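/- **Setting.** Let $\kappa$ be the horizon, $x_{k+1}=Ax_k+Bu_k+w_k$ for $k=1,\dots,\kappa$, with $A\in\mathbb R^{m\times m}$, $B\in\mathbb R^{m\times r}$, $x_1\sim\mathcal N(0,\Sigma_1)$, $w_k\sim\mathcal N(0,\Sigma_w)$, where $x_1,w_1,\dots,w_\kappa$ are independent. Let $\Omega$ be a finite set of attacker types, $\Omega^o=\Omega\cup\{\omega_o\}$ with $\omega_o\notin\Omega$ the controller of the system, and $Q^\omega\succeq O$, $R^\omega\succ O$ for $\omega\in\Omega^o$. The sensor observes the states perfectly and chooses a linear-plus-noise rule $\eta\in\Upsilon$, that is $$s_k=\sum_{j\le k}L_{k,j}'x_j+\vartheta_k\in\mathbb R^m,\qquad \vartheta_k\sim\mathcal N(0,\Theta_k),$$ with arbitrary $L_{k,j}\in\mathbb R^{m\times m}$ and $\Theta_k\succeq O$, the $\vartheta_k$ independent of each other and of $x_1,w_1,\dots,w_\kappa$. The follower uses $u_k=\gamma_k(s_1,\dots,s_k)$ with Borel measurable $\gamma_k$. Write $\|v\|_W^2=v'Wv$, and let $x^\omega,u^\omega$ be the closed-loop state and input under $\gamma^\omega$.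 A follower of type $\omega$ minimizes $U_C^\omega(\eta,\gamma)=\sum_{k=1}^\kappa \mathbb E\|x_{k+1}\|_{Q^\omega}^2+\mathbb E\|u_k\|_{R^\omega}^2$ over $\gamma$, and the objective of the sensor is $$U_S(\eta,\{\gamma^\omega\})=\max_{p\in\Delta(\Omega^o)}\Big\{\sum_{\omega\in\Omega}p_\omega\sum_{k=1}^\kappa\mathbb E\|x^\omega_{k+1}\|^2_{Q^{\omega_o}}+p_{\omega_o}\,U_C^{\omega_o}(\eta,\gamma^{\omega_o})\Big\}.$$ The problem of the sensor is to minimize $U_S(\eta,\{\gamma^\omega(\eta)\})$ over $\eta\in\Upsilon$, where $\gamma^\omega(\eta)\in\arg\min_\gamma U_C^\omega(\eta,\gamma)$ for all $\omega$ and $\eta$. A minimizing $\eta$ together with such a reaction is a Stackelberg equilibrium. **Parameters.** Let $x_1^o=x_1$, $x^o_{k+1}=Ax^o_k+w_k$, $\Sigma^o_k=\mathbb E\{x_k^o(x_k^o)'\}$ and $H_k=\mathrm{cov}\{\mathbb E\{x_k^o\mid s_1,\dots,s_k\}\}$. Let $\tilde Q^\omega_{\kappa+1}=Q^\omega$ and,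 for $k=\kappa,\dots,1$, $\Delta_k^\omega=B'\tilde Q_{k+1}^\omega B+R^\omega$, $K_k^\omega=(\Delta_k^\omega)^{-1}B'\tilde Q_{k+1}^\omega A$, $\tilde Q_k^\omega=Q^\omega+A'(\tilde Q_{k+1}^\omega-\tilde Q_{k+1}^\omega B(\Delta_k^\omega)^{-1}B'\tilde Q_{k+1}^\omega)A$. Let $\delta_0^\omega=\mathrm{Tr}\{(\tilde Q_1^\omega-Q^\omega)\Sigma_1\}+\sum_{k=1}^\kappa\mathrm{Tr}\{\tilde Q_{k+1}^\omega\Sigma_w\}$. Over the whole horizon, with blocks indexed by $k,l\in\{1,\dots,\kappa\}$, let $K^\omega,\Delta^\omega$ be block diagonal with blocks $K^\omega_k,\Delta_k^\omega$; let $\Phi^\omega$ have blocks $I$ for $l=k$, $K_k^\omega A^{k-l-1}B$ for $l<k$, $O$ for $l>k$; let $Z$ have blocks $A^{k-l}B$ for $l\le k$, $O$ for $l>k$; let $T^\omega=Z(\Phi^\omega)^{-1}K^\omega$, $\bar A=I_\kappa\otimes A$, $\bar Q=I_\kappa\otimes Q^{\omega_o}$, and let $\Sigma^o$ have blocks $\mathbb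 E\{x_k^o(x_l^o)'\}$. Let $V^{\omega_o}=-(K^{\omega_o})'\Delta^{\omega_o}K^{\omega_o}$, $\xi^{\omega_o}=\delta_0^{\omega_o}-\mathrm{Tr}\{\Sigma^oV^{\omega_o}\}$, and for $\omega\in\Omega$ let $V^\omega=(T^\omega)'\bar QT^\omega-(T^\omega)'\bar Q\bar A-\bar A'\bar QT^\omega$, $\xi^\omega=\mathrm{Tr}\{\Sigma^o\bar A'\bar Q\bar A\}+\kappa\,\mathrm{Tr}\{\Sigma_wQ^{\omega_o}\}$. Finally $\Xi_k^\omega=V_{k,k}^\omega+\sum_{l>k}\big(V_{k,l}^\omega A^{l-k}+(A^{l-k})'V_{l,k}^\omega\big)$. **Program.** Let $\varphi(S)=\max_{p\in\Delta(\Omega^o)}\sum_{\omega\in\Omega^o}p_\omega\big(\xi^\omega+\sum_{k=1}^\kappa\mathrm{Tr}\{S_k\Xi_k^\omega\}\big)$ and let $\Psi$ be the set of all $S=(S_1,\dots,S_\kappa)$ with $S_k\succeq O$, $\Sigma^o_1\succeq S_1\succeq O$ and $\Sigma^o_k\succeq S_k\succeq AS_{k-1}A'$ for $k>1$. **Construction.**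 For $S\in\Psi$ put $S_0=O$, $D_k=\Sigma_1^o$ for $k=1$ and $D_k=\Sigma^o_k-AS_{k-1}A'$ for $k>1$. Take, for every $k$, an eigen-decomposition $D_k=\bar U_k\begin{bmatrix}\bar\Lambda_k&O\\O&O\end{bmatrix}\bar U_k'$ with $\bar\Lambda_k\succ O$ diagonal of size $t_k=\mathrm{rank}\,D_k$, an eigen-decomposition $T_k=U_k\Lambda_kU_k'$, $\Lambda_k=\mathrm{diag}(\lambda_{k,1},\dots,\lambda_{k,t_k})$, of $T_k=\begin{bmatrix}\bar\Lambda_k^{-1/2}&O\end{bmatrix}\bar U_k'(S_k-AS_{k-1}A')\bar U_k\begin{bmatrix}\bar\Lambda_k^{-1/2}\\O\end{bmatrix}$, and real numbers with $\frac{(\lambda^o_{k,i})^2}{(\lambda^o_{k,i})^2+\theta_{k,i}^2}=\lambda_{k,i}$ for all $i$. The rule associated with $S$ is $s_k=L_{k,k}'x_k+\vartheta_k$ with $L_{k,k}=\bar U_k\begin{bmatrix}\bar\Lambda_k^{-1/2}U_k\Lambda_k^o&O\\O&O\end{bmatrix}$, $\Lambda_k^o=\mathrm{diag}(\lambda_{k,1}^o,\dots,\lambda^o_{k,t_k})$,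 and $\Theta_k=\mathrm{diag}(\theta_{k,1}^2,\dots,\theta_{k,t_k}^2,0,\dots,0)$. **Statement.** Best responses $\gamma^\omega(\eta)$ exist for all $\eta\in\Upsilon$ and $\omega\in\Omega^o$. For every choice of them, the problem $\min_{\eta\in\Upsilon}U_S(\eta,\{\gamma^\omega(\eta)\})$ of the sensor is equivalent to $\min_{S\in\Psi}\varphi(S)$, in the following sense. (i) For every $\eta\in\Upsilon$ and every control policy, $H=(H_1,\dots,H_\kappa)\in\Psi$ and $U_S(\eta,\{\gamma^\omega(\eta)\})=\varphi(H)$. (ii) For every $S\in\Psi$ there are rules associated with $S$, and all of them have $H=S$, whatever the control policy. (iii) Both minima are attained and they are equal. (iv) $\eta$ solves the problem of the sensor if and only if its $H$ solves $\min_{S\in\Psi}\varphi(S)$. (v) Given a solution $S$ of $\min_{S\in\Psi}\varphi(S)$, every rule associated with $S$ by the construction is optimal for the sensor. -/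

import Mathlib

open MeasureTheory ProbabilityTheory
open scoped Matrix ENNReal

noncomputable section

namespace RobustSensor

/-- Real vectors and square matrices. -/
abbrev Vec (n : ℕ) : Type := Fin n → ℝ

abbrev Mat (n : ℕ) : Type := Matrix (Fin n) (Fin n) ℝ

/-- The data of the problem: state dimension `m`, input dimension `r`, horizon `κ`, and a set `Ω` of
attacker types. The extended type set is `Option Ω`: `none` is the controller of the system
(its weights are the weights of the system) and `some ω` is the attacker of type `ω`.
Time is counted from `0`, so that stage `k : Fin κ` stands for the stage `k + 1` of `1, …, κ`. -/
structure Model (m r κ : ℕ) (Ω : Type*) where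
  A : Mat m
  B : Matrix (Fin m) (Fin r) ℝ
  /-- covariance of the initial state -/
  covInit : Mat m
  /-- covariance of the state noise -/
  covNoise : Mat m
  Q : Option Ω → Mat m
  R : Option Ω → Mat r
  covInit_posSemidef : covInit.PosSemidef
  covNoise_posSemidef : covNoise.PosSemidef
  Q_posSemidef : ∀ ω, (Q ω).PosSemidef
  R_posDef : ∀ ω, (R ω).PosDef

/-- A linear-plus-noise signaling rule under perfect measurements,
`s_k = ∑_{j ≤ k} L_{k,j}ᵀ x_j + ϑ_k` with `ϑ_k ∼ N(0, Θ_k)`: the gains `L_{k,j}`, `j ≤ k`,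
are arbitrary and the covariances `Θ_k` are arbitrary positive semi-definite matrices. -/
structure SignalRule (m κ : ℕ) where
  gain : (k : Fin κ) → Fin (k.val + 1) → Mat m
  noiseCov : Fin κ → Mat m
  noiseCov_posSemidef : ∀ k, (noiseCov k).PosSemidef

/-- A control policy: `u_k = γ_k(s_1, …, s_k)` with `γ_k` any Borel measurable function. -/
structure ControlPolicy (m r κ : ℕ) where
  act : (k : Fin κ) → (Fin (k.val + 1) → Vec m) → Vec r
  measurable_act : ∀ k, Measurable (act k)

/-- `N(0, S)` on column vectors. -/
def gaussian {m : ℕ} (S : Mat m) : Measure (Vec m) :=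
  (multivariateGaussian (0 : EuclideanSpace ℝ (Fin m)) S).map (WithLp.ofLp : _ → Vec m)

/-- Realizations of the initial state and of the state noise `(x_1, (w_k)_k)`. -/
abbrev Base (m κ : ℕ) : Type := Vec m × (Fin κ → Vec m)

/-- Realizations of all the randomness: `((x_1, (w_k)_k), (ϑ_k)_k)`. -/
abbrev Sample (m κ : ℕ) : Type := Base m κ × (Fin κ → Vec m)

section process

variable {m r κ : ℕ} {Ω : Type*} (M : Model m r κ Ω)

/-- Law of `(x_1, w)`: all components are independent, `x_1 ∼ N(0, Σ_1)`, `w_k ∼ N(0, Σ_w)`. -/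
def baseLaw : Measure (Base m κ) :=
  (gaussian M.covInit).prod (Measure.pi fun _ => gaussian M.covNoise)

/-- Law of all the randomness under a signaling rule: the `ϑ_k ∼ N(0, Θ_k)` are independent of
each other and of `(x_1, w)`. -/
def law (η : SignalRule m κ) : Measure (Sample m κ) :=
  (baseLaw M).prod (Measure.pi fun k => gaussian (η.noiseCov k))

/-- The signal of stage `k`, given the states `x_j`, `j ≤ k`, and the noise `ϑ_k`. -/
def encode (η : SignalRule m κ) (k : Fin κ) (x : Fin (k.val + 1) → Vec m) (th : Vec m) : Vec m :=
  (∑ j, (η.gain k j)ᵀ *ᵥ x j) + th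

/-- The closed-loop state `x_{k+1} = A x_k + B u_k + w_k`, `u_k = γ_k(s_1, …, s_k)`,
for the times `0, …, κ` (which stand for `1, …, κ + 1`). -/
def state (η : SignalRule m κ) (γ : ControlPolicy m r κ) (z : Sample m κ) :
    (k : ℕ) → k ≤ κ → Vec m
  | 0, _ => z.1.1
  | k + 1, hk =>
      M.A *ᵥ state η γ z k (Nat.le_of_succ_le hk)
      + M.B *ᵥ γ.act ⟨k, hk⟩ (fun j : Fin (k + 1) =>
          encode η ⟨j.val, lt_of_le_of_lt (Nat.le_of_lt_succ j.isLt) hk⟩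
            (fun i => state η γ z i.val
              ((Nat.le_of_lt_succ i.isLt).trans
                ((Nat.le_of_lt_succ j.isLt).trans (Nat.le_of_succ_le hk))))
            (z.2 ⟨j.val, lt_of_le_of_lt (Nat.le_of_lt_succ j.isLt) hk⟩))
      + z.1.2 ⟨k, hk⟩
  termination_by k => k
  decreasing_by
    · exact Nat.lt_succ_self k
    · exact lt_of_le_of_lt (Nat.le_of_lt_succ i.isLt) j.isLt

/-- The closed-loop signal `s_k`. -/
def signal (η : SignalRule m κ) (γ : ControlPolicy m r κ) (z : Sample m κ) (k : Fin κ) : Vec m :=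
  encode η k
    (fun i => state M η γ z i.val ((Nat.le_of_lt_succ i.isLt).trans k.isLt.le)) (z.2 k)

/-- The signals `s_1, …, s_k`. -/
def signalHistory (η : SignalRule m κ) (γ : ControlPolicy m r κ) (k : Fin κ) (z : Sample m κ) :
    Fin (k.val + 1) → Vec m :=
  fun j => signal M η γ z ⟨j.val, lt_of_le_of_lt (Nat.le_of_lt_succ j.isLt) k.isLt⟩

/-- The closed-loop control input `u_k = γ_k(s_1, …, s_k)`. -/
def controlInput (η : SignalRule m κ) (γ : ControlPolicy m r κ) (z : Sample m κ) (k : Fin κ) : Vec r :=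
  γ.act k (signalHistory M η γ k z)

/-- The state after stage `k`, that is `x_{k+1}`. -/
def nextState (η : SignalRule m κ) (γ : ControlPolicy m r κ) (z : Sample m κ) (k : Fin κ) :
    Vec m :=
  state M η γ z (k.val + 1) k.isLt

/-- The control-free state: `x^o_1 = x_1` and `x^o_{k+1} = A x^o_k + w_k`. -/
def freeStateAux (b : Base m κ) : (k : ℕ) → k < κ → Vec m
  | 0, _ => b.1
  | k + 1, hk =>
      M.A *ᵥ freeStateAux b k (Nat.lt_of_succ_lt hk) + b.2 ⟨k, Nat.lt_of_succ_lt hk⟩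

def freeState (b : Base m κ) (k : Fin κ) : Vec m := freeStateAux M b k.val k.isLt

/-- The posterior `E{x^o_k | s_1, …, s_k}`, coordinate by coordinate. -/
def posterior (η : SignalRule m κ) (γ : ControlPolicy m r κ) (k : Fin κ) (i : Fin m) :
    Sample m κ → ℝ :=
  (law M η)[fun z => freeState M z.1 k i |
    MeasurableSpace.comap (signalHistory M η γ k) inferInstance]

/-- `H_k = cov{E{x^o_k | s_1, …, s_k}}`. -/
def posteriorCov (η : SignalRule m κ) (γ : ControlPolicy m r κ) (k : Fin κ) : Mat m :=
  Matrix.of fun i j => cov[posterior M η γ k i, posterior M η γ k j; law M η]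

end process

section game

variable {m r κ : ℕ} {Ω : Type*} (M : Model m r κ Ω)

/-- `E‖X‖²_W` as an extended nonnegative real; it is used for positive semi-definite `W` only,
and it is `∞` exactly if `‖X‖²_W` is not integrable. -/
def meanQuad {S : Type*} [MeasurableSpace S] {n : ℕ} (P : Measure S) (W : Mat n) (X : S → Vec n) :
    ℝ≥0∞ :=
  ∫⁻ z, ENNReal.ofReal (X z ⬝ᵥ W *ᵥ X z) ∂P

/-- The objective of the player C of type `ω`. -/
def followerCost (ω : Option Ω) (η : SignalRule m κ) (γ : ControlPolicy m r κ) : ℝ≥0∞ :=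
  ∑ k : Fin κ, (meanQuad (law M η) (M.Q ω) (fun z => nextState M η γ z k)
    + meanQuad (law M η) (M.R ω) (fun z => controlInput M η γ z k))

/-- The cost that the sensor incurs when a player C of the given type uses the policy `γ`:
the full objective of the system for the controller, its state part for an attacker. -/
def sensorTypeCost (η : SignalRule m κ) (γ : ControlPolicy m r κ) : Option Ω → ℝ≥0∞
  | none => followerCost M none η γ
  | some _ => ∑ k : Fin κ, meanQuad (law M η) (M.Q none) (fun z => nextState M η γ z k)

/-- The objective of the sensor: the worst case over all distributions `p` on the extended
type set (which is finite, so that the supremum is a maximum). -/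
def sensorCost [Fintype Ω] (η : SignalRule m κ) (γ : Option Ω → ControlPolicy m r κ) : ℝ≥0∞ :=
  ⨆ p : stdSimplex ℝ (Option Ω), ∑ ω, ENNReal.ofReal (p.1 ω) * sensorTypeCost M η (γ ω) ω

/-- `γ` is a best response of the type `ω` to the signaling rule `η`. -/
def IsBestResponse (ω : Option Ω) (η : SignalRule m κ) (γ : ControlPolicy m r κ) : Prop :=
  ∀ γ' : ControlPolicy m r κ, followerCost M ω η γ ≤ followerCost M ω η γ'

/-- A reaction of the follower: every type answers every signaling rule by a best response. -/
def IsReaction (g : SignalRule m κ → Option Ω → ControlPolicy m r κ) : Prop :=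
  ∀ η ω, IsBestResponse M ω η (g η ω)

/-- Stackelberg equilibrium of the robust sensor design game, the sensor being the leader. -/
def IsEquilibrium [Fintype Ω] (η : SignalRule m κ)
    (g : SignalRule m κ → Option Ω → ControlPolicy m r κ) : Prop :=
  IsReaction M g ∧ ∀ η', sensorCost M η (g η) ≤ sensorCost M η' (g η')

end game

section parameters

variable {m r κ : ℕ} {Ω : Type*} (M : Model m r κ Ω)

/-- The Riccati recursion, run backwards from the final time. -/
def riccatiAux (ω : Option Ω) : ℕ → Mat m
  | 0 => M.Q ω
  | j + 1 =>
      let P := riccatiAux ω j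
      M.Q ω + M.Aᵀ * (P - P * M.B * (M.Bᵀ * P * M.B + M.R ω)⁻¹ * M.Bᵀ * P) * M.A

/-- `riccati M ω k`, `k = 0, …, κ`, stands for `Q̃_{k+1}^ω`; the last one is `Q^ω`. -/
def riccati (ω : Option Ω) (k : ℕ) : Mat m := riccatiAux M ω (κ - k)

/-- `Δ_k^ω`. -/
def delta (ω : Option Ω) (k : Fin κ) : Mat r :=
  M.Bᵀ * riccati M ω (k.val + 1) * M.B + M.R ω

/-- `K_k^ω`. -/
def feedback (ω : Option Ω) (k : Fin κ) : Matrix (Fin r) (Fin m) ℝ :=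
  (delta M ω k)⁻¹ * M.Bᵀ * riccati M ω (k.val + 1) * M.A

/-- `δ_0^ω = Tr{(Q̃_1 - Q)Σ_1} + ∑_k Tr{Q̃_{k+1}Σ_w}`, the minimal cost of the type `ω` when it
observes the state. -/
def delta0 (ω : Option Ω) : ℝ :=
  ((riccati M ω 0 - M.Q ω) * M.covInit).trace
    + ∑ k : Fin κ, (riccati M ω (k.val + 1) * M.covNoise).trace

/-! Matrices that act on the augmented vectors of the whole horizon; the blocks are indexed by
the stages `k : Fin κ` themselves. -/

/-- `Φ^ω`, with blocks `I` for `k = l`, `K_k A^{k-l-1} B` for `l < k`. -/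
def bigPhi (ω : Option Ω) : Matrix (Fin κ × Fin r) (Fin κ × Fin r) ℝ :=
  Matrix.of fun a b =>
    if a.1 = b.1 then (1 : Mat r) a.2 b.2
    else if b.1 < a.1 then
      (feedback M ω a.1 * M.A ^ (a.1.val - b.1.val - 1) * M.B) a.2 b.2
    else 0

/-- The block diagonal matrix of the `K_k^ω`. -/
def bigK (ω : Option Ω) : Matrix (Fin κ × Fin r) (Fin κ × Fin m) ℝ :=
  Matrix.of fun a b => if a.1 = b.1 then feedback M ω a.1 a.2 b.2 else 0

/-- The block diagonal matrix of the `Δ_k^ω`. -/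
def bigDelta (ω : Option Ω) : Matrix (Fin κ × Fin r) (Fin κ × Fin r) ℝ :=
  Matrix.of fun a b => if a.1 = b.1 then delta M ω a.1 a.2 b.2 else 0

/-- `Z`, with blocks `A^{k-l} B` for `l ≤ k`. -/
def bigZ : Matrix (Fin κ × Fin m) (Fin κ × Fin r) ℝ :=
  Matrix.of fun a b =>
    if b.1 ≤ a.1 then (M.A ^ (a.1.val - b.1.val) * M.B) a.2 b.2 else 0

/-- `I_κ ⊗ X`. -/
def bigDiag (X : Mat m) : Matrix (Fin κ × Fin m) (Fin κ × Fin m) ℝ :=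
  Matrix.kroneckerMap (· * ·) (1 : Mat κ) X

/-- `T^ω = Z (Φ^ω)⁻¹ K^ω`. -/
def bigT (ω : Option Ω) : Matrix (Fin κ × Fin m) (Fin κ × Fin m) ℝ :=
  bigZ M * (bigPhi M ω)⁻¹ * bigK M ω

/-- `Σ^o = E{x^o (x^o)ᵀ}` for the augmented control-free state. -/
def bigSigma : Matrix (Fin κ × Fin m) (Fin κ × Fin m) ℝ :=
  Matrix.of fun a b =>
    ∫ z, freeState M z a.1 a.2 * freeState M z b.1 b.2 ∂(baseLaw M)

/-- `Σ^o_k = E{x^o_k (x^o_k)ᵀ}`. -/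
def freeCov (k : Fin κ) : Mat m :=
  Matrix.of fun i j => ∫ z, freeState M z k i * freeState M z k j ∂(baseLaw M)

/-- `V^ω`. -/
def bigV : Option Ω → Matrix (Fin κ × Fin m) (Fin κ × Fin m) ℝ
  | none => -((bigK M none)ᵀ * bigDelta M none * bigK M none)
  | some ω =>
      (bigT M (some ω))ᵀ * bigDiag (M.Q none) * bigT M (some ω)
        - (bigT M (some ω))ᵀ * bigDiag (M.Q none) * bigDiag M.A
        - (bigDiag M.A)ᵀ * bigDiag (M.Q none) * bigT M (some ω)

/-- The block `V^ω_{k,l}`. -/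
def blockV (ω : Option Ω) (k l : Fin κ) : Mat m :=
  Matrix.of fun i j => bigV M ω (k, i) (l, j)

/-- `Ξ^ω_k = V^ω_{k,k} + ∑_{l > k} (V^ω_{k,l} A^{l-k} + (A^{l-k})ᵀ V^ω_{l,k})`. -/
def Xi (ω : Option Ω) (k : Fin κ) : Mat m :=
  blockV M ω k k + ∑ l ∈ Finset.Ioi k,
    (blockV M ω k l * M.A ^ (l.val - k.val) + (M.A ^ (l.val - k.val))ᵀ * blockV M ω l k)

/-- The scalar `ξ^ω`. -/
def xi : Option Ω → ℝ
  | none => delta0 M none - (bigSigma M * bigV M none).trace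
  | some _ =>
      (bigSigma M * (bigDiag M.A)ᵀ * bigDiag (M.Q none) * bigDiag M.A).trace
        + (κ : ℝ) * (M.covNoise * M.Q none).trace

end parameters

section program

variable {m r κ : ℕ} {Ω : Type*} (M : Model m r κ Ω)

/-- `A S_{k-1} Aᵀ`, and `O` at the first stage. -/
def predicted (S : Fin κ → Mat m) (k : Fin κ) : Mat m :=
  if k.val = 0 then 0
  else M.A * S ⟨k.val - 1, lt_of_le_of_lt (Nat.sub_le _ _) k.isLt⟩ * M.Aᵀ

/-- The constraints: `S_k ⪰ O`, `Σ^o_1 ⪰ S_1 ⪰ O` and `Σ^o_k ⪰ S_k ⪰ A S_{k-1} Aᵀ`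
for the later stages. -/
def Feasible : Set (Fin κ → Mat m) :=
  {S | ∀ k, (S k).PosSemidef ∧ (freeCov M k - S k).PosSemidef
    ∧ (S k - predicted M S k).PosSemidef}

/-- `max_p ∑_ω p_ω (ξ^ω + ∑_k Tr{S_k Ξ_k^ω})`, a maximum since the type set is finite. -/
def programValue [Fintype Ω] (S : Fin κ → Mat m) : ℝ :=
  ⨆ p : stdSimplex ℝ (Option Ω), ∑ ω, p.1 ω * (xi M ω + ∑ k, (S k * Xi M ω k).trace)

/-- `S` is a solution of the minimization of `programValue` over the feasible set. -/
def IsSolution [Fintype Ω] (S : Fin κ → Mat m) : Prop :=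
  S ∈ Feasible M ∧ ∀ S' ∈ Feasible M, programValue M S ≤ programValue M S'

/-- The index set of an `m × m` matrix, split after the first `t` indices. -/
def splitIndex {t q m : ℕ} (h : t + q = m) : Fin t ⊕ Fin q ≃ Fin m :=
  finSumFinEquiv.trans (finCongr h)

/-- The `m × m` matrix `[X O; O O]`. -/
def pad {t q m : ℕ} (h : t + q = m) (X : Mat t) : Mat m :=
  Matrix.reindex (splitIndex h) (splitIndex h) (Matrix.fromBlocks X 0 0 0)

/-- The upper left `t × t` block of an `m × m` matrix. -/
def topLeft {t q m : ℕ} (h : t + q = m) (X : Mat m) : Mat t :=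
  (Matrix.reindex (splitIndex h).symm (splitIndex h).symm X).toBlocks₁₁

/-- The pair `L_{k,k}`, `Θ_k` is obtained from `D = Σ^o_k - A S_{k-1} Aᵀ` and
`E = S_k - A S_{k-1} Aᵀ` by the explicit construction: with eigen-decompositions
`D = Ū [Λ̄ O; O O] Ūᵀ`, `Λ̄` positive of size `t = rank D`, and `T = U Λ Uᵀ` for
`T = [Λ̄^{-1/2} O] Ūᵀ E Ū [Λ̄^{-1/2}; O]`, and numbers `λ^o_i`, `θ_i` with
`(λ^o_i)² / ((λ^o_i)² + θ_i²) = λ_i`, one has `L_{k,k} = Ū [Λ̄^{-1/2} U Λ^o O; O O]` and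
`Θ_k = diag(θ_1², …, θ_t², 0, …, 0)`. -/
def IsStageSignal (D E L Th : Mat m) : Prop :=
  ∃ (t q : ℕ) (h : t + q = m)
    (Ubar : Mat m) (lamBar : Fin t → ℝ) (U : Mat t) (lam lamO θ : Fin t → ℝ),
    t = D.rank ∧
    Ubar ∈ Matrix.orthogonalGroup (Fin m) ℝ ∧
    (∀ i, 0 < lamBar i) ∧
    D = Ubar * pad h (Matrix.diagonal lamBar) * Ubarᵀ ∧
    U ∈ Matrix.orthogonalGroup (Fin t) ℝ ∧
    Matrix.diagonal (fun i => (√(lamBar i))⁻¹) * topLeft h (Ubarᵀ * E * Ubar)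
        * Matrix.diagonal (fun i => (√(lamBar i))⁻¹)
      = U * Matrix.diagonal lam * Uᵀ ∧
    (∀ i, lamO i ^ 2 + θ i ^ 2 ≠ 0 ∧ lamO i ^ 2 / (lamO i ^ 2 + θ i ^ 2) = lam i) ∧
    L = Ubar * pad h (Matrix.diagonal (fun i => (√(lamBar i))⁻¹) * U * Matrix.diagonal lamO) ∧
    Th = pad h (Matrix.diagonal fun i => θ i ^ 2)

/-- The signaling rule `η` is `s_k = L_{k,k}ᵀ x_k + ϑ_k`, with `L_{k,k}` and the covariance of
`ϑ_k` obtained from `S` by the explicit construction. -/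
def IsAssociatedRule (S : Fin κ → Mat m) (η : SignalRule m κ) : Prop :=
  ∀ k : Fin κ,
    (∀ j : Fin (k.val + 1), j ≠ Fin.last k.val → η.gain k j = 0) ∧
    IsStageSignal (freeCov M k - predicted M S k) (S k - predicted M S k)
      (η.gain k (Fin.last k.val)) (η.noiseCov k)

end program

end RobustSensor

end

/-!
Linear signals carry the same information as the signals that are seen when the input vanishes, so
the estimation errors do not depend on the policy. Completing squares along the Riccati recursion
then shows that the certainty-equivalent linear feedback is the almost surely unique best response;
its cost to the sensor is affine in the posterior covariances `H_k`, and the sensor's objective is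
the maximum of these affine functions over the types. Orthogonality of the estimation errors to the
past gives `Σ°_k ⪰ H_k ⪰ A H_{k-1} Aᵀ`. Conversely, if a memoryless rule is built from the spectral
decomposition of `S_k - A S_{k-1} Aᵀ`, then its innovation over the prediction from the past signals
is Gaussian and raises the posterior covariance from `A S_{k-1} Aᵀ` to exactly `S_k`. Minima exist
because the feasible set is compact and a supremum of continuous functions is lower semicontinuous.
-/

open MeasureTheory ProbabilityTheory
open scoped Matrix ENNReal

noncomputable section

namespace RobustSensor

/-! ### Second moments and conditional expectations -/

section posSemidef

variable {ι : Type*} {W X Y : Matrix ι ι ℝ}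

lemma transpose_eq_of_posSemidef (hW : W.PosSemidef) : Wᵀ = W := by
  rw [← Matrix.conjTranspose_eq_transpose_of_trivial, hW.isHermitian.eq]

variable [Fintype ι]

open scoped MatrixOrder in
lemma trace_mul_nonneg_of_posSemidef (hX : X.PosSemidef) (hY : Y.PosSemidef) :
    0 ≤ (X * Y).trace := by
  classical
  obtain ⟨C, rfl⟩ := CStarAlgebra.nonneg_iff_eq_star_mul_self.mp hX.nonneg
  rw [Matrix.star_eq_conjTranspose, Matrix.mul_assoc, Matrix.trace_mul_comm]
  exact (hY.mul_mul_conjTranspose_same C).trace_nonneg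

lemma posSemidef_transpose_mul_mul {ι' : Type*} [Finite ι'] (hW : W.PosSemidef)
    (C : Matrix ι ι' ℝ) : (Cᵀ * W * C).PosSemidef := by
  rw [← Matrix.conjTranspose_eq_transpose_of_trivial]
  exact hW.conjTranspose_mul_mul_same C

variable [DecidableEq ι]

lemma mul_inv_of_posDef (hW : W.PosDef) : W * W⁻¹ = 1 :=
  Matrix.mul_nonsing_inv W hW.det_pos.ne'.isUnit

/- The form of `W` is nonnegative at `x - t W⁻¹ eᵢ` for every `t`, so that its discriminant as a
quadratic polynomial of `t` is not positive. -/
lemma sq_apply_le_of_posDef (hW : W.PosDef) (x : ι → ℝ) (i : ι) :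
    x i ^ 2 ≤ W⁻¹ i i * (x ⬝ᵥ W *ᵥ x) := by
  set v : ι → ℝ := W⁻¹ *ᵥ Pi.single i 1
  have hv : W *ᵥ v = Pi.single i 1 := by
    rw [Matrix.mulVec_mulVec, mul_inv_of_posDef hW, Matrix.one_mulVec]
  have hvx : v ⬝ᵥ W *ᵥ x = x i := by
    rw [Matrix.dotProduct_mulVec, ← Matrix.mulVec_transpose,
      transpose_eq_of_posSemidef hW.posSemidef, hv, single_one_dotProduct]
  have hvi : v i = W⁻¹ i i := by simp [v]
  have hquad : ∀ t : ℝ, 0 ≤ W⁻¹ i i * (t * t) + (-2 * x i) * t + x ⬝ᵥ W *ᵥ x := fun t => by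
    have h := hW.posSemidef.dotProduct_mulVec_nonneg (x - t • v)
    simp only [star_trivial, Matrix.mulVec_sub, Matrix.mulVec_smul, hv, sub_dotProduct,
      dotProduct_sub, smul_dotProduct, dotProduct_smul, hvx, dotProduct_single_one, Pi.sub_apply,
      Pi.smul_apply, hvi, smul_eq_mul] at h
    linarith
  have h := discrim_le_zero hquad
  rw [discrim] at h
  linarith

end posSemidef

section moments

variable {S : Type*} {G : MeasurableSpace S} [mS : MeasurableSpace S] {P : Measure S}
  {ι ι' ι'' : Type*}

/-- A random vector with square integrable coordinates. -/
def SquareIntegrable (P : Measure S) (X : S → ι → ℝ) : Prop :=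
  ∀ i, MemLp (fun z => X z i) 2 P

/-- The cross moment matrix `E{X Yᵀ}` (not centered). -/
def crossMoment (P : Measure S) (X : S → ι → ℝ) (Y : S → ι' → ℝ) : Matrix ι ι' ℝ :=
  Matrix.of fun i j => ∫ z, X z i * Y z j ∂P

namespace SquareIntegrable

variable {X Y : S → ι → ℝ}

lemma add (hX : SquareIntegrable P X) (hY : SquareIntegrable P Y) :
    SquareIntegrable P (fun z => X z + Y z) := fun i => (hX i).add (hY i)

lemma sub (hX : SquareIntegrable P X) (hY : SquareIntegrable P Y) :
    SquareIntegrable P (fun z => X z - Y z) := fun i => (hX i).sub (hY i)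

lemma neg (hX : SquareIntegrable P X) : SquareIntegrable P (fun z => -X z) :=
  fun i => (hX i).neg

lemma sum {α : Type*} {s : Finset α} {X : α → S → ι → ℝ}
    (hX : ∀ a ∈ s, SquareIntegrable P (X a)) :
    SquareIntegrable P (fun z => ∑ a ∈ s, X a z) := fun i => by
  simp only [Finset.sum_apply]
  exact memLp_finsetSum _ fun a ha => hX a ha i

lemma mulVec [Fintype ι] (hX : SquareIntegrable P X) (A : Matrix ι' ι ℝ) :
    SquareIntegrable P (fun z => A *ᵥ X z) := fun i => by
  simp only [Matrix.mulVec, dotProduct]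
  exact memLp_finsetSum _ fun j _ => (hX j).const_mul _

lemma comp_measurePreserving {S' : Type*} [MeasurableSpace S'] {P' : Measure S'}
    (hX : SquareIntegrable P X) {τ : S' → S} (hτ : MeasurePreserving τ P' P) :
    SquareIntegrable P' (fun z => X (τ z)) := fun i => (hX i).comp_measurePreserving hτ

lemma integrable_mul {Y : S → ι' → ℝ} (hX : SquareIntegrable P X) (hY : SquareIntegrable P Y)
    (i : ι) (j : ι') : Integrable (fun z => X z i * Y z j) P :=
  (hX i).integrable_mul (hY j)

end SquareIntegrable

section crossMoment

variable {X X' : S → ι → ℝ} {Y Y' : S → ι' → ℝ}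

lemma crossMoment_apply (X : S → ι → ℝ) (Y : S → ι' → ℝ) (i : ι) (j : ι') :
    crossMoment P X Y i j = ∫ z, X z i * Y z j ∂P := rfl

lemma crossMoment_transpose (X : S → ι → ℝ) (Y : S → ι' → ℝ) :
    (crossMoment P X Y)ᵀ = crossMoment P Y X := by
  ext i j
  simp only [Matrix.transpose_apply, crossMoment_apply, mul_comm]

lemma crossMoment_eq_zero_comm : crossMoment P X Y = 0 ↔ crossMoment P Y X = 0 := by
  rw [← crossMoment_transpose, Matrix.transpose_eq_zero]

lemma crossMoment_congr (hX : X =ᵐ[P] X') (hY : Y =ᵐ[P] Y') :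
    crossMoment P X Y = crossMoment P X' Y' := by
  ext i j
  refine integral_congr_ae ?_
  filter_upwards [hX, hY] with z hXz hYz
  rw [hXz, hYz]

lemma crossMoment_comp_measurePreserving {S' : Type*} [MeasurableSpace S'] {P' : Measure S'}
    {τ : S' → S} (hτ : MeasurePreserving τ P' P) (hX : SquareIntegrable P X)
    (hY : SquareIntegrable P Y) :
    crossMoment P' (fun z => X (τ z)) (fun z => Y (τ z)) = crossMoment P X Y := by
  ext i j
  rw [crossMoment_apply, crossMoment_apply, ← hτ.map_eq, integral_map hτ.aemeasurable]
  rw [hτ.map_eq]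
  exact (hX.integrable_mul hY i j).aestronglyMeasurable

lemma crossMoment_zero_right : crossMoment P X (fun _ => (0 : ι' → ℝ)) = 0 := by
  ext i j
  simp [crossMoment_apply]

lemma crossMoment_neg_left : crossMoment P (fun z => -X z) Y = -crossMoment P X Y := by
  ext i j
  simp [crossMoment_apply, integral_neg]

lemma crossMoment_add_left (hX : SquareIntegrable P X) (hX' : SquareIntegrable P X')
    (hY : SquareIntegrable P Y) :
    crossMoment P (fun z => X z + X' z) Y = crossMoment P X Y + crossMoment P X' Y := by
  ext i j
  simp only [crossMoment_apply, Matrix.add_apply, Pi.add_apply, add_mul]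
  exact integral_add (hX.integrable_mul hY i j) (hX'.integrable_mul hY i j)

lemma crossMoment_sub_left (hX : SquareIntegrable P X) (hX' : SquareIntegrable P X')
    (hY : SquareIntegrable P Y) :
    crossMoment P (fun z => X z - X' z) Y = crossMoment P X Y - crossMoment P X' Y := by
  simp only [sub_eq_add_neg]
  rw [crossMoment_add_left hX hX'.neg hY, crossMoment_neg_left]

lemma crossMoment_add_right (hX : SquareIntegrable P X) (hY : SquareIntegrable P Y)
    (hY' : SquareIntegrable P Y') :
    crossMoment P X (fun z => Y z + Y' z) = crossMoment P X Y + crossMoment P X Y' := by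
  rw [← crossMoment_transpose, crossMoment_add_left hY hY' hX, Matrix.transpose_add]
  simp only [crossMoment_transpose]

lemma crossMoment_sub_right (hX : SquareIntegrable P X) (hY : SquareIntegrable P Y)
    (hY' : SquareIntegrable P Y') :
    crossMoment P X (fun z => Y z - Y' z) = crossMoment P X Y - crossMoment P X Y' := by
  rw [← crossMoment_transpose, crossMoment_sub_left hY hY' hX, Matrix.transpose_sub]
  simp only [crossMoment_transpose]

lemma crossMoment_add_self (hX : SquareIntegrable P X) (hX' : SquareIntegrable P X') :
    crossMoment P (fun z => X z + X' z) (fun z => X z + X' z) = crossMoment P X X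
      + crossMoment P X X' + (crossMoment P X X')ᵀ + crossMoment P X' X' := by
  rw [crossMoment_add_left hX hX' (hX.add hX'), crossMoment_add_right hX hX hX',
    crossMoment_add_right hX' hX hX', crossMoment_transpose]
  abel

lemma crossMoment_add_self_of_uncorrelated (hX : SquareIntegrable P X)
    (hX' : SquareIntegrable P X') (h : crossMoment P X' X = 0) :
    crossMoment P (fun z => X z + X' z) (fun z => X z + X' z)
      = crossMoment P X X + crossMoment P X' X' := by
  rw [crossMoment_add_self hX hX', crossMoment_eq_zero_comm.mp h, Matrix.transpose_zero, add_zero,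
    add_zero]

lemma crossMoment_mulVec_left [Fintype ι] (hX : SquareIntegrable P X)
    (hY : SquareIntegrable P Y) (A : Matrix ι'' ι ℝ) :
    crossMoment P (fun z => A *ᵥ X z) Y = A * crossMoment P X Y := by
  ext i j
  simp only [crossMoment_apply, Matrix.mul_apply, Matrix.mulVec, dotProduct, Finset.sum_mul]
  rw [integral_finsetSum]
  · simp only [mul_assoc, integral_const_mul]
  · intro a _
    simp only [mul_assoc]
    exact (hX.integrable_mul hY a j).const_mul _

lemma crossMoment_mulVec_right [Fintype ι'] (hX : SquareIntegrable P X)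
    (hY : SquareIntegrable P Y) (A : Matrix ι'' ι' ℝ) :
    crossMoment P X (fun z => A *ᵥ Y z) = crossMoment P X Y * Aᵀ := by
  rw [← crossMoment_transpose, crossMoment_mulVec_left hY hX, Matrix.transpose_mul,
    crossMoment_transpose]

lemma crossMoment_mulVec_self [Fintype ι] (hX : SquareIntegrable P X) (A : Matrix ι' ι ℝ) :
    crossMoment P (fun z => A *ᵥ X z) (fun z => A *ᵥ X z) = A * crossMoment P X X * Aᵀ := by
  rw [crossMoment_mulVec_left hX (hX.mulVec A), crossMoment_mulVec_right hX hX, Matrix.mul_assoc]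

lemma crossMoment_eq_zero_of_flip {τ : S → S} (hτ : MeasurePreserving τ P P)
    (hX : SquareIntegrable P X) (hY : SquareIntegrable P Y) (hXτ : ∀ z, X (τ z) = -X z)
    (hYτ : ∀ z, Y (τ z) = Y z) : crossMoment P X Y = 0 := by
  have h := crossMoment_comp_measurePreserving hτ hX hY
  simp only [hXτ, hYτ, crossMoment_neg_left] at h
  exact Matrix.ext fun i j => neg_eq_self.mp (congrFun₂ h i j)

end crossMoment

section quadratic

variable [Fintype ι] {X : S → ι → ℝ}

lemma integrable_dotProduct_mulVec [Fintype ι'] {Y : S → ι' → ℝ} (hX : SquareIntegrable P X)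
    (hY : SquareIntegrable P Y) (W : Matrix ι ι' ℝ) :
    Integrable (fun z => X z ⬝ᵥ W *ᵥ Y z) P := by
  simp only [dotProduct]
  exact integrable_finsetSum _ fun i _ => hX.integrable_mul (hY.mulVec W) i i

lemma integral_dotProduct_mulVec [Fintype ι'] {Y : S → ι' → ℝ} (hX : SquareIntegrable P X)
    (hY : SquareIntegrable P Y) (W : Matrix ι ι' ℝ) :
    ∫ z, X z ⬝ᵥ W *ᵥ Y z ∂P = (W * crossMoment P Y X).trace := by
  rw [← crossMoment_mulVec_left hY hX]
  simp only [dotProduct, Matrix.trace, Matrix.diag_apply, crossMoment_apply]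
  rw [integral_finsetSum _ fun i _ => hX.integrable_mul (hY.mulVec W) i i]
  simp only [mul_comm]

omit [Fintype ι] in
lemma posSemidef_crossMoment_self [Finite ι] (hX : SquareIntegrable P X) :
    (crossMoment P X X).PosSemidef := by
  have := Fintype.ofFinite ι
  refine Matrix.PosSemidef.of_dotProduct_mulVec_nonneg ?_ fun v => ?_
  · rw [Matrix.IsHermitian, Matrix.conjTranspose_eq_transpose_of_trivial, crossMoment_transpose]
  · have hsq : star v ⬝ᵥ crossMoment P X X *ᵥ v = ∫ z, X z ⬝ᵥ Matrix.vecMulVec v v *ᵥ X z ∂P := by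
      rw [integral_dotProduct_mulVec hX hX, Matrix.trace_mul_comm, Matrix.mul_vecMulVec,
        Matrix.trace_vecMulVec, star_trivial, dotProduct_comm]
    rw [hsq]
    refine integral_nonneg fun z => ?_
    simpa using (Matrix.posSemidef_vecMulVec_self_star v).dotProduct_mulVec_nonneg (X z)

lemma ae_eq_zero_of_trace_eq_zero {W : Matrix ι ι ℝ} (hW : W.PosDef)
    (hX : SquareIntegrable P X) (h : (W * crossMoment P X X).trace = 0) :
    X =ᵐ[P] fun _ => 0 := by
  classical
  rw [← integral_dotProduct_mulVec hX hX W, integral_eq_zero_iff_of_nonneg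
    (fun z => by simpa using hW.posSemidef.dotProduct_mulVec_nonneg (X z))
    (integrable_dotProduct_mulVec hX hX W)] at h
  filter_upwards [h] with z hz
  ext i
  have hi := sq_apply_le_of_posDef hW (X z) i
  rw [hz, Pi.zero_apply, mul_zero] at hi
  exact sq_nonpos_iff _ |>.mp hi

end quadratic

section meanQuad

variable {n : ℕ} {W : Mat n} {X : S → Vec n}

lemma meanQuad_eq (hW : W.PosSemidef) (hX : SquareIntegrable P X) :
    meanQuad P W X = ENNReal.ofReal (W * crossMoment P X X).trace := by
  rw [meanQuad, ← integral_dotProduct_mulVec hX hX W,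
    ofReal_integral_eq_lintegral_ofReal (integrable_dotProduct_mulVec hX hX W)]
  exact Filter.Eventually.of_forall fun z => by
    simpa using hW.dotProduct_mulVec_nonneg (X z)

lemma SquareIntegrable.of_meanQuad_ne_top (hW : W.PosDef) (hX : Measurable X)
    (h : meanQuad P W X ≠ ⊤) : SquareIntegrable P X := by
  have hquad : Integrable (fun z => X z ⬝ᵥ W *ᵥ X z) P := by
    refine ⟨(by fun_prop : Continuous fun x : Vec n => x ⬝ᵥ W *ᵥ x).measurable.comp hX
      |>.aestronglyMeasurable, ?_⟩
    rw [hasFiniteIntegral_iff_ofReal (Filter.Eventually.of_forall fun z => by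
      simpa using hW.posSemidef.dotProduct_mulVec_nonneg (X z))]
    exact lt_top_iff_ne_top.mpr h
  intro i
  have hXi : Measurable fun z => X z i := (measurable_pi_apply i).comp hX
  rw [memLp_two_iff_integrable_sq hXi.aestronglyMeasurable]
  refine (hquad.const_mul (W⁻¹ i i)).mono' (hXi.pow_const 2).aestronglyMeasurable
    (Filter.Eventually.of_forall fun z => ?_)
  rw [Real.norm_of_nonneg (sq_nonneg _)]
  exact sq_apply_le_of_posDef hW (X z) i

end meanQuad

section condVec

/-- Conditional expectation of a random vector, coordinate by coordinate. -/
def condVec {S : Type*} [MeasurableSpace S] (P : Measure S) (G : MeasurableSpace S)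
    (X : S → ι → ℝ) (z : S) (i : ι) : ℝ :=
  (P[fun z => X z i | G]) z

variable (G) in
lemma measurable_condVec (X : S → ι → ℝ) :
    Measurable[G] (condVec P G X) :=
  @measurable_pi_iff _ _ _ G _ _ |>.mpr fun _ => stronglyMeasurable_condExp.measurable

variable (G) in
lemma SquareIntegrable.condVec {X : S → ι → ℝ} (hX : SquareIntegrable P X) :
    SquareIntegrable P (condVec P G X) :=
  fun i => (hX i).condExp (by norm_num)

lemma crossMoment_condVec_left (hG : G ≤ mS) [IsFiniteMeasure P]
    {X : S → ι → ℝ} {Y : S → ι' → ℝ} (hX : SquareIntegrable P X)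
    (hY : SquareIntegrable P Y) (hYG : Measurable[G] Y) :
    crossMoment P (condVec P G X) Y = crossMoment P X Y := by
  ext i j
  have hYj : StronglyMeasurable[G] (fun z => Y z j) :=
    (@measurable_pi_iff _ _ _ G _ _ |>.mp hYG j).stronglyMeasurable
  rw [crossMoment_apply, crossMoment_apply,
    ← integral_condExp hG (f := fun z => X z i * Y z j)]
  exact (integral_congr_ae (condExp_mul_of_stronglyMeasurable_right hYj
    (hX.integrable_mul hY i j) ((hX i).integrable (by norm_num)))).symm

lemma crossMoment_sub_condVec (hG : G ≤ mS) [IsFiniteMeasure P]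
    {X : S → ι → ℝ} {Y : S → ι' → ℝ} (hX : SquareIntegrable P X)
    (hY : SquareIntegrable P Y) (hYG : Measurable[G] Y) :
    crossMoment P (fun z => X z - condVec P G X z) Y = 0 := by
  rw [crossMoment_sub_left hX (hX.condVec G) hY, crossMoment_condVec_left hG hX hY hYG, sub_self]

end condVec

end moments

section gaussian

variable {m : ℕ}

instance (S : Mat m) : IsProbabilityMeasure (gaussian S) :=
  Measure.isProbabilityMeasure_map (by fun_prop)

instance (S : Mat m) : IsGaussian (gaussian S) := by
  change IsGaussian ((multivariateGaussian (0 : EuclideanSpace ℝ (Fin m)) S).map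
    (PiLp.continuousLinearEquiv 2 ℝ (fun _ : Fin m => ℝ)))
  infer_instance

instance (S : Mat m) : (gaussian S).IsNegInvariant := by
  have hneg : (stdGaussian (EuclideanSpace ℝ (Fin m))).map (fun x => -x)
      = stdGaussian (EuclideanSpace ℝ (Fin m)) :=
    stdGaussian_map (LinearIsometryEquiv.neg ℝ)
  refine ⟨?_⟩
  simp only [Measure.neg, gaussian, multivariateGaussian, zero_add]
  rw [Measure.map_map (by fun_prop) (by fun_prop), Measure.map_map (by fun_prop) (by fun_prop)]
  conv_rhs => rw [← hneg]
  rw [Measure.map_map (by fun_prop) (by fun_prop), Measure.map_map (by fun_prop) (by fun_prop)]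
  congr 1
  ext x i
  simp

lemma squareIntegrable_gaussian (S : Mat m) : SquareIntegrable (gaussian S) (fun x => x) :=
  fun i => IsGaussian.memLp_dual (gaussian S) (ContinuousLinearMap.proj i) 2 (by simp)

lemma crossMoment_gaussian {S : Mat m} (hS : S.PosSemidef) :
    crossMoment (gaussian S) (fun x => x) (fun x => x) = S := by
  set N : Measure (EuclideanSpace ℝ (Fin m)) := multivariateGaussian 0 S
  have hcoord : ∀ i, MemLp (fun x : EuclideanSpace ℝ (Fin m) => x i) 2 N :=
    fun i => IsGaussian.memLp_dual _ (EuclideanSpace.proj i) 2 (by simp)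
  have hmean : ∀ i, ∫ x, x i ∂N = 0 := fun i => by
    have h := (EuclideanSpace.proj (𝕜 := ℝ) i).integral_comp_id_comm (μ := N)
      IsGaussian.integrable_id
    simpa [N] using h
  ext i j
  rw [crossMoment_apply, gaussian, integral_map (by fun_prop) (by fun_prop),
    ← covariance_eval_multivariateGaussian (μ := 0) hS,
    covariance_eq_sub (hcoord i) (hcoord j), hmean, hmean, mul_zero, sub_zero]
  rfl

end gaussian

/-! ### The closed loop and its information -/

section closedLoop

variable {m r κ : ℕ} {Ω : Type*} (M : Model m r κ Ω) (η : SignalRule m κ)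
  (γ : ControlPolicy m r κ)

/-- The closed-loop state at the beginning of a stage. -/
def stateAt (k : Fin κ) (z : Sample m κ) : Vec m := state M η γ z k.val k.isLt.le

lemma nextState_eq (z : Sample m κ) (k : Fin κ) :
    nextState M η γ z k
      = M.A *ᵥ stateAt M η γ k z + M.B *ᵥ controlInput M η γ z k + z.1.2 k := by
  rw [nextState, state]
  rfl

lemma stateAt_zero (h : 0 < κ) (z : Sample m κ) : stateAt M η γ ⟨0, h⟩ z = z.1.1 := by
  rw [stateAt, state]

lemma stateAt_succ {k : ℕ} (h : k + 1 < κ) (z : Sample m κ) :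
    stateAt M η γ ⟨k + 1, h⟩ z = nextState M η γ z ⟨k, Nat.lt_of_succ_lt h⟩ := rfl

lemma freeState_zero (h : 0 < κ) (b : Base m κ) : freeState M b ⟨0, h⟩ = b.1 := by
  rw [freeState, freeStateAux]

lemma freeState_succ {k : ℕ} (h : k + 1 < κ) (b : Base m κ) :
    freeState M b ⟨k + 1, h⟩
      = M.A *ᵥ freeState M b ⟨k, Nat.lt_of_succ_lt h⟩ + b.2 ⟨k, Nat.lt_of_succ_lt h⟩ := by
  rw [freeState, freeStateAux]
  rfl

/-- The part of the state at stage `k` that is caused by the inputs `u_l`, `l < k`. -/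
def forcedState (u : Fin κ → Vec r) (k : Fin κ) : Vec m :=
  ∑ l ∈ Finset.Iio k, (M.A ^ (k.val - l.val - 1) * M.B) *ᵥ u l

lemma forcedState_zero (h : 0 < κ) (u : Fin κ → Vec r) : forcedState M u ⟨0, h⟩ = 0 :=
  Finset.sum_eq_zero fun _ hl => absurd (Finset.mem_Iio.mp hl) (Nat.not_lt_zero _)

lemma Iio_fin_succ {k : ℕ} (h : k + 1 < κ) :
    Finset.Iio (⟨k + 1, h⟩ : Fin κ)
      = insert ⟨k, Nat.lt_of_succ_lt h⟩ (Finset.Iio ⟨k, Nat.lt_of_succ_lt h⟩) := by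
  ext l
  simp only [Finset.mem_Iio, Finset.mem_insert, Fin.lt_def, Fin.ext_iff]
  omega

lemma forcedState_succ {k : ℕ} (h : k + 1 < κ) (u : Fin κ → Vec r) :
    forcedState M u ⟨k + 1, h⟩
      = M.A *ᵥ forcedState M u ⟨k, Nat.lt_of_succ_lt h⟩ + M.B *ᵥ u ⟨k, Nat.lt_of_succ_lt h⟩ := by
  rw [forcedState, Iio_fin_succ, Finset.sum_insert (by simp), add_comm, forcedState,
    Matrix.mulVec_sum]
  congr 1
  · refine Finset.sum_congr rfl fun l hl => ?_
    have hlk : l.val < k := by simpa [Fin.lt_def] using hl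
    rw [Matrix.mulVec_mulVec, ← Matrix.mul_assoc, ← pow_succ',
      show k + 1 - l.val - 1 = k - l.val - 1 + 1 by omega]
  · simp

lemma stateAt_eq (k : Fin κ) (z : Sample m κ) :
    stateAt M η γ k z = freeState M z.1 k + forcedState M (controlInput M η γ z) k := by
  obtain ⟨k, hk⟩ := k
  induction k with
  | zero => rw [stateAt_zero, freeState_zero, forcedState_zero, add_zero]
  | succ k ih =>
    rw [stateAt_succ, nextState_eq, ih, freeState_succ, forcedState_succ, Matrix.mulVec_add]
    abel

/-- The signal that is seen when the input vanishes. -/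
def openSignal (k : Fin κ) (z : Sample m κ) : Vec m :=
  encode η k (fun j => freeState M z.1 (Fin.castLE k.isLt j)) (z.2 k)

/-- The part of the signal that is caused by the inputs. -/
def forcedSignal (u : Fin κ → Vec r) (k : Fin κ) : Vec m :=
  ∑ j, (η.gain k j)ᵀ *ᵥ forcedState M u (Fin.castLE k.isLt j)

lemma signal_eq (k : Fin κ) (z : Sample m κ) :
    signal M η γ z k = openSignal M η k z + forcedSignal M η (controlInput M η γ z) k := by
  have hstate : ∀ j : Fin (k.val + 1), state M η γ z j.val
      ((Nat.le_of_lt_succ j.isLt).trans k.isLt.le)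
      = stateAt M η γ (Fin.castLE k.isLt j) z := fun _ => rfl
  simp only [signal, openSignal, forcedSignal, encode, hstate, stateAt_eq, Matrix.mulVec_add,
    Finset.sum_add_distrib]
  abel

end closedLoop

section information

variable {m r κ : ℕ} {Ω : Type*} (M : Model m r κ Ω) (η : SignalRule m κ)
  (γ : ControlPolicy m r κ)

/-- The signals up to stage `k` that are seen when the input vanishes. -/
def openHistory (k : Fin κ) (z : Sample m κ) (j : Fin (k.val + 1)) : Vec m :=
  openSignal M η (Fin.castLE k.isLt j) z

/-- The information up to stage `k`. By `comap_signalHistory` it does not depend on the policy. -/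
abbrev openAlg (k : Fin κ) : MeasurableSpace (Sample m κ) :=
  MeasurableSpace.comap (openHistory M η k) inferInstance

lemma measurable_mulVec {n p : ℕ} (A : Matrix (Fin n) (Fin p) ℝ) {S : Type*}
    {G : MeasurableSpace S} {X : S → Vec p} (hX : Measurable[G] X) :
    Measurable[G] (fun z => A *ᵥ X z) :=
  (Continuous.matrix_mulVec continuous_const continuous_id).measurable.comp hX

lemma measurable_freeState (k : Fin κ) : Measurable (fun b => freeState M b k) := by
  obtain ⟨k, hk⟩ := k
  induction k with
  | zero => simp only [freeState_zero]; exact measurable_fst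
  | succ k ih =>
    simp only [freeState_succ]
    exact (measurable_mulVec _ (ih _)).add ((measurable_pi_apply _).comp measurable_snd)

lemma measurable_openSignal (k : Fin κ) : Measurable (openSignal M η k) :=
  (Finset.measurable_sum _ fun _ _ =>
    measurable_mulVec _ ((measurable_freeState M _).comp measurable_fst)).add
    ((measurable_pi_apply _).comp measurable_snd)

lemma measurable_forcedState {S : Type*} {G : MeasurableSpace S} {u : S → Fin κ → Vec r}
    {k : Fin κ} (hu : ∀ l < k, Measurable[G] fun z => u z l) :
    Measurable[G] (fun z => forcedState M (u z) k) :=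
  Finset.measurable_sum _ fun l hl => measurable_mulVec _ (hu l (Finset.mem_Iio.mp hl))

lemma measurable_forcedSignal {S : Type*} {G : MeasurableSpace S} {u : S → Fin κ → Vec r}
    {k : Fin κ} (hu : ∀ l < k, Measurable[G] fun z => u z l) :
    Measurable[G] (fun z => forcedSignal M η (u z) k) :=
  Finset.measurable_sum _ fun j _ => measurable_mulVec _ <| measurable_forcedState M fun l hl =>
    hu l (hl.trans_le (Nat.le_of_lt_succ j.isLt))

lemma measurable_openSignal_openAlg {j k : Fin κ} (hjk : j ≤ k) :
    Measurable[openAlg M η k] (openSignal M η j) :=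
  (measurable_pi_apply (⟨j.val, Nat.lt_succ_of_le hjk⟩ : Fin (k.val + 1))).comp
    (comap_measurable (openHistory M η k))

lemma openAlg_mono {j k : Fin κ} (hjk : j ≤ k) : openAlg M η j ≤ openAlg M η k :=
  measurable_iff_comap_le.mp <| @measurable_pi_iff _ _ _ (openAlg M η k) _ _ |>.mpr fun i =>
    measurable_openSignal_openAlg M η ((Nat.le_of_lt_succ i.isLt).trans hjk)

lemma openAlg_le (k : Fin κ) : openAlg M η k ≤ (inferInstance : MeasurableSpace (Sample m κ)) :=
  measurable_iff_comap_le.mp (measurable_pi_iff.mpr fun _ => measurable_openSignal M η _)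

lemma eq_of_measurable_openAlg {k : Fin κ} {T : Type*} [MeasurableSpace T]
    [MeasurableSingletonClass T] {Y : Sample m κ → T} (hY : Measurable[openAlg M η k] Y)
    {z z' : Sample m κ} (h : ∀ j ≤ k, openSignal M η j z = openSignal M η j z') : Y z = Y z' :=
  hY.factorsThrough (funext fun i => h _ (Nat.le_of_lt_succ i.isLt))

lemma measurable_controlInput_of_signal {G : MeasurableSpace (Sample m κ)} {k : Fin κ}
    (h : ∀ j ≤ k, Measurable[G] fun z => signal M η γ z j) :
    Measurable[G] (fun z => controlInput M η γ z k) :=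
  (γ.measurable_act k).comp <| @measurable_pi_iff _ _ _ G _ _ |>.mpr fun i =>
    h _ (Nat.le_of_lt_succ i.isLt)

lemma measurable_signal_openAlg {j k : Fin κ} (hjk : j ≤ k) :
    Measurable[openAlg M η k] (fun z => signal M η γ z j) := by
  induction j using WellFoundedLT.induction with
  | ind j ih =>
    simp only [signal_eq]
    refine (measurable_openSignal_openAlg M η hjk).add (measurable_forcedSignal M η fun l hl => ?_)
    exact measurable_controlInput_of_signal M η γ fun i hi =>
      ih i (hi.trans_lt hl) ((hi.trans hl.le).trans hjk)

lemma measurable_controlInput_openAlg {j k : Fin κ} (hjk : j ≤ k) :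
    Measurable[openAlg M η k] (fun z => controlInput M η γ z j) :=
  measurable_controlInput_of_signal M η γ fun _ hi =>
    measurable_signal_openAlg M η γ (hi.trans hjk)

lemma measurable_openSignal_of_signal {G : MeasurableSpace (Sample m κ)} {k : Fin κ}
    (h : ∀ j ≤ k, Measurable[G] fun z => signal M η γ z j) : Measurable[G] (openSignal M η k) := by
  have hopen : openSignal M η k
      = fun z => signal M η γ z k - forcedSignal M η (controlInput M η γ z) k :=
    funext fun z => by rw [signal_eq, add_sub_cancel_right]
  rw [hopen]
  exact (h k le_rfl).sub <| measurable_forcedSignal M η fun l hl =>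
    measurable_controlInput_of_signal M η γ fun i hi => h i (hi.trans hl.le)

lemma comap_signalHistory (k : Fin κ) :
    MeasurableSpace.comap (signalHistory M η γ k) inferInstance = openAlg M η k := by
  refine le_antisymm (measurable_iff_comap_le.mp ?_) (measurable_iff_comap_le.mp ?_)
  · exact @measurable_pi_iff _ _ _ (openAlg M η k) _ _ |>.mpr fun i =>
      measurable_signal_openAlg M η γ (Nat.le_of_lt_succ i.isLt)
  · set G := MeasurableSpace.comap (signalHistory M η γ k) inferInstance
    have hsignal : ∀ j ≤ k, Measurable[G] fun z => signal M η γ z j := fun j hj =>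
      (measurable_pi_apply (⟨j.val, Nat.lt_succ_of_le hj⟩ : Fin (k.val + 1))).comp
        (comap_measurable (signalHistory M η γ k))
    exact @measurable_pi_iff _ _ _ G _ _ |>.mpr fun i =>
      measurable_openSignal_of_signal M η γ fun j hj =>
        hsignal j (hj.trans (Nat.le_of_lt_succ i.isLt))

end information

section gaussianVectors

variable {E : Type*} [NormedAddCommGroup E] [NormedSpace ℝ E] {ι ι' : Type*} [Fintype ι]
  [Fintype ι'] {X : E → ι → ℝ}

lemma isBoundedLinearMap_mulVec (A : Matrix ι' ι ℝ) (hX : IsBoundedLinearMap ℝ X) :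
    IsBoundedLinearMap ℝ (fun z => A *ᵥ X z) :=
  (Matrix.mulVecLin A).toContinuousLinearMap.isBoundedLinearMap.comp hX

lemma isBoundedLinearMap_finsetSum {α : Type*} {s : Finset α} {X : α → E → ι → ℝ}
    (hX : ∀ a ∈ s, IsBoundedLinearMap ℝ (X a)) :
    IsBoundedLinearMap ℝ (fun z => ∑ a ∈ s, X a z) := by
  classical
  induction s using Finset.induction_on with
  | empty => simpa using IsBoundedLinearMap.zero
  | insert a s ha ih =>
    simp only [Finset.sum_insert ha]
    exact (hX a (Finset.mem_insert_self a s)).add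
      (ih fun b hb => hX b (Finset.mem_insert_of_mem hb))

variable [MeasurableSpace E] {P : Measure E}

lemma squareIntegrable_of_isBoundedLinearMap [BorelSpace E] [IsGaussian P]
    (hX : IsBoundedLinearMap ℝ X) : SquareIntegrable P X := fun i =>
  IsGaussian.memLp_dual P ((ContinuousLinearMap.proj i).comp hX.toContinuousLinearMap) 2 (by simp)

lemma integral_eq_zero_of_isBoundedLinearMap [MeasurableNeg E] [P.IsNegInvariant]
    (hX : IsBoundedLinearMap ℝ X) (i : ι) : ∫ z, X z i ∂P = 0 := by
  have h := integral_neg_eq_self (fun z => X z i) P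
  simp only [hX.toIsLinearMap.map_neg, Pi.neg_apply, integral_neg] at h
  exact neg_eq_self.mp h

end gaussianVectors

/-! ### The joint law and the posteriors -/

section law

variable {m r κ : ℕ} {Ω : Type*} (M : Model m r κ Ω) (η : SignalRule m κ)

lemma isGaussian_pi_gaussian {ι : Type*} [Fintype ι] (S : ι → Mat m) :
    IsGaussian (Measure.pi fun k => gaussian (S k)) := by
  have hindep : iIndepFun (fun k (x : ι → Vec m) => x k) (Measure.pi fun k => gaussian (S k)) :=
    iIndepFun_pi (X := fun _ x => x) fun _ => aemeasurable_id
  have hcoord : ∀ k, HasGaussianLaw (fun x : ι → Vec m => x k)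
      (Measure.pi fun k => gaussian (S k)) := fun k =>
    ⟨by rw [(measurePreserving_eval (fun k => gaussian (S k)) k).map_eq]; infer_instance⟩
  have hjoint := (hindep.hasGaussianLaw hcoord).isGaussian_map
  rwa [show (fun (x : ι → Vec m) k => x k) = id from rfl, Measure.map_id] at hjoint

instance : IsProbabilityMeasure (baseLaw M) := by unfold baseLaw; infer_instance

instance : IsProbabilityMeasure (law M η) := by unfold law; infer_instance

instance : IsGaussian (baseLaw M) := by
  have := isGaussian_pi_gaussian fun _ : Fin κ => M.covNoise
  unfold baseLaw
  infer_instance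

instance : IsGaussian (law M η) := by
  have := isGaussian_pi_gaussian η.noiseCov
  unfold law
  infer_instance

instance : (law M η).IsNegInvariant :=
  have := Measure.pi.isNegInvariant fun _ : Fin κ => gaussian M.covNoise
  have := Measure.pi.isNegInvariant fun k => gaussian (η.noiseCov k)
  ⟨(((Measure.measurePreserving_neg _).prod (Measure.measurePreserving_neg _)).prod
    (Measure.measurePreserving_neg _)).map_eq⟩

lemma measurePreserving_base :
    MeasurePreserving (fun z : Sample m κ => z.1) (law M η) (baseLaw M) :=
  measurePreserving_fst

lemma measurePreserving_initial :
    MeasurePreserving (fun z : Sample m κ => z.1.1) (law M η) (gaussian M.covInit) :=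
  (measurePreserving_fst (μ := gaussian M.covInit)
    (ν := Measure.pi fun _ : Fin κ => gaussian M.covNoise)).comp (measurePreserving_base M η)

lemma measurePreserving_stateNoise (k : Fin κ) :
    MeasurePreserving (fun z : Sample m κ => z.1.2 k) (law M η) (gaussian M.covNoise) :=
  ((measurePreserving_eval (fun _ : Fin κ => gaussian M.covNoise) k).comp
    (measurePreserving_snd (μ := gaussian M.covInit))).comp (measurePreserving_base M η)

lemma measurePreserving_signalNoise (k : Fin κ) :
    MeasurePreserving (fun z : Sample m κ => z.2 k) (law M η) (gaussian (η.noiseCov k)) :=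
  (measurePreserving_eval (fun k : Fin κ => gaussian (η.noiseCov k)) k).comp
    (measurePreserving_snd (μ := baseLaw M))

lemma squareIntegrable_stateNoise (k : Fin κ) :
    SquareIntegrable (law M η) (fun z => z.1.2 k) :=
  (squareIntegrable_gaussian _).comp_measurePreserving (measurePreserving_stateNoise M η k)

lemma squareIntegrable_signalNoise (k : Fin κ) : SquareIntegrable (law M η) (fun z => z.2 k) :=
  (squareIntegrable_gaussian _).comp_measurePreserving (measurePreserving_signalNoise M η k)

lemma crossMoment_initial :
    crossMoment (law M η) (fun z => z.1.1) (fun z => z.1.1) = M.covInit :=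
  (crossMoment_comp_measurePreserving (measurePreserving_initial M η)
    (squareIntegrable_gaussian _) (squareIntegrable_gaussian _)).trans
    (crossMoment_gaussian M.covInit_posSemidef)

lemma crossMoment_stateNoise (k : Fin κ) :
    crossMoment (law M η) (fun z => z.1.2 k) (fun z => z.1.2 k) = M.covNoise :=
  (crossMoment_comp_measurePreserving (measurePreserving_stateNoise M η k)
    (squareIntegrable_gaussian _) (squareIntegrable_gaussian _)).trans
    (crossMoment_gaussian M.covNoise_posSemidef)

lemma crossMoment_signalNoise (k : Fin κ) :
    crossMoment (law M η) (fun z => z.2 k) (fun z => z.2 k) = η.noiseCov k :=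
  (crossMoment_comp_measurePreserving (measurePreserving_signalNoise M η k)
    (squareIntegrable_gaussian _) (squareIntegrable_gaussian _)).trans
    (crossMoment_gaussian (η.noiseCov_posSemidef k))

lemma isBoundedLinearMap_freeState (k : Fin κ) :
    IsBoundedLinearMap ℝ (fun b => freeState M b k) := by
  obtain ⟨k, hk⟩ := k
  induction k with
  | zero => simp only [freeState_zero]; exact .fst
  | succ k ih =>
    simp only [freeState_succ]
    exact (isBoundedLinearMap_mulVec M.A (ih _)).add
      ((ContinuousLinearMap.proj (R := ℝ) (φ := fun _ : Fin κ => Vec m)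
        ⟨k, Nat.lt_of_succ_lt hk⟩).isBoundedLinearMap.comp .snd)

lemma isBoundedLinearMap_openSignal (k : Fin κ) : IsBoundedLinearMap ℝ (openSignal M η k) :=
  (isBoundedLinearMap_finsetSum fun _ _ =>
    isBoundedLinearMap_mulVec _ ((isBoundedLinearMap_freeState M _).comp .fst)).add
    ((ContinuousLinearMap.proj (R := ℝ) (φ := fun _ : Fin κ => Vec m) k).isBoundedLinearMap.comp
      .snd)

lemma squareIntegrable_freeState (k : Fin κ) :
    SquareIntegrable (law M η) (fun z => freeState M z.1 k) :=
  squareIntegrable_of_isBoundedLinearMap ((isBoundedLinearMap_freeState M k).comp .fst)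

lemma squareIntegrable_openSignal (k : Fin κ) : SquareIntegrable (law M η) (openSignal M η k) :=
  squareIntegrable_of_isBoundedLinearMap (isBoundedLinearMap_openSignal M η k)

lemma integral_freeState (k : Fin κ) (i : Fin m) : ∫ z, freeState M z.1 k i ∂(law M η) = 0 :=
  integral_eq_zero_of_isBoundedLinearMap ((isBoundedLinearMap_freeState M k).comp .fst) i

lemma freeCov_eq (k : Fin κ) :
    freeCov M k
      = crossMoment (law M η) (fun z => freeState M z.1 k) (fun z => freeState M z.1 k) :=
  have hfree := squareIntegrable_of_isBoundedLinearMap (P := baseLaw M)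
    (isBoundedLinearMap_freeState M k)
  (crossMoment_comp_measurePreserving (measurePreserving_base M η) hfree hfree).symm

/-- The augmented vector of a sequence of vectors. -/
def augment {ι α : Type*} (x : ι → α → ℝ) (a : ι × α) : ℝ := x a.1 a.2

lemma bigSigma_eq :
    bigSigma M = crossMoment (law M η) (fun z => augment (freeState M z.1))
      (fun z => augment (freeState M z.1)) :=
  have hfree : SquareIntegrable (baseLaw M) fun b => augment (freeState M b) := fun a =>
    squareIntegrable_of_isBoundedLinearMap (isBoundedLinearMap_freeState M a.1) a.2
  (crossMoment_comp_measurePreserving (measurePreserving_base M η) hfree hfree).symm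

end law

section flips

/-- Reversal of the sign of one coordinate. Reversing a single noise preserves the law, which is
how a noise is seen to be uncorrelated with what does not depend on it. -/
def negAt {ι E : Type*} [DecidableEq ι] [Neg E] (k : ι) (x : ι → E) : ι → E :=
  Function.update x k (-x k)

lemma measurePreserving_negAt {ι E : Type*} [Fintype ι] [DecidableEq ι] [MeasurableSpace E]
    [InvolutiveNeg E] [MeasurableNeg E] (μ : ι → Measure E) [∀ k, SigmaFinite (μ k)] (k : ι)
    [(μ k).IsNegInvariant] : MeasurePreserving (negAt k) (Measure.pi μ) (Measure.pi μ) := by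
  have hcoord : ∀ j, MeasurePreserving (fun x : E => if j = k then -x else x) (μ j) (μ j) := by
    intro j
    by_cases h : j = k
    · subst h
      simpa using Measure.measurePreserving_neg (μ j)
    · simp only [h, if_false]
      exact MeasurePreserving.id (μ j)
  convert measurePreserving_pi μ μ hcoord using 1
  ext x j
  by_cases h : j = k
  · subst h
    simp [negAt]
  · simp [negAt, h]

variable {m r κ : ℕ} {Ω : Type*} (M : Model m r κ Ω) (η : SignalRule m κ)

/-- Reversal of the state noise of one stage. -/
def flipStateNoise (k : Fin κ) (z : Sample m κ) : Sample m κ := ((z.1.1, negAt k z.1.2), z.2)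

/-- Reversal of the signal noise of one stage. -/
def flipSignalNoise (k : Fin κ) (z : Sample m κ) : Sample m κ := (z.1, negAt k z.2)

lemma measurePreserving_flipStateNoise (k : Fin κ) :
    MeasurePreserving (flipStateNoise (m := m) k) (law M η) (law M η) :=
  ((MeasurePreserving.id _).prod (measurePreserving_negAt _ k)).prod (MeasurePreserving.id _)

lemma measurePreserving_flipSignalNoise (k : Fin κ) :
    MeasurePreserving (flipSignalNoise (m := m) k) (law M η) (law M η) :=
  (MeasurePreserving.id _).prod (measurePreserving_negAt _ k)

lemma stateNoise_flipStateNoise (k : Fin κ) (z : Sample m κ) :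
    (flipStateNoise k z).1.2 k = -z.1.2 k := Function.update_self ..

lemma signalNoise_flipSignalNoise (k : Fin κ) (z : Sample m κ) :
    (flipSignalNoise k z).2 k = -z.2 k := Function.update_self ..

lemma freeState_flipStateNoise {j k : Fin κ} (hjk : j ≤ k) (z : Sample m κ) :
    freeState M (flipStateNoise k z).1 j = freeState M z.1 j := by
  obtain ⟨j, hj⟩ := j
  induction j with
  | zero => simp only [freeState_zero, flipStateNoise]
  | succ j ih =>
    have hlt : (⟨j, Nat.lt_of_succ_lt hj⟩ : Fin κ) < k := hjk
    rw [freeState_succ, freeState_succ, ih (Nat.lt_of_succ_lt hj) hlt.le]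
    simp only [flipStateNoise, negAt, Function.update_of_ne hlt.ne]

lemma openSignal_flipStateNoise {j k : Fin κ} (hjk : j ≤ k) (z : Sample m κ) :
    openSignal M η j (flipStateNoise k z) = openSignal M η j z := by
  have hfree : ∀ i : Fin (j.val + 1), freeState M (flipStateNoise k z).1 (Fin.castLE j.isLt i)
      = freeState M z.1 (Fin.castLE j.isLt i) := fun i =>
    freeState_flipStateNoise M (le_trans (Nat.le_of_lt_succ i.isLt) hjk) z
  simp only [openSignal, hfree]
  rfl

lemma openSignal_flipSignalNoise {j k : Fin κ} (hjk : j < k) (z : Sample m κ) :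
    openSignal M η j (flipSignalNoise k z) = openSignal M η j z := by
  simp only [openSignal, flipSignalNoise, negAt, Function.update_of_ne hjk.ne]

lemma crossMoment_stateNoise_freeState {j k : Fin κ} (hjk : j ≤ k) :
    crossMoment (law M η) (fun z => z.1.2 k) (fun z => freeState M z.1 j) = 0 :=
  crossMoment_eq_zero_of_flip (measurePreserving_flipStateNoise M η k)
    (squareIntegrable_stateNoise M η k) (squareIntegrable_freeState M η j)
    (stateNoise_flipStateNoise k) (freeState_flipStateNoise M hjk)

lemma crossMoment_stateNoise_openAlg {ι : Type*} [Countable ι] {k : Fin κ}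
    {Y : Sample m κ → ι → ℝ} (hY : SquareIntegrable (law M η) Y)
    (hYm : Measurable[openAlg M η k] Y) : crossMoment (law M η) (fun z => z.1.2 k) Y = 0 :=
  crossMoment_eq_zero_of_flip (measurePreserving_flipStateNoise M η k)
    (squareIntegrable_stateNoise M η k) hY (stateNoise_flipStateNoise k)
    fun z => eq_of_measurable_openAlg M η hYm fun _ hj => openSignal_flipStateNoise M η hj z

lemma crossMoment_signalNoise_freeState (j k : Fin κ) :
    crossMoment (law M η) (fun z => z.2 k) (fun z => freeState M z.1 j) = 0 :=
  crossMoment_eq_zero_of_flip (measurePreserving_flipSignalNoise M η k)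
    (squareIntegrable_signalNoise M η k) (squareIntegrable_freeState M η j)
    (signalNoise_flipSignalNoise k) fun _ => rfl

lemma crossMoment_signalNoise_openAlg {ι : Type*} [Countable ι] {j k : Fin κ} (hjk : j < k)
    {Y : Sample m κ → ι → ℝ} (hY : SquareIntegrable (law M η) Y)
    (hYm : Measurable[openAlg M η j] Y) : crossMoment (law M η) (fun z => z.2 k) Y = 0 :=
  crossMoment_eq_zero_of_flip (measurePreserving_flipSignalNoise M η k)
    (squareIntegrable_signalNoise M η k) hY (signalNoise_flipSignalNoise k)
    fun z => eq_of_measurable_openAlg M η hYm fun _ hi =>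
      openSignal_flipSignalNoise M η (hi.trans_lt hjk) z

end flips

section posterior

variable {m r κ : ℕ} {Ω : Type*} (M : Model m r κ Ω) (η : SignalRule m κ)
  (γ : ControlPolicy m r κ)

/-- The posterior mean of the control-free state, as a vector; see `posterior_eq`. -/
def estimate (k : Fin κ) : Sample m κ → Vec m :=
  condVec (law M η) (openAlg M η k) (fun z => freeState M z.1 k)

/-- The error of the posterior mean. -/
def estimateError (k : Fin κ) (z : Sample m κ) : Vec m := freeState M z.1 k - estimate M η k z

lemma posterior_eq (k : Fin κ) (i : Fin m) :
    posterior M η γ k i = fun z => estimate M η k z i := by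
  rw [posterior, comap_signalHistory]
  rfl

lemma squareIntegrable_estimate (k : Fin κ) : SquareIntegrable (law M η) (estimate M η k) :=
  (squareIntegrable_freeState M η k).condVec _

lemma squareIntegrable_estimateError (k : Fin κ) :
    SquareIntegrable (law M η) (estimateError M η k) :=
  (squareIntegrable_freeState M η k).sub (squareIntegrable_estimate M η k)

lemma measurable_estimate {j k : Fin κ} (hjk : j ≤ k) :
    Measurable[openAlg M η k] (estimate M η j) :=
  (measurable_condVec (openAlg M η j) _).mono (openAlg_mono M η hjk) le_rfl

lemma integral_estimate (k : Fin κ) (i : Fin m) : ∫ z, estimate M η k z i ∂(law M η) = 0 :=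
  (integral_condExp (openAlg_le M η k)).trans (integral_freeState M η k i)

lemma posteriorCov_eq (k : Fin κ) :
    posteriorCov M η γ k = crossMoment (law M η) (estimate M η k) (estimate M η k) := by
  ext i j
  have h := squareIntegrable_estimate M η k
  rw [posteriorCov, Matrix.of_apply, posterior_eq, posterior_eq, covariance_eq_sub (h i) (h j),
    integral_estimate, zero_mul, sub_zero]
  rfl

variable {ι : Type*} {k : Fin κ} {Y : Sample m κ → ι → ℝ}

lemma crossMoment_estimate_left (hY : SquareIntegrable (law M η) Y)
    (hYm : Measurable[openAlg M η k] Y) :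
    crossMoment (law M η) (estimate M η k) Y
      = crossMoment (law M η) (fun z => freeState M z.1 k) Y :=
  crossMoment_condVec_left (openAlg_le M η k) (squareIntegrable_freeState M η k) hY hYm

lemma crossMoment_estimateError_left (hY : SquareIntegrable (law M η) Y)
    (hYm : Measurable[openAlg M η k] Y) : crossMoment (law M η) (estimateError M η k) Y = 0 :=
  crossMoment_sub_condVec (openAlg_le M η k) (squareIntegrable_freeState M η k) hY hYm

lemma freeCov_eq_posteriorCov_add (k : Fin κ) :
    freeCov M k = posteriorCov M η γ k
      + crossMoment (law M η) (estimateError M η k) (estimateError M η k) := by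
  have hest := squareIntegrable_estimate M η k
  rw [posteriorCov_eq, ← crossMoment_add_self_of_uncorrelated hest
    (squareIntegrable_estimateError M η k)
    (crossMoment_estimateError_left M η hest (measurable_estimate M η le_rfl)), freeCov_eq M η]
  simp only [estimateError, add_sub_cancel]

lemma crossMoment_freeState_succ [Countable ι] {k : ℕ} (hk : k + 1 < κ)
    (hY : SquareIntegrable (law M η) Y)
    (hYm : Measurable[openAlg M η ⟨k, Nat.lt_of_succ_lt hk⟩] Y) :
    crossMoment (law M η) (fun z => freeState M z.1 ⟨k + 1, hk⟩) Y
      = M.A * crossMoment (law M η) (estimate M η ⟨k, Nat.lt_of_succ_lt hk⟩) Y := by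
  simp only [freeState_succ]
  rw [crossMoment_add_left ((squareIntegrable_freeState M η _).mulVec M.A)
    (squareIntegrable_stateNoise M η _) hY,
    crossMoment_stateNoise_openAlg M η hY hYm, add_zero,
    crossMoment_mulVec_left (squareIntegrable_freeState M η _) hY,
    crossMoment_estimate_left M η hY hYm]

lemma crossMoment_estimate_succ [Countable ι] {k : ℕ} (hk : k + 1 < κ)
    (hY : SquareIntegrable (law M η) Y)
    (hYm : Measurable[openAlg M η ⟨k, Nat.lt_of_succ_lt hk⟩] Y) :
    crossMoment (law M η) (estimate M η ⟨k + 1, hk⟩) Y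
      = M.A * crossMoment (law M η) (estimate M η ⟨k, Nat.lt_of_succ_lt hk⟩) Y := by
  rw [crossMoment_estimate_left M η hY (hYm.mono (openAlg_mono M η (Nat.le_succ k)) le_rfl),
    crossMoment_freeState_succ M η hk hY hYm]

lemma crossMoment_estimate_of_le {k l : Fin κ} (hkl : k ≤ l) :
    crossMoment (law M η) (estimate M η l) (estimate M η k)
      = M.A ^ (l.val - k.val) * crossMoment (law M η) (estimate M η k) (estimate M η k) := by
  obtain ⟨l, hl⟩ := l
  induction l with
  | zero =>
    obtain rfl : k = ⟨0, hl⟩ := le_antisymm hkl (Nat.zero_le _)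
    simp
  | succ l ih =>
    rcases hkl.eq_or_lt with rfl | hlt
    · simp
    · have hkl' : k.val ≤ l := Nat.le_of_lt_succ hlt
      rw [crossMoment_estimate_succ M η hl (squareIntegrable_estimate M η k)
        (measurable_estimate M η hkl'), ih _ hkl', ← Matrix.mul_assoc, ← pow_succ',
        Nat.succ_sub hkl']

lemma posteriorCov_succ {k : ℕ} (hk : k + 1 < κ) :
    posteriorCov M η γ ⟨k + 1, hk⟩
      = M.A * posteriorCov M η γ ⟨k, Nat.lt_of_succ_lt hk⟩ * M.Aᵀ
        + crossMoment (law M η)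
          (fun z => estimate M η ⟨k + 1, hk⟩ z - M.A *ᵥ estimate M η ⟨k, Nat.lt_of_succ_lt hk⟩ z)
          (fun z =>
            estimate M η ⟨k + 1, hk⟩ z - M.A *ᵥ estimate M η ⟨k, Nat.lt_of_succ_lt hk⟩ z) := by
  set j : Fin κ := ⟨k, Nat.lt_of_succ_lt hk⟩
  have hj := squareIntegrable_estimate M η j
  have hsucc := squareIntegrable_estimate M η ⟨k + 1, hk⟩
  have hinnov : crossMoment (law M η)
      (fun z => estimate M η ⟨k + 1, hk⟩ z - M.A *ᵥ estimate M η j z)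
      (fun z => M.A *ᵥ estimate M η j z) = 0 := by
    rw [crossMoment_mulVec_right (hsucc.sub (hj.mulVec _)) hj,
      crossMoment_sub_left hsucc (hj.mulVec _) hj, crossMoment_mulVec_left hj hj,
      crossMoment_estimate_succ M η hk hj (measurable_estimate M η le_rfl), sub_self,
      Matrix.zero_mul]
  rw [posteriorCov_eq, posteriorCov_eq, ← crossMoment_mulVec_self hj,
    ← crossMoment_add_self_of_uncorrelated (hj.mulVec _) (hsucc.sub (hj.mulVec _)) hinnov]
  simp only [add_sub_cancel]

lemma predicted_zero (S : Fin κ → Mat m) (h : 0 < κ) : predicted M S ⟨0, h⟩ = 0 := if_pos rfl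

lemma predicted_succ (S : Fin κ → Mat m) {k : ℕ} (hk : k + 1 < κ) :
    predicted M S ⟨k + 1, hk⟩ = M.A * S ⟨k, Nat.lt_of_succ_lt hk⟩ * M.Aᵀ :=
  if_neg (Nat.succ_ne_zero k)

theorem posteriorCov_mem_feasible : posteriorCov M η γ ∈ Feasible M := by
  intro k
  have hpos : (posteriorCov M η γ k).PosSemidef := by
    rw [posteriorCov_eq]
    exact posSemidef_crossMoment_self (squareIntegrable_estimate M η k)
  refine ⟨hpos, ?_, ?_⟩
  · rw [freeCov_eq_posteriorCov_add M η γ, add_sub_cancel_left]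
    exact posSemidef_crossMoment_self (squareIntegrable_estimateError M η k)
  · match k with
    | ⟨0, h⟩ => rwa [predicted_zero, sub_zero]
    | ⟨k + 1, hk⟩ =>
      rw [predicted_succ, posteriorCov_succ, add_sub_cancel_left]
      exact posSemidef_crossMoment_self ((squareIntegrable_estimate M η _).sub
        ((squareIntegrable_estimate M η _).mulVec _))

end posterior

/-! ### Certainty equivalence -/

section riccati

variable {ι ι' : Type*} [Fintype ι] {P : Matrix ι ι ℝ} {B : Matrix ι ι' ℝ} {R : Matrix ι' ι' ℝ}

lemma posDef_transpose_mul_mul_add [Finite ι'] (hP : P.PosSemidef) (B : Matrix ι ι' ℝ)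
    (hR : R.PosDef) : (Bᵀ * P * B + R).PosDef :=
  Matrix.PosDef.posSemidef_add (posSemidef_transpose_mul_mul hP B) hR

variable [Fintype ι']

lemma posSemidef_riccati_step [DecidableEq ι'] (hP : P.PosSemidef) (B : Matrix ι ι' ℝ)
    (hR : R.PosDef) :
    (P - P * B * (Bᵀ * P * B + R)⁻¹ * Bᵀ * P).PosSemidef := by
  classical
  set D := Bᵀ * P * B + R with hD
  set F := D⁻¹ * Bᵀ * P with hF
  have hDF : D * F = Bᵀ * P := by
    rw [hF, ← Matrix.mul_assoc, ← Matrix.mul_assoc,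
      mul_inv_of_posDef (posDef_transpose_mul_mul_add hP B hR), Matrix.one_mul]
  -- The Riccati step is the value attained by the optimal gain `F`.
  have hvalue : P - P * B * D⁻¹ * Bᵀ * P = (1 - B * F)ᵀ * P * (1 - B * F) + Fᵀ * R * F := by
    have hPBF : P * B * D⁻¹ * Bᵀ * P = P * B * F := by simp only [hF, Matrix.mul_assoc]
    have hFDF : Fᵀ * (Bᵀ * P * B) * F + Fᵀ * R * F = Fᵀ * (Bᵀ * P) := by
      rw [← Matrix.add_mul, ← Matrix.mul_add, ← hD, Matrix.mul_assoc, hDF]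
    have hsquare : (1 - B * F)ᵀ * P * (1 - B * F)
        = P - P * B * F - Fᵀ * (Bᵀ * P) + Fᵀ * (Bᵀ * P * B) * F := by
      rw [Matrix.transpose_sub, Matrix.transpose_one, Matrix.transpose_mul]
      simp only [Matrix.sub_mul, Matrix.mul_sub, Matrix.one_mul, Matrix.mul_one, Matrix.mul_assoc]
      abel
    rw [hPBF, hsquare, add_assoc, hFDF]
    abel
  rw [hvalue]
  exact (posSemidef_transpose_mul_mul hP _).add (posSemidef_transpose_mul_mul hR.posSemidef _)

/- Here `X`, `N`, `U` are the joint second moments of a state `x` and an input `u`; the identity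
completes the square, `‖Ax + Bu‖²_P + ‖u‖²_R = ‖x‖²_{AᵀPA - KᵀDK} + ‖u + Kx‖²_D`. -/
lemma trace_completion (hP : Pᵀ = P) (A : Matrix ι ι ℝ) {D : Matrix ι' ι' ℝ}
    (hD : D = Bᵀ * P * B + R) (hDt : Dᵀ = D) {K : Matrix ι' ι ℝ} (hK : D * K = Bᵀ * P * A)
    (X : Matrix ι ι ℝ) (N : Matrix ι ι' ℝ) (U : Matrix ι' ι' ℝ) :
    (P * (A * X * Aᵀ + A * N * Bᵀ + B * Nᵀ * Aᵀ + B * U * Bᵀ)).trace + (R * U).trace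
      = ((Aᵀ * P * A - Kᵀ * D * K) * X).trace
        + (D * (U + Nᵀ * Kᵀ + K * N + K * X * Kᵀ)).trace := by
  have hKN : (P * (A * N * Bᵀ)).trace = (D * (K * N)).trace := by
    rw [← Matrix.mul_assoc D, hK, ← Matrix.mul_assoc P, Matrix.trace_mul_comm]
    simp only [Matrix.mul_assoc]
  have hKN' : (D * (Nᵀ * Kᵀ)).trace = (D * (K * N)).trace := by
    rw [← Matrix.trace_transpose]
    simp only [Matrix.transpose_mul, Matrix.transpose_transpose, hDt]
    rw [Matrix.trace_mul_comm]
  have hPN : (P * (B * Nᵀ * Aᵀ)).trace = (P * (A * N * Bᵀ)).trace := by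
    rw [← Matrix.trace_transpose]
    simp only [Matrix.transpose_mul, Matrix.transpose_transpose, hP]
    rw [Matrix.trace_mul_comm]
    simp only [Matrix.mul_assoc]
  have hX : (P * (A * X * Aᵀ)).trace = (Aᵀ * P * A * X).trace := by
    rw [← Matrix.mul_assoc P, Matrix.trace_mul_comm]
    simp only [Matrix.mul_assoc]
  have hX' : (D * (K * X * Kᵀ)).trace = (Kᵀ * D * K * X).trace := by
    rw [← Matrix.mul_assoc D, Matrix.trace_mul_comm]
    simp only [Matrix.mul_assoc]
  have hU : (P * (B * U * Bᵀ)).trace + (R * U).trace = (D * U).trace := by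
    rw [hD, Matrix.add_mul, Matrix.trace_add, ← Matrix.mul_assoc P, Matrix.trace_mul_comm]
    simp only [Matrix.mul_assoc]
  simp only [Matrix.mul_add, Matrix.sub_mul, Matrix.trace_add, Matrix.trace_sub, hX, hX', hPN, hKN,
    hKN', ← hU]
  ring

variable {m r κ : ℕ} {Ω : Type*} (M : Model m r κ Ω) (ω : Option Ω)

lemma posSemidef_riccatiAux (j : ℕ) : (riccatiAux M ω j).PosSemidef := by
  induction j with
  | zero => exact M.Q_posSemidef ω
  | succ j ih =>
    exact (M.Q_posSemidef ω).add
      (posSemidef_transpose_mul_mul (posSemidef_riccati_step ih M.B (M.R_posDef ω)) M.A)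

lemma posSemidef_riccatiAux_sub : ∀ j, (riccatiAux M ω j - M.Q ω).PosSemidef
  | 0 => by simpa only [riccatiAux, sub_self] using Matrix.PosSemidef.zero
  | j + 1 => by
    simpa only [riccatiAux, add_sub_cancel_left] using posSemidef_transpose_mul_mul
      (posSemidef_riccati_step (posSemidef_riccatiAux M ω j) M.B (M.R_posDef ω)) M.A

lemma posSemidef_riccati (k : ℕ) : (riccati M ω k).PosSemidef := posSemidef_riccatiAux M ω _

lemma riccati_last : riccati M ω κ = M.Q ω := by
  rw [riccati, Nat.sub_self, riccatiAux]

lemma posDef_delta (k : Fin κ) : (delta M ω k).PosDef :=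
  posDef_transpose_mul_mul_add (posSemidef_riccati M ω _) M.B (M.R_posDef ω)

lemma delta_mul_feedback (k : Fin κ) :
    delta M ω k * feedback M ω k = M.Bᵀ * riccati M ω (k.val + 1) * M.A := by
  rw [feedback]
  simp only [← Matrix.mul_assoc]
  rw [mul_inv_of_posDef (posDef_delta M ω k), Matrix.one_mul]

lemma riccati_sub (k : Fin κ) :
    riccati M ω k.val - M.Q ω = M.Aᵀ * riccati M ω (k.val + 1) * M.A
      - (feedback M ω k)ᵀ * delta M ω k * feedback M ω k := by
  have hPt := transpose_eq_of_posSemidef (posSemidef_riccati M ω (k.val + 1))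
  have hDt := transpose_eq_of_posSemidef (posDef_delta M ω k).posSemidef
  have hstep : riccati M ω k.val = M.Q ω + M.Aᵀ * (riccati M ω (k.val + 1)
      - riccati M ω (k.val + 1) * M.B * (delta M ω k)⁻¹ * M.Bᵀ * riccati M ω (k.val + 1))
        * M.A := by
    rw [riccati, show κ - k.val = (κ - (k.val + 1)) + 1 by omega, riccatiAux]
    rfl
  rw [hstep, Matrix.mul_assoc _ (delta M ω k), delta_mul_feedback, feedback]
  simp only [Matrix.transpose_mul, Matrix.transpose_nonsing_inv, hPt, hDt,
    Matrix.transpose_transpose, Matrix.mul_sub, Matrix.sub_mul, Matrix.mul_assoc]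
  abel

end riccati

section cost

variable {m r κ : ℕ} {Ω : Type*} (M : Model m r κ Ω) (ω : Option Ω) (η : SignalRule m κ)
  (γ : ControlPolicy m r κ)

/-- Square integrability of all inputs: the policies among which best responses are to be found,
since `R` is positive definite. -/
def FiniteEnergy : Prop :=
  ∀ k, SquareIntegrable (law M η) (fun z => controlInput M η γ z k)

/-- The deviation `u_k + K_k E{x_k | s_1, …, s_k}` of the input from the certainty-equivalent
linear feedback. -/
def deviation (k : Fin κ) (z : Sample m κ) : Vec r :=
  controlInput M η γ z k + feedback M ω k *ᵥ
    (estimate M η k z + forcedState M (controlInput M η γ z) k)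

/-- The smallest cost that the player C of type `ω` can achieve against `η`. -/
def optimalCost : ℝ :=
  delta0 M ω + ∑ k : Fin κ, (delta M ω k * crossMoment (law M η)
    (fun z => feedback M ω k *ᵥ estimateError M η k z)
    (fun z => feedback M ω k *ᵥ estimateError M η k z)).trace

/-- The potential `E‖x_n‖²` in the weight `Q̃_n - Q`, along which the stage costs telescope. -/
def excessCostToGo (n : Fin (κ + 1)) : ℝ :=
  ((riccati M ω n - M.Q ω) * crossMoment (law M η)
    (fun z => state M η γ z n (Nat.le_of_lt_succ n.isLt))
    (fun z => state M η γ z n (Nat.le_of_lt_succ n.isLt))).trace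

lemma measurable_forcedState_openAlg (k : Fin κ) :
    Measurable[openAlg M η k] (fun z => forcedState M (controlInput M η γ z) k) :=
  measurable_forcedState M fun _ hl => measurable_controlInput_openAlg M η γ hl.le

lemma measurable_deviation (k : Fin κ) : Measurable[openAlg M η k] (deviation M ω η γ k) :=
  (measurable_controlInput_openAlg M η γ le_rfl).add (measurable_mulVec _
    ((measurable_estimate M η le_rfl).add (measurable_forcedState_openAlg M η γ k)))

lemma optimalCost_nonneg : 0 ≤ optimalCost M ω η :=
  add_nonneg
    (add_nonneg
      (trace_mul_nonneg_of_posSemidef (posSemidef_riccatiAux_sub M ω _) M.covInit_posSemidef)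
      (Finset.sum_nonneg fun _ _ =>
        trace_mul_nonneg_of_posSemidef (posSemidef_riccati M ω _) M.covNoise_posSemidef))
    (Finset.sum_nonneg fun k _ =>
      trace_mul_nonneg_of_posSemidef (posDef_delta M ω k).posSemidef
        (posSemidef_crossMoment_self ((squareIntegrable_estimateError M η k).mulVec _)))

lemma excessCostToGo_zero :
    excessCostToGo M ω η γ 0 = ((riccati M ω 0 - M.Q ω) * M.covInit).trace := by
  rw [← crossMoment_initial M η]
  rw [excessCostToGo]
  congr 3 <;> funext z <;> exact state.eq_1 M η γ z _

lemma excessCostToGo_last : excessCostToGo M ω η γ (Fin.last κ) = 0 := by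
  simp only [excessCostToGo, Fin.val_last, riccati_last, sub_self, Matrix.zero_mul,
    Matrix.trace_zero]

variable {M η γ}

namespace FiniteEnergy

lemma squareIntegrable_forcedState (h : FiniteEnergy M η γ) (k : Fin κ) :
    SquareIntegrable (law M η) (fun z => forcedState M (controlInput M η γ z) k) :=
  SquareIntegrable.sum fun l _ => (h l).mulVec _

lemma squareIntegrable_stateAt (h : FiniteEnergy M η γ) (k : Fin κ) :
    SquareIntegrable (law M η) (stateAt M η γ k) := by
  rw [funext (stateAt_eq M η γ k)]
  exact (squareIntegrable_freeState M η k).add (h.squareIntegrable_forcedState k)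

lemma squareIntegrable_deviation (h : FiniteEnergy M η γ) (k : Fin κ) :
    SquareIntegrable (law M η) (deviation M ω η γ k) :=
  (h k).add (((squareIntegrable_estimate M η k).add (h.squareIntegrable_forcedState k)).mulVec _)

lemma squareIntegrable_nextState (h : FiniteEnergy M η γ) (k : Fin κ) :
    SquareIntegrable (law M η) (fun z => nextState M η γ z k) := by
  simp only [nextState_eq]
  exact (((h.squareIntegrable_stateAt k).mulVec _).add ((h k).mulVec _)).add
    (squareIntegrable_stateNoise M η k)

lemma crossMoment_stateNoise_stateAt (h : FiniteEnergy M η γ) (k : Fin κ) :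
    crossMoment (law M η) (fun z => z.1.2 k) (stateAt M η γ k) = 0 := by
  rw [funext (stateAt_eq M η γ k),
    crossMoment_add_right (squareIntegrable_stateNoise M η k) (squareIntegrable_freeState M η k)
      (h.squareIntegrable_forcedState k),
    crossMoment_stateNoise_freeState M η le_rfl, crossMoment_stateNoise_openAlg M η
      (h.squareIntegrable_forcedState k) (measurable_forcedState_openAlg M η γ k), add_zero]

lemma crossMoment_nextState (h : FiniteEnergy M η γ) (k : Fin κ) :
    crossMoment (law M η) (fun z => nextState M η γ z k) (fun z => nextState M η γ z k)
      = crossMoment (law M η) (fun z => M.A *ᵥ stateAt M η γ k z + M.B *ᵥ controlInput M η γ z k)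
          (fun z => M.A *ᵥ stateAt M η γ k z + M.B *ᵥ controlInput M η γ z k) + M.covNoise := by
  have hx := h.squareIntegrable_stateAt k
  have hw := squareIntegrable_stateNoise M η k
  simp only [nextState_eq]
  rw [crossMoment_add_self_of_uncorrelated ((hx.mulVec _).add ((h k).mulVec _)) hw,
    crossMoment_stateNoise]
  rw [crossMoment_add_right hw (hx.mulVec _) ((h k).mulVec _), crossMoment_mulVec_right hw hx,
    crossMoment_mulVec_right hw (h k), h.crossMoment_stateNoise_stateAt,
    crossMoment_stateNoise_openAlg M η (h k) (measurable_controlInput_openAlg M η γ le_rfl),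
    Matrix.zero_mul, Matrix.zero_mul, add_zero]

lemma crossMoment_residual (h : FiniteEnergy M η γ) (k : Fin κ) :
    crossMoment (law M η)
        (fun z => controlInput M η γ z k + feedback M ω k *ᵥ stateAt M η γ k z)
        (fun z => controlInput M η γ z k + feedback M ω k *ᵥ stateAt M η γ k z)
      = crossMoment (law M η) (deviation M ω η γ k) (deviation M ω η γ k)
        + crossMoment (law M η) (fun z => feedback M ω k *ᵥ estimateError M η k z)
          (fun z => feedback M ω k *ᵥ estimateError M η k z) := by
  have hv := h.squareIntegrable_deviation ω k
  have he := squareIntegrable_estimateError M η k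
  have hsplit : (fun z => controlInput M η γ z k + feedback M ω k *ᵥ stateAt M η γ k z)
      = fun z => deviation M ω η γ k z + feedback M ω k *ᵥ estimateError M η k z := by
    funext z
    rw [stateAt_eq, deviation, estimateError, add_assoc, ← Matrix.mulVec_add]
    congr 2
    abel
  rw [hsplit, crossMoment_add_self_of_uncorrelated hv (he.mulVec _)]
  rw [crossMoment_mulVec_left he hv,
    crossMoment_estimateError_left M η hv (measurable_deviation M ω η γ k), Matrix.mul_zero]

lemma stage_identity (h : FiniteEnergy M η γ) (k : Fin κ) :
    (riccati M ω (k.val + 1) * crossMoment (law M η) (fun z => nextState M η γ z k)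
        (fun z => nextState M η γ z k)).trace
      + (M.R ω * crossMoment (law M η) (fun z => controlInput M η γ z k)
        (fun z => controlInput M η γ z k)).trace
    = ((riccati M ω k.val - M.Q ω)
        * crossMoment (law M η) (stateAt M η γ k) (stateAt M η γ k)).trace
      + (delta M ω k * crossMoment (law M η)
          (fun z => controlInput M η γ z k + feedback M ω k *ᵥ stateAt M η γ k z)
          (fun z => controlInput M η γ z k + feedback M ω k *ᵥ stateAt M η γ k z)).trace
      + (riccati M ω (k.val + 1) * M.covNoise).trace := by
  have hx := h.squareIntegrable_stateAt k
  have hu := h k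
  have hcompletion := trace_completion
    (transpose_eq_of_posSemidef (posSemidef_riccati M ω (k.val + 1))) M.A
    (D := delta M ω k) rfl (transpose_eq_of_posSemidef (posDef_delta M ω k).posSemidef)
    (delta_mul_feedback M ω k) (crossMoment (law M η) (stateAt M η γ k) (stateAt M η γ k))
    (crossMoment (law M η) (stateAt M η γ k) (fun z => controlInput M η γ z k))
    (crossMoment (law M η) (fun z => controlInput M η γ z k) (fun z => controlInput M η γ z k))
  rw [h.crossMoment_nextState, Matrix.mul_add, Matrix.trace_add, add_right_comm, riccati_sub,
    crossMoment_add_self (hx.mulVec _) (hu.mulVec _), crossMoment_add_self hu (hx.mulVec _)]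
  simp only [crossMoment_mulVec_self hx, crossMoment_mulVec_self hu,
    crossMoment_mulVec_left hx (hu.mulVec _), crossMoment_mulVec_right hx hu,
    crossMoment_mulVec_right hu hx]
  simp only [Matrix.transpose_mul, Matrix.transpose_transpose, crossMoment_transpose,
    Matrix.mul_assoc] at hcompletion ⊢
  rw [hcompletion]

lemma stage_cost (h : FiniteEnergy M η γ) (k : Fin κ) :
    (M.Q ω * crossMoment (law M η) (fun z => nextState M η γ z k)
        (fun z => nextState M η γ z k)).trace
      + (M.R ω * crossMoment (law M η) (fun z => controlInput M η γ z k)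
        (fun z => controlInput M η γ z k)).trace
    = excessCostToGo M ω η γ k.castSucc - excessCostToGo M ω η γ k.succ
      + (riccati M ω (k.val + 1) * M.covNoise).trace
      + (delta M ω k * crossMoment (law M η) (fun z => feedback M ω k *ᵥ estimateError M η k z)
          (fun z => feedback M ω k *ᵥ estimateError M η k z)).trace
      + (delta M ω k
          * crossMoment (law M η) (deviation M ω η γ k) (deviation M ω η γ k)).trace := by
  have hsucc : excessCostToGo M ω η γ k.succ
      = (riccati M ω (k.val + 1) * crossMoment (law M η) (fun z => nextState M η γ z k)
          (fun z => nextState M η γ z k)).trace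
        - (M.Q ω * crossMoment (law M η)
          (fun z => nextState M η γ z k) (fun z => nextState M η γ z k)).trace := by
    rw [← Matrix.trace_sub, ← Matrix.sub_mul]
    rfl
  have hcast : excessCostToGo M ω η γ k.castSucc = ((riccati M ω k.val - M.Q ω)
      * crossMoment (law M η) (stateAt M η γ k) (stateAt M η γ k)).trace := rfl
  have hstage := h.stage_identity ω k
  rw [h.crossMoment_residual, Matrix.mul_add, Matrix.trace_add] at hstage
  rw [hsucc, hcast]
  linarith

lemma sum_cost (h : FiniteEnergy M η γ) :
    ∑ k : Fin κ, ((M.Q ω * crossMoment (law M η) (fun z => nextState M η γ z k)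
        (fun z => nextState M η γ z k)).trace
      + (M.R ω * crossMoment (law M η) (fun z => controlInput M η γ z k)
        (fun z => controlInput M η γ z k)).trace)
    = optimalCost M ω η + ∑ k : Fin κ, (delta M ω k * crossMoment (law M η)
      (deviation M ω η γ k) (deviation M ω η γ k)).trace := by
  have htelescope : ∑ k : Fin κ,
      (excessCostToGo M ω η γ k.castSucc - excessCostToGo M ω η γ k.succ)
        = ((riccati M ω 0 - M.Q ω) * M.covInit).trace := by
    have hsum := Fin.sum_univ_succ (excessCostToGo M ω η γ)
    rw [Fin.sum_univ_castSucc, excessCostToGo_zero, excessCostToGo_last] at hsum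
    rw [Finset.sum_sub_distrib]
    linarith
  simp only [h.stage_cost ω, Finset.sum_add_distrib, htelescope, optimalCost, delta0]

lemma followerCost_eq (h : FiniteEnergy M η γ) :
    followerCost M ω η γ = ENNReal.ofReal (optimalCost M ω η + ∑ k : Fin κ,
      (delta M ω k * crossMoment (law M η) (deviation M ω η γ k) (deviation M ω η γ k)).trace) := by
  have hx := fun k => trace_mul_nonneg_of_posSemidef (M.Q_posSemidef ω)
    (posSemidef_crossMoment_self (h.squareIntegrable_nextState k))
  have hu := fun k => trace_mul_nonneg_of_posSemidef (M.R_posDef ω).posSemidef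
    (posSemidef_crossMoment_self (h k))
  rw [← h.sum_cost ω, followerCost,
    ENNReal.ofReal_sum_of_nonneg fun k _ => add_nonneg (hx k) (hu k)]
  refine Finset.sum_congr rfl fun k _ => ?_
  rw [meanQuad_eq (M.Q_posSemidef ω) (h.squareIntegrable_nextState k),
    meanQuad_eq (M.R_posDef ω).posSemidef (h k), ENNReal.ofReal_add (hx k) (hu k)]

lemma trace_deviation_nonneg (h : FiniteEnergy M η γ) (k : Fin κ) :
    0 ≤ (delta M ω k * crossMoment (law M η) (deviation M ω η γ k)
      (deviation M ω η γ k)).trace :=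
  trace_mul_nonneg_of_posSemidef (posDef_delta M ω k).posSemidef
    (posSemidef_crossMoment_self (h.squareIntegrable_deviation ω k))

lemma of_followerCost_ne_top (h : followerCost M ω η γ ≠ ⊤) : FiniteEnergy M η γ := by
  intro k
  refine SquareIntegrable.of_meanQuad_ne_top (M.R_posDef ω)
    ((measurable_controlInput_openAlg M η γ le_rfl).mono (openAlg_le M η k) le_rfl)
    fun htop => h ?_
  rw [followerCost, ENNReal.sum_eq_top]
  exact ⟨k, Finset.mem_univ k, by rw [htop, add_top]⟩

lemma of_deviation_eq_zero (h : ∀ k z, deviation M ω η γ k z = 0) : FiniteEnergy M η γ := by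
  intro k
  induction k using WellFoundedLT.induction with
  | ind k ih =>
    have hforced : SquareIntegrable (law M η) (fun z => forcedState M (controlInput M η γ z) k) :=
      SquareIntegrable.sum fun l hl => (ih l (Finset.mem_Iio.mp hl)).mulVec _
    have hu : (fun z => controlInput M η γ z k) = fun z => -(feedback M ω k *ᵥ
        (estimate M η k z + forcedState M (controlInput M η γ z) k)) :=
      funext fun z => eq_neg_of_add_eq_zero_left (h k z)
    rw [hu]
    exact (((squareIntegrable_estimate M η k).add hforced).mulVec _).neg

end FiniteEnergy

end cost

section bestResponse

variable {m r κ : ℕ} {Ω : Type*} {M : Model m r κ Ω} (ω : Option Ω) {η : SignalRule m κ}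
  {γ γ' : ControlPolicy m r κ}

lemma forcedState_congr {u u' : Fin κ → Vec r} {k : Fin κ} (h : ∀ l < k, u l = u' l) :
    forcedState M u k = forcedState M u' k :=
  Finset.sum_congr rfl fun l hl => by rw [h l (Finset.mem_Iio.mp hl)]

lemma forcedSignal_congr {u u' : Fin κ → Vec r} {k : Fin κ} (h : ∀ l < k, u l = u' l) :
    forcedSignal M η u k = forcedSignal M η u' k :=
  Finset.sum_congr rfl fun j _ => by
    rw [forcedState_congr fun l hl => h l (hl.trans_le (Nat.le_of_lt_succ j.isLt))]

lemma signal_congr {k : Fin κ} (h : ∀ j < k, γ.act j = γ'.act j) (z : Sample m κ) :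
    signal M η γ z k = signal M η γ' z k := by
  induction k using WellFoundedLT.induction with
  | ind k ih =>
    rw [signal_eq, signal_eq, forcedSignal_congr fun l hl => ?_]
    rw [controlInput, controlInput, h l hl]
    refine congrArg _ (funext fun i => ?_)
    have hil : (⟨i.val, lt_of_le_of_lt (Nat.le_of_lt_succ i.isLt) l.isLt⟩ : Fin κ) ≤ l :=
      Nat.le_of_lt_succ i.isLt
    exact ih _ (hil.trans_lt hl) fun j hj => h j (hj.trans (hil.trans_lt hl))

lemma signalHistory_congr {k : Fin κ} (h : ∀ j < k, γ.act j = γ'.act j) (z : Sample m κ) :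
    signalHistory M η γ k z = signalHistory M η γ' k z :=
  funext fun i => signal_congr (fun j hj => h j (hj.trans_le (Nat.le_of_lt_succ i.isLt))) z

lemma controlInput_congr {k : Fin κ} (h : ∀ j ≤ k, γ.act j = γ'.act j) (z : Sample m κ) :
    controlInput M η γ z k = controlInput M η γ' z k := by
  rw [controlInput, controlInput, h k le_rfl, signalHistory_congr fun j hj => h j hj.le]

lemma deviation_congr {k : Fin κ} (h : ∀ j ≤ k, γ.act j = γ'.act j) (z : Sample m κ) :
    deviation M ω η γ k z = deviation M ω η γ' k z := by
  rw [deviation, deviation, controlInput_congr h,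
    forcedState_congr fun l hl => controlInput_congr (fun j hj => h j (hj.trans hl.le)) z]

variable (M η γ) in
lemma exists_act_eq_deviation_eq_zero (k : Fin κ) :
    ∃ γ' : ControlPolicy m r κ, (∀ j < k, γ.act j = γ'.act j) ∧
      ∀ z, deviation M ω η γ' k z = 0 := by
  have hmeas : Measurable[MeasurableSpace.comap (signalHistory M η γ k) inferInstance]
      (fun z => -(feedback M ω k *ᵥ
        (estimate M η k z + forcedState M (controlInput M η γ z) k))) := by
    rw [comap_signalHistory]
    exact (measurable_mulVec _ ((measurable_estimate M η le_rfl).add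
      (measurable_forcedState_openAlg M η γ k))).neg
  obtain ⟨φ, hφ, hφ_eq⟩ := hmeas.exists_eq_measurable_comp
  let γ' : ControlPolicy m r κ :=
    { act := Function.update γ.act k φ
      measurable_act := fun j => by
        rcases eq_or_ne j k with rfl | hjk
        · rwa [Function.update_self]
        · rw [Function.update_of_ne hjk]
          exact γ.measurable_act j }
  have hact : ∀ j < k, γ.act j = γ'.act j := fun j hj => (Function.update_of_ne hj.ne _ _).symm
  refine ⟨γ', hact, fun z => ?_⟩
  have hu : controlInput M η γ' z k = φ (signalHistory M η γ k z) := by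
    rw [controlInput, ← signalHistory_congr hact]
    exact congrFun (Function.update_self _ _ _) _
  rw [deviation, ← forcedState_congr fun l hl =>
      controlInput_congr (fun j hj => hact j (hj.trans_lt hl)) z, hu,
    ← Function.comp_apply (f := φ), ← hφ_eq, neg_add_cancel]

variable (M η) in
lemma exists_deviation_eq_zero :
    ∃ γ : ControlPolicy m r κ, ∀ k z, deviation M ω η γ k z = 0 := by
  suffices h : ∀ n : ℕ, ∃ γ : ControlPolicy m r κ, ∀ k : Fin κ, k.val < n →
      ∀ z, deviation M ω η γ k z = 0 by
    obtain ⟨γ, hγ⟩ := h κ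
    exact ⟨γ, fun k => hγ k k.isLt⟩
  intro n
  induction n with
  | zero =>
    exact ⟨⟨fun _ _ => 0, fun _ => measurable_const⟩, fun k hk => absurd hk (Nat.not_lt_zero _)⟩
  | succ n ih =>
    obtain ⟨γ, hγ⟩ := ih
    by_cases hn : n < κ
    · obtain ⟨γ', hact, hγ'⟩ := exists_act_eq_deviation_eq_zero M ω η γ ⟨n, hn⟩
      refine ⟨γ', fun k hk z => ?_⟩
      rcases Nat.lt_succ_iff_lt_or_eq.mp hk with hlt | heq
      · rw [← deviation_congr ω fun j hj => hact j (hj.trans_lt hlt)]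
        exact hγ k hlt z
      · rw [Fin.ext (b := ⟨n, hn⟩) heq]
        exact hγ' z
    · exact ⟨γ, fun k _ => hγ k (k.isLt.trans_le (not_lt.mp hn))⟩

lemma followerCost_of_deviation_ae_eq_zero (hu : FiniteEnergy M η γ)
    (h : ∀ k, deviation M ω η γ k =ᵐ[law M η] fun _ => 0) :
    followerCost M ω η γ = ENNReal.ofReal (optimalCost M ω η) := by
  have hmoment : ∀ k, crossMoment (law M η) (deviation M ω η γ k) (deviation M ω η γ k) = 0 :=
    fun k => by rw [crossMoment_congr (h k) (h k), crossMoment_zero_right]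
  simp only [hu.followerCost_eq, hmoment, Matrix.mul_zero, Matrix.trace_zero,
    Finset.sum_const_zero, add_zero]

lemma isBestResponse_of_deviation_eq_zero (h : ∀ k z, deviation M ω η γ k z = 0) :
    IsBestResponse M ω η γ := by
  intro γ'
  rw [followerCost_of_deviation_ae_eq_zero ω (FiniteEnergy.of_deviation_eq_zero ω h)
    fun k => Filter.Eventually.of_forall (h k)]
  by_cases htop : followerCost M ω η γ' = ⊤
  · exact htop ▸ le_top
  · have hu := FiniteEnergy.of_followerCost_ne_top ω htop
    rw [hu.followerCost_eq]
    exact ENNReal.ofReal_le_ofReal (le_add_of_nonneg_right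
      (Finset.sum_nonneg fun k _ => hu.trace_deviation_nonneg ω k))

lemma IsBestResponse.finiteEnergy_and_deviation (h : IsBestResponse M ω η γ) :
    FiniteEnergy M η γ ∧ ∀ k, deviation M ω η γ k =ᵐ[law M η] fun _ => 0 := by
  obtain ⟨γ₀, hγ₀⟩ := exists_deviation_eq_zero M ω η
  have hle := h γ₀
  rw [followerCost_of_deviation_ae_eq_zero ω (FiniteEnergy.of_deviation_eq_zero ω hγ₀)
    fun k => Filter.Eventually.of_forall (hγ₀ k)] at hle
  have hu := FiniteEnergy.of_followerCost_ne_top ω (ne_top_of_le_ne_top ENNReal.ofReal_ne_top hle)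
  refine ⟨hu, fun k => ae_eq_zero_of_trace_eq_zero (posDef_delta M ω k)
    (hu.squareIntegrable_deviation ω k) ?_⟩
  rw [hu.followerCost_eq, ENNReal.ofReal_le_ofReal_iff (optimalCost_nonneg M ω η)] at hle
  have hnonneg := fun k (_ : k ∈ Finset.univ) => hu.trace_deviation_nonneg ω k
  exact (Finset.sum_eq_zero_iff_of_nonneg hnonneg).mp
    (le_antisymm (by linarith) (Finset.sum_nonneg hnonneg)) k (Finset.mem_univ k)

variable (M) in
lemma exists_isReaction :
    ∃ g : SignalRule m κ → Option Ω → ControlPolicy m r κ, IsReaction M g := by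
  choose g hg using fun (η : SignalRule m κ) (ω : Option Ω) => exists_deviation_eq_zero M ω η
  exact ⟨g, fun η ω => isBestResponse_of_deviation_eq_zero ω (hg η ω)⟩

end bestResponse

/-! ### The cost of the sensor -/

section augmented

variable {ι ι' α β : Type*} {V : Matrix (ι × α) (ι' × β) ℝ}

lemma SquareIntegrable.augment {S : Type*} [MeasurableSpace S] {P : Measure S}
    {X : S → ι → α → ℝ} (hX : ∀ k, SquareIntegrable P fun z => X z k) :
    SquareIntegrable P fun z => augment (X z) := fun a => hX a.1 a.2

lemma mulVec_augment [Fintype ι'] [Fintype β] (V : Matrix (ι × α) (ι' × β) ℝ) (x : ι' → β → ℝ) :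
    V *ᵥ augment x = augment fun k => ∑ l, V.submatrix (Prod.mk k) (Prod.mk l) *ᵥ x l := by
  ext ⟨k, i⟩
  simp only [augment, Matrix.mulVec, dotProduct, Fintype.sum_prod_type, Finset.sum_apply,
    Matrix.submatrix_apply]

lemma trace_mul_crossMoment_augment {S : Type*} [MeasurableSpace S] {P : Measure S} [Fintype ι]
    [Fintype α] [Fintype ι'] [Fintype β] (V : Matrix (ι × α) (ι' × β) ℝ) (X : S → ι' → β → ℝ)
    (Y : S → ι → α → ℝ) :
    (V * crossMoment P (fun z => augment (X z)) (fun z => augment (Y z))).trace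
      = ∑ k, ∑ l, (V.submatrix (Prod.mk k) (Prod.mk l)
          * crossMoment P (fun z => X z l) (fun z => Y z k)).trace := by
  simp only [Matrix.trace, Matrix.diag_apply, Matrix.mul_apply, Fintype.sum_prod_type,
    Matrix.submatrix_apply]
  exact Finset.sum_congr rfl fun k _ => Finset.sum_comm

section blockDiagonal

variable [Fintype ι] [DecidableEq ι] [Fintype β] {V : Matrix (ι × α) (ι × β) ℝ}
  {W : ι → Matrix α β ℝ}

lemma mulVec_augment_of_blockDiagonal
    (hV : ∀ k l, V.submatrix (Prod.mk k) (Prod.mk l) = if k = l then W k else 0)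
    (x : ι → β → ℝ) : V *ᵥ augment x = augment fun k => W k *ᵥ x k := by
  rw [mulVec_augment]
  congr with k : 1
  rw [Finset.sum_eq_single_of_mem k (Finset.mem_univ k) fun l _ hl => by
    rw [hV, if_neg hl.symm, Matrix.zero_mulVec], hV, if_pos rfl]

lemma trace_mul_crossMoment_augment_of_blockDiagonal [Fintype α] {S : Type*} [MeasurableSpace S]
    {P : Measure S}
    (hV : ∀ k l, V.submatrix (Prod.mk k) (Prod.mk l) = if k = l then W k else 0)
    (X : S → ι → β → ℝ) (Y : S → ι → α → ℝ) :
    (V * crossMoment P (fun z => augment (X z)) (fun z => augment (Y z))).trace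
      = ∑ k, (W k * crossMoment P (fun z => X z k) (fun z => Y z k)).trace := by
  rw [trace_mul_crossMoment_augment]
  refine Finset.sum_congr rfl fun k _ => ?_
  rw [Finset.sum_eq_single_of_mem k (Finset.mem_univ k) fun l _ hl => by
    rw [hV, if_neg hl.symm, Matrix.zero_mul, Matrix.trace_zero], hV, if_pos rfl]

end blockDiagonal

lemma trace_mul_mul_mul_transpose [Fintype ι] [Fintype ι'] (W : Matrix ι ι ℝ) (C : Matrix ι ι' ℝ)
    (E : Matrix ι' ι' ℝ) (D : Matrix ι ι' ℝ) :
    (W * (C * E * Dᵀ)).trace = (Dᵀ * W * C * E).trace := by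
  rw [← Matrix.mul_assoc, Matrix.trace_mul_comm]
  simp only [Matrix.mul_assoc]

lemma trace_transpose_mul_mul_mul_comm [Fintype ι] [Fintype ι'] {W : Matrix ι ι ℝ}
    {E : Matrix ι' ι' ℝ} (hW : Wᵀ = W) (hE : Eᵀ = E) (C D : Matrix ι ι' ℝ) :
    (Cᵀ * W * D * E).trace = (Dᵀ * W * C * E).trace := by
  rw [← Matrix.trace_transpose]
  simp only [Matrix.transpose_mul, Matrix.transpose_transpose, hE, hW]
  rw [Matrix.trace_mul_comm]
  simp only [Matrix.mul_assoc]

lemma sum_sum_eq_sum_diag_add [Fintype ι] [LinearOrder ι] [LocallyFiniteOrderTop ι]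
    [LocallyFiniteOrderBot ι] (g : ι → ι → ℝ) :
    ∑ k, ∑ l, g k l = ∑ k, (g k k + ∑ l ∈ Finset.Ioi k, (g k l + g l k)) := by
  have hrow : ∀ k,
      ∑ l, g k l = g k k + (∑ l ∈ Finset.Ioi k, g k l + ∑ l ∈ Finset.Iio k, g k l) := by
    intro k
    have huniv : (Finset.univ : Finset ι) = insert k (Finset.Ioi k ∪ Finset.Iio k) := by
      ext l
      simpa [eq_comm, or_comm, or_left_comm] using lt_trichotomy k l
    rw [huniv, Finset.sum_insert (by simp), Finset.sum_union]
    exact Finset.disjoint_left.mpr fun l hlt hgt =>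
      lt_asymm (Finset.mem_Ioi.mp hlt) (Finset.mem_Iio.mp hgt)
  have hlower : ∑ k, ∑ l ∈ Finset.Iio k, g k l = ∑ k, ∑ l ∈ Finset.Ioi k, g l k :=
    Finset.sum_comm' fun k l => by simp
  simp only [hrow, Finset.sum_add_distrib, hlower]

end augmented

section horizon

variable {m r κ : ℕ} {Ω : Type*} (M : Model m r κ Ω) (ω : Option Ω) (η : SignalRule m κ)

/-- The contribution `A f_k + B u_k` of the inputs to the state `x_{k+1}`. -/
def controlEffect (u : Fin κ → Vec r) (k : Fin κ) : Vec m :=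
  M.A *ᵥ forcedState M u k + M.B *ᵥ u k

/-- The posteriors of all stages, stacked. -/
def bigEstimate (z : Sample m κ) : Fin κ × Fin m → ℝ := augment fun k => estimate M η k z

lemma squareIntegrable_bigEstimate : SquareIntegrable (law M η) (bigEstimate M η) :=
  SquareIntegrable.augment (squareIntegrable_estimate M η)

lemma bigK_submatrix (k l : Fin κ) :
    (bigK M ω).submatrix (Prod.mk k) (Prod.mk l) = if k = l then feedback M ω k else 0 := by
  ext i j
  simp only [bigK, Matrix.submatrix_apply, Matrix.of_apply]
  split_ifs <;> rfl

lemma bigDelta_submatrix (k l : Fin κ) :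
    (bigDelta M ω).submatrix (Prod.mk k) (Prod.mk l) = if k = l then delta M ω k else 0 := by
  ext i j
  simp only [bigDelta, Matrix.submatrix_apply, Matrix.of_apply]
  split_ifs <;> rfl

lemma bigDiag_submatrix (X : Mat m) (k l : Fin κ) :
    (bigDiag X).submatrix (Prod.mk k) (Prod.mk l) = if k = l then X else 0 := by
  ext i j
  by_cases hkl : k = l <;> simp [bigDiag, hkl]

lemma transpose_bigDiag (X : Mat m) : (bigDiag (κ := κ) X)ᵀ = bigDiag Xᵀ := by
  rw [bigDiag, ← Matrix.kroneckerMap_transpose, Matrix.transpose_one, bigDiag]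

lemma mulVec_augment_of_blockTriangular {n : ℕ} {V : Matrix (Fin κ × Fin n) (Fin κ × Fin r) ℝ}
    {D : Fin κ → Matrix (Fin n) (Fin r) ℝ} {C : Fin κ → Matrix (Fin n) (Fin m) ℝ}
    (hV : ∀ k l, V.submatrix (Prod.mk k) (Prod.mk l) = if k = l then D k
      else if l < k then C k * (M.A ^ (k.val - l.val - 1) * M.B) else 0) (u : Fin κ → Vec r) :
    V *ᵥ augment u = augment fun k => D k *ᵥ u k + C k *ᵥ forcedState M u k := by
  rw [mulVec_augment]
  congr with k : 1
  have hterm : ∀ l, V.submatrix (Prod.mk k) (Prod.mk l) *ᵥ u l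
      = (if k = l then D k *ᵥ u l else 0) + (if l < k then
        C k *ᵥ ((M.A ^ (k.val - l.val - 1) * M.B) *ᵥ u l) else 0) := by
    intro l
    rw [hV, Matrix.mulVec_mulVec]
    rcases lt_trichotomy k l with h | rfl | h
    · simp [h.ne, h.not_gt]
    · simp
    · simp [h.ne', h]
  have hfilter : Finset.univ.filter (fun l => l < k) = Finset.Iio k := by ext; simp
  rw [Finset.sum_congr rfl fun l _ => hterm l, Finset.sum_add_distrib, Finset.sum_ite_eq,
    if_pos (Finset.mem_univ k), ← Finset.sum_filter, hfilter, forcedState, Matrix.mulVec_sum]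

lemma bigPhi_mulVec_augment (u : Fin κ → Vec r) :
    bigPhi M ω *ᵥ augment u = augment fun k => u k + feedback M ω k *ᵥ forcedState M u k := by
  simpa only [Matrix.one_mulVec] using
    mulVec_augment_of_blockTriangular (D := fun _ => 1) (C := feedback M ω) M (fun k l => by
      ext i j
      rw [← Matrix.mul_assoc]
      simp only [bigPhi, Matrix.submatrix_apply, Matrix.of_apply]
      split_ifs <;> rfl) u

lemma bigZ_mulVec_augment (u : Fin κ → Vec r) :
    bigZ M *ᵥ augment u = augment (controlEffect M u) := by
  rw [mulVec_augment_of_blockTriangular (D := fun _ => M.B) (C := fun _ => M.A) M fun k l => ?_]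
  · exact congrArg augment (funext fun k => add_comm _ _)
  ext i j
  simp only [bigZ, Matrix.submatrix_apply, Matrix.of_apply]
  rcases lt_trichotomy k l with h | rfl | h
  · simp [h.ne, h.not_gt, h.not_ge]
  · simp
  · have hpow : k.val - l.val = k.val - l.val - 1 + 1 := by
      have : l.val < k.val := h
      omega
    rw [if_pos h.le, if_neg h.ne', if_pos h, ← Matrix.mul_assoc, ← pow_succ', ← hpow]

lemma isUnit_bigPhi : IsUnit (bigPhi M ω) := by
  rw [← Matrix.mulVec_injective_iff_isUnit]
  refine (injective_iff_map_eq_zero (bigPhi M ω).mulVecLin).mpr fun v hv => ?_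
  let u : Fin κ → Vec r := fun k i => v (k, i)
  change bigPhi M ω *ᵥ augment u = 0 at hv
  rw [bigPhi_mulVec_augment] at hv
  have hu : ∀ k, u k = 0 := by
    intro k
    induction k using WellFoundedLT.induction with
    | ind k ih =>
      have hforced : forcedState M u k = 0 :=
        Finset.sum_eq_zero fun l hl => by rw [ih l (Finset.mem_Iio.mp hl), Matrix.mulVec_zero]
      ext i
      simpa [augment, hforced] using congrFun hv (k, i)
  ext ⟨k, i⟩
  exact congrFun (hu k) i

lemma trace_bigV_mul_bigEstimate :
    (bigV M ω * crossMoment (law M η) (bigEstimate M η) (bigEstimate M η)).trace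
      = ∑ k, (crossMoment (law M η) (estimate M η k) (estimate M η k) * Xi M ω k).trace := by
  refine (trace_mul_crossMoment_augment ..).trans ?_
  rw [sum_sum_eq_sum_diag_add]
  refine Finset.sum_congr rfl fun k _ => ?_
  rw [Matrix.trace_mul_comm _ (Xi M ω k), Xi, Matrix.add_mul, Matrix.trace_add,
    Finset.sum_mul, Matrix.trace_sum]
  refine congrArg₂ _ rfl (Finset.sum_congr rfl fun l hl => ?_)
  have hmoment := crossMoment_estimate_of_le M η (Finset.mem_Ioi.mp hl).le
  rw [hmoment, ← crossMoment_transpose (estimate M η l) (estimate M η k), hmoment,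
    Matrix.transpose_mul, crossMoment_transpose, Matrix.add_mul, Matrix.trace_add]
  refine congrArg₂ _ ?_ ?_
  · rw [Matrix.mul_assoc]
    rfl
  · rw [← Matrix.mul_assoc, Matrix.trace_mul_comm, Matrix.mul_assoc]
    rfl

variable {M η} {γ : ControlPolicy m r κ}

lemma augment_controlInput_ae_eq (h : ∀ k, deviation M ω η γ k =ᵐ[law M η] fun _ => 0) :
    (fun z => augment (controlInput M η γ z))
      =ᵐ[law M η] fun z => -(((bigPhi M ω)⁻¹ * bigK M ω) *ᵥ bigEstimate M η z) := by
  filter_upwards [ae_all_iff.mpr h] with z hz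
  have hPhi : bigPhi M ω *ᵥ augment (controlInput M η γ z)
      = -(bigK M ω *ᵥ bigEstimate M η z) := by
    rw [bigPhi_mulVec_augment, bigEstimate, mulVec_augment_of_blockDiagonal (bigK_submatrix M ω)]
    ext ⟨k, i⟩
    have hdeviation := congrFun (hz k) i
    rw [deviation, Matrix.mulVec_add] at hdeviation
    simp only [augment, Pi.neg_apply, Pi.add_apply, Pi.zero_apply] at hdeviation ⊢
    linarith
  rw [← Matrix.mulVec_mulVec, ← Matrix.mulVec_neg, ← hPhi, Matrix.mulVec_mulVec,
    Matrix.nonsing_inv_mul _ ((Matrix.isUnit_iff_isUnit_det _).mp (isUnit_bigPhi M ω)),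
    Matrix.one_mulVec]

lemma augment_controlEffect_ae_eq (h : ∀ k, deviation M ω η γ k =ᵐ[law M η] fun _ => 0) :
    (fun z => augment (controlEffect M (controlInput M η γ z)))
      =ᵐ[law M η] fun z => (-bigT M ω) *ᵥ bigEstimate M η z := by
  filter_upwards [augment_controlInput_ae_eq ω h] with z hz
  rw [← bigZ_mulVec_augment, hz, Matrix.mulVec_neg, Matrix.mulVec_mulVec, ← Matrix.mul_assoc,
    Matrix.neg_mulVec, bigT]

end horizon

section sensor

variable {m r κ : ℕ} {Ω : Type*} (M : Model m r κ Ω) (η : SignalRule m κ)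

/-- The cost of the sensor against the type `ω`, as a function of the posterior covariances. -/
def typeValue (S : Fin κ → Mat m) (ω : Option Ω) : ℝ := xi M ω + ∑ k, (S k * Xi M ω k).trace

variable {M η} in
lemma trace_bigV_none_mul_augment {X : Sample m κ → Fin κ → Vec m}
    (hX : ∀ k, SquareIntegrable (law M η) fun z => X z k) :
    (bigV M none * crossMoment (law M η) (fun z => augment (X z)) (fun z => augment (X z))).trace
      = -∑ k, (delta M none k * (feedback M none k
          * crossMoment (law M η) (fun z => X z k) (fun z => X z k) * (feedback M none k)ᵀ)).trace
      := by
  have hK : (fun z => bigK M none *ᵥ augment (X z))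
      = fun z => augment fun k => feedback M none k *ᵥ X z k :=
    funext fun z => mulVec_augment_of_blockDiagonal (bigK_submatrix M none) (X z)
  rw [bigV, Matrix.neg_mul, Matrix.trace_neg, ← trace_mul_mul_mul_transpose,
    ← crossMoment_mulVec_self (SquareIntegrable.augment hX), hK,
    trace_mul_crossMoment_augment_of_blockDiagonal (bigDelta_submatrix M none)]
  simp only [fun k => crossMoment_mulVec_self (hX k) (feedback M none k)]

variable (γ₀ : ControlPolicy m r κ)

lemma optimalCost_none : optimalCost M none η = typeValue M (posteriorCov M η γ₀) none := by
  have hfree := trace_bigV_none_mul_augment (squareIntegrable_freeState M η)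
  have hestimate := trace_bigV_none_mul_augment (squareIntegrable_estimate M η)
  change (bigV M none * crossMoment (law M η) (bigEstimate M η) (bigEstimate M η)).trace = _
    at hestimate
  rw [trace_bigV_mul_bigEstimate] at hestimate
  rw [← bigSigma_eq, Matrix.trace_mul_comm] at hfree
  simp only [← freeCov_eq, ← posteriorCov_eq M η γ₀, freeCov_eq_posteriorCov_add M η γ₀,
    Matrix.mul_add, Matrix.add_mul, Matrix.trace_add, Finset.sum_add_distrib] at hfree hestimate
  simp only [typeValue, xi, optimalCost, hfree, hestimate,
    fun k => crossMoment_mulVec_self (squareIntegrable_estimateError M η k) (feedback M none k)]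
  ring

variable {M η} {γ : ControlPolicy m r κ}

lemma measurable_controlEffect (k : Fin κ) :
    Measurable[openAlg M η k] fun z => controlEffect M (controlInput M η γ z) k :=
  (measurable_mulVec _ (measurable_forcedState_openAlg M η γ k)).add
    (measurable_mulVec _ (measurable_controlInput_openAlg M η γ le_rfl))

namespace FiniteEnergy

lemma squareIntegrable_controlEffect (h : FiniteEnergy M η γ) (k : Fin κ) :
    SquareIntegrable (law M η) fun z => controlEffect M (controlInput M η γ z) k :=
  ((h.squareIntegrable_forcedState k).mulVec _).add ((h k).mulVec _)

lemma trace_mul_crossMoment_nextState (h : FiniteEnergy M η γ) {W : Mat m} (hW : Wᵀ = W)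
    (k : Fin κ) :
    (W * crossMoment (law M η) (fun z => nextState M η γ z k)
        (fun z => nextState M η γ z k)).trace
      = (W * crossMoment (law M η) (fun z => M.A *ᵥ freeState M z.1 k)
          (fun z => M.A *ᵥ freeState M z.1 k)).trace
        + 2 * (W * crossMoment (law M η) (fun z => M.A *ᵥ estimate M η k z)
          (fun z => controlEffect M (controlInput M η γ z) k)).trace
        + (W * crossMoment (law M η) (fun z => controlEffect M (controlInput M η γ z) k)
          (fun z => controlEffect M (controlInput M η γ z) k)).trace
        + (M.covNoise * W).trace := by
  have hx := squareIntegrable_freeState M η k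
  have he := squareIntegrable_estimate M η k
  have hc := h.squareIntegrable_controlEffect k
  have hsplit : (fun z => M.A *ᵥ stateAt M η γ k z + M.B *ᵥ controlInput M η γ z k)
      = fun z => M.A *ᵥ freeState M z.1 k + controlEffect M (controlInput M η γ z) k := by
    funext z
    rw [stateAt_eq, controlEffect, Matrix.mulVec_add, add_assoc]
  have hestimate : crossMoment (law M η) (fun z => M.A *ᵥ freeState M z.1 k)
        (fun z => controlEffect M (controlInput M η γ z) k)
      = crossMoment (law M η) (fun z => M.A *ᵥ estimate M η k z)
        (fun z => controlEffect M (controlInput M η γ z) k) := by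
    rw [crossMoment_mulVec_left hx hc, crossMoment_mulVec_left he hc,
      crossMoment_estimate_left M η hc (measurable_controlEffect k)]
  have hsymm (N : Mat m) : (W * Nᵀ).trace = (W * N).trace := by
    rw [← Matrix.trace_transpose, Matrix.transpose_mul, Matrix.transpose_transpose, hW,
      Matrix.trace_mul_comm]
  rw [h.crossMoment_nextState, hsplit, crossMoment_add_self (hx.mulVec _) hc, hestimate]
  simp only [Matrix.mul_add, Matrix.trace_add]
  rw [hsymm, Matrix.trace_mul_comm M.covNoise]
  ring

end FiniteEnergy

lemma mulVec_bigEstimate (X : Mat m) :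
    (fun z => augment fun k => X *ᵥ estimate M η k z) = fun z => bigDiag X *ᵥ bigEstimate M η z :=
  funext fun _ => (mulVec_augment_of_blockDiagonal (bigDiag_submatrix X) _).symm

lemma sum_trace_mul_crossMoment (X Y : Sample m κ → Fin κ → Vec m) :
    ∑ k, (M.Q none * crossMoment (law M η) (fun z => X z k) (fun z => Y z k)).trace
      = (bigDiag (M.Q none) * crossMoment (law M η) (fun z => augment (X z))
          (fun z => augment (Y z))).trace :=
  (trace_mul_crossMoment_augment_of_blockDiagonal (bigDiag_submatrix (M.Q none)) X Y).symm

variable (M η) in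
lemma sum_trace_mul_crossMoment_freeState :
    ∑ k, (M.Q none * crossMoment (law M η) (fun z => M.A *ᵥ freeState M z.1 k)
        (fun z => M.A *ᵥ freeState M z.1 k)).trace
      = (bigSigma M * (bigDiag M.A)ᵀ * bigDiag (M.Q none) * bigDiag M.A).trace := by
  rw [sum_trace_mul_crossMoment (fun z k => M.A *ᵥ freeState M z.1 k),
    ← funext fun z : Sample m κ =>
      mulVec_augment_of_blockDiagonal (bigDiag_submatrix M.A) (freeState M z.1),
    crossMoment_mulVec_self (SquareIntegrable.augment (squareIntegrable_freeState M η)),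
    ← bigSigma_eq, trace_mul_mul_mul_transpose, Matrix.trace_mul_comm]
  simp only [Matrix.mul_assoc]

lemma sum_trace_mul_crossMoment_estimate_controlEffect (ω : Option Ω)
    (h : ∀ k, deviation M ω η γ k =ᵐ[law M η] fun _ => 0) :
    ∑ k, (M.Q none * crossMoment (law M η) (fun z => M.A *ᵥ estimate M η k z)
        (fun z => controlEffect M (controlInput M η γ z) k)).trace
      = -((bigT M ω)ᵀ * bigDiag (M.Q none) * bigDiag M.A
          * crossMoment (law M η) (bigEstimate M η) (bigEstimate M η)).trace := by
  have he := squareIntegrable_bigEstimate M η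
  rw [sum_trace_mul_crossMoment (fun z k => M.A *ᵥ estimate M η k z), mulVec_bigEstimate,
    crossMoment_congr Filter.EventuallyEq.rfl (augment_controlEffect_ae_eq ω h),
    crossMoment_mulVec_left he (he.mulVec _), crossMoment_mulVec_right he he,
    ← Matrix.mul_assoc (bigDiag M.A), trace_mul_mul_mul_transpose]
  simp only [Matrix.transpose_neg, Matrix.neg_mul, Matrix.trace_neg]

lemma sum_trace_mul_crossMoment_controlEffect (ω : Option Ω)
    (h : ∀ k, deviation M ω η γ k =ᵐ[law M η] fun _ => 0) :
    ∑ k, (M.Q none * crossMoment (law M η)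
        (fun z => controlEffect M (controlInput M η γ z) k)
        (fun z => controlEffect M (controlInput M η γ z) k)).trace
      = ((bigT M ω)ᵀ * bigDiag (M.Q none) * bigT M ω
          * crossMoment (law M η) (bigEstimate M η) (bigEstimate M η)).trace := by
  have hc := augment_controlEffect_ae_eq ω h
  rw [sum_trace_mul_crossMoment (fun z => controlEffect M (controlInput M η γ z)),
    crossMoment_congr hc hc, crossMoment_mulVec_self (squareIntegrable_bigEstimate M η),
    trace_mul_mul_mul_transpose]
  simp only [Matrix.transpose_neg, Matrix.neg_mul, Matrix.mul_neg, neg_neg]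

lemma attackerCost (ω : Ω) (hu : FiniteEnergy M η γ)
    (h : ∀ k, deviation M (some ω) η γ k =ᵐ[law M η] fun _ => 0) :
    ∑ k : Fin κ, (M.Q none * crossMoment (law M η) (fun z => nextState M η γ z k)
        (fun z => nextState M η γ z k)).trace
      = typeValue M (posteriorCov M η γ₀) (some ω) := by
  have hQ := transpose_eq_of_posSemidef (M.Q_posSemidef none)
  have hV := trace_bigV_mul_bigEstimate M (some ω) η
  rw [bigV, Matrix.sub_mul, Matrix.sub_mul, Matrix.trace_sub, Matrix.trace_sub,
    trace_transpose_mul_mul_mul_comm (by rw [transpose_bigDiag, hQ]) (crossMoment_transpose _ _)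
      (bigDiag M.A)] at hV
  simp only [hu.trace_mul_crossMoment_nextState hQ, Finset.sum_add_distrib, ← Finset.mul_sum,
    sum_trace_mul_crossMoment_freeState, sum_trace_mul_crossMoment_estimate_controlEffect _ h,
    sum_trace_mul_crossMoment_controlEffect _ h, typeValue, xi, posteriorCov_eq, Finset.sum_const,
    Finset.card_univ, Fintype.card_fin, nsmul_eq_mul, ← hV]
  ring

lemma sensorTypeCost_eq {ω : Option Ω} (h : IsBestResponse M ω η γ) :
    sensorTypeCost M η γ ω = ENNReal.ofReal (typeValue M (posteriorCov M η γ₀) ω)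
      ∧ 0 ≤ typeValue M (posteriorCov M η γ₀) ω := by
  obtain ⟨hu, hdev⟩ := h.finiteEnergy_and_deviation
  cases ω with
  | none =>
    rw [sensorTypeCost, followerCost_of_deviation_ae_eq_zero none hu hdev,
      ← optimalCost_none M η γ₀]
    exact ⟨rfl, optimalCost_nonneg M none η⟩
  | some ω =>
    have hx := fun k => trace_mul_nonneg_of_posSemidef (M.Q_posSemidef none)
      (posSemidef_crossMoment_self (hu.squareIntegrable_nextState k))
    rw [sensorTypeCost, ← attackerCost γ₀ ω hu hdev,
      ENNReal.ofReal_sum_of_nonneg fun k _ => hx k]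
    exact ⟨Finset.sum_congr rfl fun k _ =>
      meanQuad_eq (M.Q_posSemidef none) (hu.squareIntegrable_nextState k),
      Finset.sum_nonneg fun k _ => hx k⟩

lemma iSup_stdSimplex_ofReal {ι : Type*} [Fintype ι] [Nonempty ι] {c : ι → ℝ} (hc : 0 ≤ c) :
    ⨆ p : stdSimplex ℝ ι, ∑ i, ENNReal.ofReal (p.1 i) * ENNReal.ofReal (c i)
      = ENNReal.ofReal (⨆ p : stdSimplex ℝ ι, ∑ i, p.1 i * c i) := by
  have hbdd : BddAbove (Set.range fun p : stdSimplex ℝ ι => ∑ i, p.1 i * c i) := by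
    refine ⟨∑ i, c i, ?_⟩
    rintro _ ⟨p, rfl⟩
    exact Finset.sum_le_sum fun i _ => mul_le_of_le_one_left (hc i)
      ((Finset.single_le_sum (fun j _ => p.2.1 j) (Finset.mem_univ i)).trans p.2.2.le)
  rw [ENNReal.ofReal_mono.map_ciSup_of_continuousAt ENNReal.continuous_ofReal.continuousAt hbdd]
  refine iSup_congr fun p => ?_
  rw [ENNReal.ofReal_sum_of_nonneg fun i _ => mul_nonneg (p.2.1 i) (hc i)]
  exact Finset.sum_congr rfl fun i _ => (ENNReal.ofReal_mul (p.2.1 i)).symm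

theorem sensorCost_eq [Fintype Ω] {g : Option Ω → ControlPolicy m r κ}
    (h : ∀ ω, IsBestResponse M ω η (g ω)) :
    ((sensorCost M η g : ℝ≥0∞) : EReal) = (programValue M (posteriorCov M η γ₀) : EReal) := by
  have hnonneg : 0 ≤ typeValue M (posteriorCov M η γ₀) := fun ω => (sensorTypeCost_eq γ₀ (h ω)).2
  have hsup : sensorCost M η g = ENNReal.ofReal (programValue M (posteriorCov M η γ₀)) := by
    simp only [sensorCost, fun ω => (sensorTypeCost_eq γ₀ (h ω)).1]
    exact iSup_stdSimplex_ofReal hnonneg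
  rw [hsup, EReal.coe_ennreal_ofReal, max_eq_left]
  exact Real.iSup_nonneg fun p =>
    Finset.sum_nonneg fun ω _ => mul_nonneg (p.2.1 ω) (hnonneg ω)

end sensor

/-! ### The construction -/

section construction

lemma transpose_mul_conj_mul {n : Type*} [Fintype n] [DecidableEq n] {U : Matrix n n ℝ}
    (hU : Uᵀ * U = 1) (X : Matrix n n ℝ) : Uᵀ * (U * X * Uᵀ) * U = X := by
  calc Uᵀ * (U * X * Uᵀ) * U = (Uᵀ * U) * X * (Uᵀ * U) := by simp only [Matrix.mul_assoc]
    _ = X := by rw [hU, Matrix.one_mul, Matrix.mul_one]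

lemma le_one_of_posSemidef_one_sub_conj {n : Type*} [Fintype n] [DecidableEq n]
    {U : Matrix n n ℝ} (hU : Uᵀ * U = 1) {v : n → ℝ}
    (h : (1 - U * Matrix.diagonal v * Uᵀ).PosSemidef) (i : n) : v i ≤ 1 := by
  have hdiag := posSemidef_transpose_mul_mul h U
  rw [Matrix.mul_sub, Matrix.sub_mul, Matrix.mul_one, hU, transpose_mul_conj_mul hU] at hdiag
  have hi : 0 ≤ (1 - Matrix.diagonal v) i i := hdiag.diag_nonneg
  rwa [Matrix.sub_apply, Matrix.one_apply_eq, Matrix.diagonal_apply_eq, sub_nonneg] at hi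

lemma exists_diagonalization {n : Type*} [Fintype n] [DecidableEq n] {X : Matrix n n ℝ}
    (hX : X.PosSemidef) :
    ∃ (U : Matrix n n ℝ) (v : n → ℝ), U ∈ Matrix.orthogonalGroup n ℝ ∧ (∀ i, 0 ≤ v i) ∧
      X = U * Matrix.diagonal v * Uᵀ ∧ X.rank = Fintype.card {i // v i ≠ 0} :=
  ⟨hX.isHermitian.eigenvectorUnitary, hX.isHermitian.eigenvalues,
    hX.isHermitian.eigenvectorUnitary.2, hX.eigenvalues_nonneg,
    hX.isHermitian.spectral_theorem, hX.isHermitian.rank_eq_card_non_zero_eigs⟩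

/-- The diagonal matrix `Λ̄^{-1/2}`. -/
def invSqrtDiagonal {n : Type*} [DecidableEq n] (v : n → ℝ) : Matrix n n ℝ :=
  Matrix.diagonal fun i => (√(v i))⁻¹

lemma transpose_invSqrtDiagonal {n : Type*} [DecidableEq n] (v : n → ℝ) :
    (invSqrtDiagonal v)ᵀ = invSqrtDiagonal v :=
  Matrix.diagonal_transpose _

section

variable {n : Type*} [Fintype n] [DecidableEq n] {v : n → ℝ}

lemma diagonal_mul_invSqrtDiagonal_mul_self (hv : ∀ i, 0 < v i) :
    Matrix.diagonal v * invSqrtDiagonal v * invSqrtDiagonal v = 1 := by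
  rw [invSqrtDiagonal, Matrix.diagonal_mul_diagonal, Matrix.diagonal_mul_diagonal,
    ← Matrix.diagonal_one]
  congr 1
  ext i
  rw [mul_assoc, ← mul_inv, Real.mul_self_sqrt (hv i).le, mul_inv_cancel₀ (hv i).ne']

lemma invSqrtDiagonal_mul_diagonal (v : n → ℝ) :
    invSqrtDiagonal v * Matrix.diagonal v = Matrix.diagonal v * invSqrtDiagonal v := by
  simp only [invSqrtDiagonal, Matrix.diagonal_mul_diagonal, mul_comm]

lemma invSqrtDiagonal_mul_diagonal_mul (hv : ∀ i, 0 < v i) :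
    invSqrtDiagonal v * Matrix.diagonal v * invSqrtDiagonal v = 1 := by
  rw [invSqrtDiagonal_mul_diagonal, diagonal_mul_invSqrtDiagonal_mul_self hv]

lemma invSqrtDiagonal_mul_self_mul_diagonal (hv : ∀ i, 0 < v i) :
    invSqrtDiagonal v * invSqrtDiagonal v * Matrix.diagonal v = 1 := by
  rw [Matrix.mul_assoc, invSqrtDiagonal_mul_diagonal, ← Matrix.mul_assoc,
    invSqrtDiagonal_mul_diagonal_mul hv]

end

variable {t q m : ℕ} (h : t + q = m)

lemma pad_mul (X Y : Mat t) : pad h X * pad h Y = pad h (X * Y) := by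
  simp only [pad, Matrix.reindex_apply, Matrix.submatrix_mul_equiv, Matrix.fromBlocks_multiply,
    Matrix.mul_zero, Matrix.zero_mul, add_zero]

lemma transpose_pad (X : Mat t) : (pad h X)ᵀ = pad h Xᵀ := by
  simp only [pad, Matrix.reindex_apply, Matrix.transpose_submatrix, Matrix.fromBlocks_transpose,
    Matrix.transpose_zero]

lemma pad_add (X Y : Mat t) : pad h X + pad h Y = pad h (X + Y) := by
  ext a b
  obtain ⟨a, rfl⟩ := (splitIndex h).surjective a
  obtain ⟨b, rfl⟩ := (splitIndex h).surjective b
  rcases a with a | a <;> rcases b with b | b <;> simp [pad]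

lemma posSemidef_pad_diagonal_sq (v : Fin t → ℝ) :
    (pad h (Matrix.diagonal fun i => v i ^ 2)).PosSemidef := by
  have hsq : pad h (Matrix.diagonal fun i => v i ^ 2)
      = (pad h (Matrix.diagonal v))ᵀ * pad h (Matrix.diagonal v) := by
    simp only [transpose_pad, pad_mul, Matrix.diagonal_transpose, Matrix.diagonal_mul_diagonal, sq]
  rw [hsq, ← Matrix.conjTranspose_eq_transpose_of_trivial]
  exact Matrix.posSemidef_conjTranspose_mul_self _

lemma topLeft_pad (X : Mat t) : topLeft h (pad h X) = X := by
  ext i j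
  simp [topLeft, pad, Matrix.toBlocks₁₁]

lemma topLeft_sub (X Y : Mat m) : topLeft h (X - Y) = topLeft h X - topLeft h Y := rfl

lemma posSemidef_topLeft {X : Mat m} (hX : X.PosSemidef) : (topLeft h X).PosSemidef :=
  (hX.submatrix (splitIndex h)).submatrix Sum.inl

lemma pad_splitIndex_inr_apply (X : Mat t) (i : Fin q) (j : Fin m) :
    pad h X (splitIndex h (Sum.inr i)) j = 0 := by
  obtain ⟨j, rfl⟩ := (splitIndex h).surjective j
  simp only [pad, Matrix.reindex_apply, Matrix.submatrix_apply, Equiv.symm_apply_apply]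
  cases j <;> rfl

lemma pad_topLeft_of_posSemidef_sub {F : Mat m} {X : Mat t} (hF : F.PosSemidef)
    (hX : (pad h X - F).PosSemidef) : pad h (topLeft h F) = F := by
  have hcol (i : Fin q) (j : Fin m) : F j (splitIndex h (Sum.inr i)) = 0 := by
    have hle : 0 ≤ (pad h X - F) (splitIndex h (Sum.inr i)) (splitIndex h (Sum.inr i)) :=
      hX.diag_nonneg
    rw [Matrix.sub_apply, pad_splitIndex_inr_apply, zero_sub, neg_nonneg] at hle
    have hdiag := le_antisymm hle hF.diag_nonneg
    have hmul := (hF.dotProduct_mulVec_zero_iff (Pi.single (splitIndex h (Sum.inr i)) 1)).mp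
      (by simp [hdiag])
    simpa using congrFun hmul j
  have hrow (i : Fin q) (j : Fin m) : F (splitIndex h (Sum.inr i)) j = 0 := by
    rw [← transpose_eq_of_posSemidef hF, Matrix.transpose_apply, hcol]
  ext a b
  obtain ⟨a, rfl⟩ := (splitIndex h).surjective a
  obtain ⟨b, rfl⟩ := (splitIndex h).surjective b
  rcases a with a | a
  · rcases b with b | b
    · simp [pad, topLeft, Matrix.toBlocks₁₁]
    · simp [pad, hcol]
  · rw [hrow, pad_splitIndex_inr_apply]

lemma mul_pad_topLeft_mul {D E Ub : Mat m} {X : Mat t} (hUb : Ubᵀ * Ub = 1)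
    (hD : D = Ub * pad h X * Ubᵀ) (hE : E.PosSemidef) (hDE : (D - E).PosSemidef) :
    Ub * pad h (topLeft h (Ubᵀ * E * Ub)) * Ubᵀ = E := by
  have hsub := posSemidef_transpose_mul_mul hDE Ub
  rw [Matrix.mul_sub, Matrix.sub_mul, hD, transpose_mul_conj_mul hUb] at hsub
  rw [pad_topLeft_of_posSemidef_sub h (posSemidef_transpose_mul_mul hE Ub) hsub]
  simpa only [Matrix.transpose_transpose] using transpose_mul_conj_mul (U := Ubᵀ)
    (by rw [Matrix.transpose_transpose]; exact mul_eq_one_comm.mp hUb) E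

lemma conj_pad_mul {Ub : Mat m} (hUb : Ubᵀ * Ub = 1) (X Y : Mat t) :
    Ub * pad h X * Ubᵀ * (Ub * pad h Y) = Ub * pad h (X * Y) := by
  calc Ub * pad h X * Ubᵀ * (Ub * pad h Y) = Ub * (pad h X * (Ubᵀ * Ub) * pad h Y) := by
        simp only [Matrix.mul_assoc]
    _ = Ub * pad h (X * Y) := by rw [hUb, Matrix.mul_one, pad_mul]

lemma signalCov_eq_pad {Ub : Mat m} {U : Mat t} {lb lo θ : Fin t → ℝ} (hUb : Ubᵀ * Ub = 1)
    (hU : Uᵀ * U = 1) (hlb : ∀ i, 0 < lb i) :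
    (Ub * pad h (invSqrtDiagonal lb * U * Matrix.diagonal lo))ᵀ
          * (Ub * pad h (Matrix.diagonal lb) * Ubᵀ)
          * (Ub * pad h (invSqrtDiagonal lb * U * Matrix.diagonal lo))
        + pad h (Matrix.diagonal fun i => θ i ^ 2)
      = pad h (Matrix.diagonal fun i => lo i ^ 2 + θ i ^ 2) := by
  set s := invSqrtDiagonal lb
  set Lo := Matrix.diagonal lo with hLo
  have hstate : (Ub * pad h (s * U * Lo))ᵀ * (Ub * pad h (Matrix.diagonal lb) * Ubᵀ)
      * (Ub * pad h (s * U * Lo)) = pad h (Lo * Lo) := by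
    calc _ = (pad h (s * U * Lo))ᵀ * (Ubᵀ * Ub) * pad h (Matrix.diagonal lb * (s * U * Lo)) := by
          rw [Matrix.mul_assoc, conj_pad_mul h hUb, Matrix.transpose_mul]
          simp only [Matrix.mul_assoc]
      _ = pad h (Lo * (Uᵀ * (s * Matrix.diagonal lb * s) * U) * Lo) := by
          rw [hUb, Matrix.mul_one, transpose_pad, pad_mul]
          simp only [s, Matrix.transpose_mul, transpose_invSqrtDiagonal, hLo,
            Matrix.diagonal_transpose, Matrix.mul_assoc]
      _ = pad h (Lo * Lo) := by
          rw [invSqrtDiagonal_mul_diagonal_mul hlb, Matrix.mul_one, hU, Matrix.mul_one]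
  rw [hstate, pad_add, hLo, Matrix.diagonal_mul_diagonal, Matrix.diagonal_add]
  simp only [sq]

lemma eq_diagonal_conj_of_invSqrtDiagonal_conj {lb : Fin t → ℝ} (hlb : ∀ i, 0 < lb i)
    {X T : Mat t} (hT : invSqrtDiagonal lb * X * invSqrtDiagonal lb = T) :
    Matrix.diagonal lb * invSqrtDiagonal lb * T * (invSqrtDiagonal lb * Matrix.diagonal lb)
      = X := by
  calc _ = Matrix.diagonal lb * invSqrtDiagonal lb * invSqrtDiagonal lb * X
          * (invSqrtDiagonal lb * invSqrtDiagonal lb * Matrix.diagonal lb) := by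
        rw [← hT]
        simp only [Matrix.mul_assoc]
    _ = X := by
        rw [diagonal_mul_invSqrtDiagonal_mul_self hlb, invSqrtDiagonal_mul_self_mul_diagonal hlb,
          Matrix.one_mul, Matrix.mul_one]

lemma IsStageSignal.exists_gain {D E L Th : Mat m} (hs : IsStageSignal D E L Th)
    (hE : E.PosSemidef) (hDE : (D - E).PosSemidef) :
    ∃ G : Mat m, G * (Lᵀ * D * L + Th) = D * L ∧ G * (Lᵀ * D * L + Th) * Gᵀ = E := by
  obtain ⟨t, q, h, Ub, lb, U, lam, lo, θ, -, hUb, hlb, hD, hU, hT, hlam, hL, hTh⟩ := hs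
  rw [Matrix.mem_orthogonalGroup_iff'] at hUb hU
  change invSqrtDiagonal lb * _ * invSqrtDiagonal lb = _ at hT
  change L = Ub * pad h (invSqrtDiagonal lb * U * _) at hL
  set s := invSqrtDiagonal lb
  set Lb := Matrix.diagonal lb with hLb
  set Lo := Matrix.diagonal lo with hLo
  set c := fun i => lo i ^ 2 + θ i ^ 2
  set C := Matrix.diagonal fun i => (c i)⁻¹ with hC
  have hcov : Lᵀ * D * L + Th = pad h (Matrix.diagonal c) := by
    rw [hL, hD, hTh]
    exact signalCov_eq_pad h hUb hU hlb
  have hDL : D * L = Ub * pad h (Lb * (s * U * Lo)) := by rw [hD, hL, conj_pad_mul h hUb]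
  have hinv : C * Matrix.diagonal c = 1 := by
    simp only [hC, Matrix.diagonal_mul_diagonal, c, inv_mul_cancel₀ (hlam _).1, Matrix.diagonal_one]
  have hratio : Lo * C * Lo = Matrix.diagonal lam := by
    simp only [hLo, hC, Matrix.diagonal_mul_diagonal]
    refine congrArg _ (funext fun i => ?_)
    rw [← (hlam i).2]
    ring
  have hgain : Ub * pad h (Lb * (s * U * Lo) * C) * (Lᵀ * D * L + Th) = D * L := by
    rw [hcov, hDL, Matrix.mul_assoc, pad_mul, Matrix.mul_assoc _ C, hinv, Matrix.mul_one]
  have hblock : Lb * (s * U * Lo) * (Lb * (s * U * Lo) * C)ᵀ = topLeft h (Ubᵀ * E * Ub) := by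
    rw [← eq_diagonal_conj_of_invSqrtDiagonal_conj hlb hT, ← hratio]
    simp only [Matrix.transpose_mul, s, transpose_invSqrtDiagonal, hLb, hLo, hC,
      Matrix.diagonal_transpose, Matrix.mul_assoc]
  refine ⟨_, hgain, ?_⟩
  rw [hgain, hDL, Matrix.transpose_mul, transpose_pad, ← Matrix.mul_assoc, Matrix.mul_assoc Ub,
    pad_mul, hblock, mul_pad_topLeft_mul h hUb hD hE hDE]

lemma pad_diagonal {v : Fin m → ℝ} {π : Fin m ≃ Fin m}
    (hv : ∀ i, v (π (splitIndex h (Sum.inr i))) = 0) :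
    pad h (Matrix.diagonal fun i => v (π (splitIndex h (Sum.inl i))))
      = (Matrix.diagonal v).submatrix π π := by
  ext a b
  obtain ⟨a, rfl⟩ := (splitIndex h).surjective a
  obtain ⟨b, rfl⟩ := (splitIndex h).surjective b
  rcases a with a | a <;> rcases b with b | b <;> simp [pad, Matrix.diagonal_apply, hv]

lemma exists_equiv_forall_ne_zero {n : ℕ} {v : Fin m → ℝ} (hn : n = Fintype.card {i // v i ≠ 0}) :
    ∃ (q : ℕ) (h : n + q = m) (π : Fin m ≃ Fin m),
      (∀ i, v (π (splitIndex h (Sum.inl i))) ≠ 0) ∧ ∀ i, v (π (splitIndex h (Sum.inr i))) = 0 := by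
  have hcard : n + Fintype.card {i // ¬ v i ≠ 0} = m := by
    rw [hn, ← Fintype.card_sum, Fintype.card_congr (Equiv.sumCompl fun i => v i ≠ 0),
      Fintype.card_fin]
  let e₁ : Fin n ≃ {i // v i ≠ 0} := (finCongr hn).trans (Fintype.equivFin _).symm
  let e₂ : Fin _ ≃ {i // ¬ v i ≠ 0} := (Fintype.equivFin _).symm
  refine ⟨_, hcard, (splitIndex hcard).symm.trans
    ((Equiv.sumCongr e₁ e₂).trans (Equiv.sumCompl fun i => v i ≠ 0)), fun i => ?_, fun i => ?_⟩
  · simpa using (e₁ i).2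
  · simpa using (e₂ i).2

lemma exists_sorted_diagonalization {D : Mat m} (hD : D.PosSemidef) :
    ∃ (q : ℕ) (h : D.rank + q = m) (Ub : Mat m) (lb : Fin D.rank → ℝ),
      Ub ∈ Matrix.orthogonalGroup (Fin m) ℝ ∧ (∀ i, 0 < lb i) ∧
      D = Ub * pad h (Matrix.diagonal lb) * Ubᵀ := by
  obtain ⟨U, v, hU, hv, hDU, hrank⟩ := exists_diagonalization hD
  obtain ⟨q, h, π, hne, hzero⟩ := exists_equiv_forall_ne_zero hrank
  refine ⟨q, h, U.submatrix id π, fun i => v (π (splitIndex h (Sum.inl i))), ?_,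
    fun i => lt_of_le_of_ne (hv _) (hne i).symm, ?_⟩
  · rw [Matrix.mem_orthogonalGroup_iff] at hU ⊢
    rw [Matrix.transpose_submatrix, Matrix.submatrix_mul_equiv, hU, Matrix.submatrix_id_id]
  · rw [pad_diagonal h hzero, Matrix.transpose_submatrix, Matrix.submatrix_mul_equiv,
      Matrix.submatrix_mul_equiv, Matrix.submatrix_id_id]
    exact hDU

/-- The matrix `T_k = [Λ̄^{-1/2} O] Ūᵀ X Ū [Λ̄^{-1/2}; O]` of the construction. -/
def whiten (Ub : Mat m) (lb : Fin t → ℝ) (X : Mat m) : Mat t :=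
  invSqrtDiagonal lb * topLeft h (Ubᵀ * X * Ub) * invSqrtDiagonal lb

lemma posSemidef_whiten (Ub : Mat m) (lb : Fin t → ℝ) {X : Mat m} (hX : X.PosSemidef) :
    (whiten h Ub lb X).PosSemidef := by
  simpa only [whiten, transpose_invSqrtDiagonal] using posSemidef_transpose_mul_mul
    (posSemidef_topLeft h (posSemidef_transpose_mul_mul hX Ub)) (invSqrtDiagonal lb)

lemma whiten_sub (Ub : Mat m) (lb : Fin t → ℝ) (X Y : Mat m) :
    whiten h Ub lb (X - Y) = whiten h Ub lb X - whiten h Ub lb Y := by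
  simp only [whiten, Matrix.mul_sub, Matrix.sub_mul, topLeft_sub]

lemma whiten_eq_one {Ub : Mat m} {lb : Fin t → ℝ} (hUb : Ubᵀ * Ub = 1) (hlb : ∀ i, 0 < lb i) :
    whiten h Ub lb (Ub * pad h (Matrix.diagonal lb) * Ubᵀ) = 1 := by
  rw [whiten, transpose_mul_conj_mul hUb, topLeft_pad, invSqrtDiagonal_mul_diagonal_mul hlb]

lemma exists_isStageSignal {D E : Mat m} (hE : E.PosSemidef) (hDE : (D - E).PosSemidef) :
    ∃ L Th : Mat m, Th.PosSemidef ∧ IsStageSignal D E L Th := by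
  have hD : D.PosSemidef := by simpa only [sub_add_cancel] using hDE.add hE
  obtain ⟨q, h, Ub, lb, hUb, hlb, hDU⟩ := exists_sorted_diagonalization hD
  obtain ⟨U, lam, hU, hlam, hT, -⟩ := exists_diagonalization (posSemidef_whiten h Ub lb hE)
  have hlam1 (i) : lam i ≤ 1 := by
    have hle := posSemidef_whiten h Ub lb hDE
    rw [whiten_sub, hT, (congrArg (whiten h Ub lb) hDU).trans
      (whiten_eq_one h ((Matrix.mem_orthogonalGroup_iff' _ _).mp hUb) hlb)] at hle
    exact le_one_of_posSemidef_one_sub_conj ((Matrix.mem_orthogonalGroup_iff' _ _).mp hU) hle i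
  have hsum (i) : √(lam i) ^ 2 + √(1 - lam i) ^ 2 = 1 := by
    rw [Real.sq_sqrt (hlam i), Real.sq_sqrt (sub_nonneg.mpr (hlam1 i)), add_sub_cancel]
  refine ⟨_, _, posSemidef_pad_diagonal_sq h fun i => √(1 - lam i), D.rank, q, h, Ub, lb, U, lam,
    fun i => √(lam i), fun i => √(1 - lam i), rfl, hUb, hlb, hDU, hU, hT, fun i => ?_, rfl, rfl⟩
  rw [hsum, div_one, Real.sq_sqrt (hlam i)]
  exact ⟨one_ne_zero, rfl⟩

lemma exists_isAssociatedRule {r κ : ℕ} {Ω : Type*} (M : Model m r κ Ω) {S : Fin κ → Mat m}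
    (hS : S ∈ Feasible M) : ∃ η, IsAssociatedRule M S η := by
  choose L Th hTh hs using fun k => exists_isStageSignal
    (D := freeCov M k - predicted M S k) (hS k).2.2
    (by rw [sub_sub_sub_cancel_right]; exact (hS k).2.1)
  exact ⟨⟨fun k j => if j = Fin.last k.val then L k else 0, Th, hTh⟩,
    fun k => ⟨fun j hj => if_neg hj, by simpa only [if_true] using hs k⟩⟩

end construction

/-! ### Gaussian filtering -/

section independence

variable {α ι : Type*} [Countable ι] [MeasurableSpace α] {P : Measure α} {X T : α → ι → ℝ}

lemma condVec_ae_eq_of_indepFun [IsFiniteMeasure P] {β : Type*} [mβ : MeasurableSpace β]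
    {Z : α → β} (hZ : Measurable Z) (hX : SquareIntegrable P X) (hT : SquareIntegrable P T)
    (hTm : Measurable[mβ.comap Z] T) (hε : Measurable fun z => X z - T z)
    (hindep : IndepFun (fun z => X z - T z) Z P) (hmean : ∀ i, ∫ z, (X z - T z) i ∂P = 0) :
    condVec P (mβ.comap Z) X =ᵐ[P] T := by
  have hcoord (i : ι) : P[fun z => X z i | mβ.comap Z] =ᵐ[P] fun z => T z i := by
    have hTi : StronglyMeasurable[mβ.comap Z] fun z => T z i :=
      ((measurable_pi_apply i).comp hTm).stronglyMeasurable
    have hTint := (hT i).integrable one_le_two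
    have hεi : Measurable[MeasurableSpace.comap (fun z => X z - T z) inferInstance]
        fun z => (X z - T z) i :=
      (measurable_pi_apply i).comp (comap_measurable fun z => X z - T z)
    have hzero := condExp_indep_eq hε.comap_le hZ.comap_le hεi.stronglyMeasurable
      ((IndepFun_iff_Indep _ _ _).mp hindep)
    filter_upwards [hzero, condExp_sub ((hX i).integrable one_le_two) hTint (mβ.comap Z)]
      with z hz hsub
    rw [hmean i] at hz
    have hsub' := hsub.symm.trans hz
    rwa [Pi.sub_apply, condExp_of_stronglyMeasurable hZ.comap_le hTi hTint, sub_eq_zero] at hsub'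
  filter_upwards [ae_all_iff.mpr hcoord] with z hz
  exact funext hz

end independence

section gaussianConditioning

variable {E : Type*} [NormedAddCommGroup E] [NormedSpace ℝ E] {ι ι' : Type*} [Fintype ι]
  [Fintype ι'] {X : E → ι → ℝ}

lemma isBoundedLinearMap_augment {Z : E → ι' → ι → ℝ}
    (hZ : ∀ j, IsBoundedLinearMap ℝ fun z => Z z j) :
    IsBoundedLinearMap ℝ fun z => augment (Z z) :=
  (ContinuousLinearMap.pi fun a : ι' × ι =>
    (ContinuousLinearMap.proj a.2).comp (hZ a.1).toContinuousLinearMap).isBoundedLinearMap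

variable [MeasurableSpace E] [BorelSpace E] {P : Measure E}

lemma indepFun_of_crossMoment_eq_zero [IsGaussian P] [P.IsNegInvariant] {Y : E → ι' → ℝ}
    (hX : IsBoundedLinearMap ℝ X) (hY : IsBoundedLinearMap ℝ Y) (h : crossMoment P X Y = 0) :
    IndepFun X Y P := by
  have hgauss : HasGaussianLaw (fun z => (fun i => X z i, fun j => Y z j)) P :=
    (IsGaussian.hasGaussianLaw_id (μ := P)).map_fun
      (hX.toContinuousLinearMap.prod hY.toContinuousLinearMap)
  refine hgauss.indepFun_of_covariance_eval fun i j => ?_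
  rw [covariance_eq_sub (squareIntegrable_of_isBoundedLinearMap hX i)
    (squareIntegrable_of_isBoundedLinearMap hY j), integral_eq_zero_of_isBoundedLinearMap hX,
    zero_mul, sub_zero]
  exact congrFun (congrFun h i) j

end gaussianConditioning

section filter

variable {m r κ : ℕ} {Ω : Type*} (M : Model m r κ Ω) (η : SignalRule m κ)

lemma estimate_ae_eq_of_crossMoment_eq_zero {k : Fin κ} {T : Sample m κ → Vec m}
    (hT : IsBoundedLinearMap ℝ T) (hTm : Measurable[openAlg M η k] T)
    (h : ∀ j ≤ k, crossMoment (law M η) (fun z => freeState M z.1 k - T z)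
      (openSignal M η j) = 0) :
    estimate M η k =ᵐ[law M η] T := by
  have hε : IsBoundedLinearMap ℝ fun z : Sample m κ => freeState M z.1 k - T z :=
    ((isBoundedLinearMap_freeState M k).comp .fst).sub hT
  have hindep := indepFun_of_crossMoment_eq_zero (P := law M η) hε
    (isBoundedLinearMap_augment (Z := openHistory M η k)
      fun _ => isBoundedLinearMap_openSignal M η _)
    (Matrix.ext fun i a => congrFun (congrFun (h _ (Nat.le_of_lt_succ a.1.isLt)) i) a.2)
  refine condVec_ae_eq_of_indepFun ?_ (squareIntegrable_freeState M η k)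
    (squareIntegrable_of_isBoundedLinearMap hT) hTm
    hε.toContinuousLinearMap.continuous.measurable
    (hindep.comp measurable_id
      (ψ := fun y : Fin (k.val + 1) × Fin m → ℝ => fun j i => y (j, i)) (by fun_prop))
    (integral_eq_zero_of_isBoundedLinearMap hε)
  exact measurable_iff_comap_le.mpr (openAlg_le M η k)

/-- `T` is a linear version of the posterior of the control-free state `x_k`. -/
structure IsLinearEstimate (k : Fin κ) (T : Sample m κ → Vec m) : Prop where
  isBoundedLinearMap : IsBoundedLinearMap ℝ T
  measurable : Measurable[openAlg M η k] T
  ae_eq : estimate M η k =ᵐ[law M η] T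

/-- `p` is the best linear prediction of the control-free state `x_k` from the signals before
stage `k`. -/
structure IsPrediction (k : Fin κ) (p : Sample m κ → Vec m) : Prop where
  isBoundedLinearMap : IsBoundedLinearMap ℝ p
  measurable : Measurable[openAlg M η k] p
  error_openSignal : ∀ j < k, crossMoment (law M η) (fun z => freeState M z.1 k - p z)
    (openSignal M η j) = 0
  error_self : crossMoment (law M η) (fun z => freeState M z.1 k - p z) p = 0
  signalNoise_self : crossMoment (law M η) (fun z => z.2 k) p = 0

/-- The innovation `L_{k,k}ᵀ (x_k - p) + ϑ_k` of the signal `s_k` over the prediction `p`. -/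
def innovation (k : Fin κ) (p : Sample m κ → Vec m) (z : Sample m κ) : Vec m :=
  (η.gain k (Fin.last k.val))ᵀ *ᵥ (freeState M z.1 k - p z) + z.2 k

lemma openSignal_eq_innovation_add {k : Fin κ}
    (hgain : ∀ j : Fin (k.val + 1), j ≠ Fin.last k.val → η.gain k j = 0)
    (p : Sample m κ → Vec m) (z : Sample m κ) :
    openSignal M η k z
      = innovation M η k p z + (η.gain k (Fin.last k.val))ᵀ *ᵥ p z := by
  rw [openSignal, encode, Finset.sum_eq_single (Fin.last k.val), innovation, Matrix.mulVec_sub]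
  · change _ᵀ *ᵥ freeState M z.1 k + z.2 k = _
    abel
  · intro j _ hj
    rw [hgain j hj, Matrix.transpose_zero, Matrix.zero_mulVec]
  · exact fun h => absurd (Finset.mem_univ _) h

namespace IsPrediction

variable {M η} {k : Fin κ} {p : Sample m κ → Vec m}

lemma squareIntegrable (hp : IsPrediction M η k p) : SquareIntegrable (law M η) p :=
  squareIntegrable_of_isBoundedLinearMap hp.isBoundedLinearMap

lemma squareIntegrable_error (hp : IsPrediction M η k p) :
    SquareIntegrable (law M η) fun z => freeState M z.1 k - p z :=
  (squareIntegrable_freeState M η k).sub hp.squareIntegrable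

lemma isBoundedLinearMap_innovation (hp : IsPrediction M η k p) :
    IsBoundedLinearMap ℝ (innovation M η k p) :=
  (isBoundedLinearMap_mulVec _
    (((isBoundedLinearMap_freeState M k).comp .fst).sub hp.isBoundedLinearMap)).add
    ((ContinuousLinearMap.proj (R := ℝ) (φ := fun _ : Fin κ => Vec m) k).isBoundedLinearMap.comp
      .snd)

lemma squareIntegrable_innovation (hp : IsPrediction M η k p) :
    SquareIntegrable (law M η) (innovation M η k p) :=
  squareIntegrable_of_isBoundedLinearMap hp.isBoundedLinearMap_innovation

lemma measurable_innovation (hp : IsPrediction M η k p)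
    (hgain : ∀ j : Fin (k.val + 1), j ≠ Fin.last k.val → η.gain k j = 0) :
    Measurable[openAlg M η k] (innovation M η k p) := by
  rw [show innovation M η k p = fun z => openSignal M η k z - _ from
    funext fun z => eq_sub_of_add_eq (openSignal_eq_innovation_add M η hgain p z).symm]
  exact (measurable_openSignal_openAlg M η le_rfl).sub (measurable_mulVec _ hp.measurable)

lemma error_freeState (hp : IsPrediction M η k p) :
    crossMoment (law M η) (fun z => freeState M z.1 k - p z) (fun z => freeState M z.1 k)
      = freeCov M k - crossMoment (law M η) p p := by
  have hx := squareIntegrable_freeState M η k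
  have hxp := hp.error_self
  rw [crossMoment_sub_left hx hp.squareIntegrable hp.squareIntegrable, sub_eq_zero] at hxp
  rw [crossMoment_sub_left hx hp.squareIntegrable hx, ← freeCov_eq,
    ← crossMoment_transpose (fun z => freeState M z.1 k) p, hxp, crossMoment_transpose]

lemma error_error (hp : IsPrediction M η k p) :
    crossMoment (law M η) (fun z => freeState M z.1 k - p z) (fun z => freeState M z.1 k - p z)
      = freeCov M k - crossMoment (law M η) p p := by
  rw [crossMoment_sub_right hp.squareIntegrable_error (squareIntegrable_freeState M η k)
    hp.squareIntegrable, hp.error_self, sub_zero, hp.error_freeState]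

lemma signalNoise_error (hp : IsPrediction M η k p) :
    crossMoment (law M η) (fun z => z.2 k) (fun z => freeState M z.1 k - p z) = 0 := by
  rw [crossMoment_sub_right (squareIntegrable_signalNoise M η k)
    (squareIntegrable_freeState M η k) hp.squareIntegrable, crossMoment_signalNoise_freeState,
    hp.signalNoise_self, sub_zero]

lemma error_innovation (hp : IsPrediction M η k p) :
    crossMoment (law M η) (fun z => freeState M z.1 k - p z) (innovation M η k p)
      = (freeCov M k - crossMoment (law M η) p p) * η.gain k (Fin.last k.val) := by
  have he := hp.squareIntegrable_error
  unfold innovation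
  rw [crossMoment_add_right he (he.mulVec _) (squareIntegrable_signalNoise M η k),
    crossMoment_mulVec_right he he, crossMoment_eq_zero_comm.mp hp.signalNoise_error,
    hp.error_error, Matrix.transpose_transpose, add_zero]

lemma innovation_innovation (hp : IsPrediction M η k p) :
    crossMoment (law M η) (innovation M η k p) (innovation M η k p)
      = (η.gain k (Fin.last k.val))ᵀ * (freeCov M k - crossMoment (law M η) p p)
          * η.gain k (Fin.last k.val) + η.noiseCov k := by
  have he := hp.squareIntegrable_error
  have hθe := hp.signalNoise_error
  unfold innovation
  rw [crossMoment_add_self_of_uncorrelated (he.mulVec _) (squareIntegrable_signalNoise M η k)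
    (by rw [crossMoment_mulVec_right (squareIntegrable_signalNoise M η k) he, hθe,
      Matrix.zero_mul]), crossMoment_mulVec_self he, hp.error_error,
    Matrix.transpose_transpose, crossMoment_signalNoise]

lemma innovation_crossMoment_eq_zero (hp : IsPrediction M η k p) {Y : Sample m κ → Vec m}
    (hY : SquareIntegrable (law M η) Y)
    (he : crossMoment (law M η) (fun z => freeState M z.1 k - p z) Y = 0)
    (hθ : crossMoment (law M η) (fun z => z.2 k) Y = 0) :
    crossMoment (law M η) (innovation M η k p) Y = 0 := by
  unfold innovation
  rw [crossMoment_add_left (hp.squareIntegrable_error.mulVec _)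
    (squareIntegrable_signalNoise M η k) hY, crossMoment_mulVec_left hp.squareIntegrable_error hY,
    he, hθ, Matrix.mul_zero, add_zero]

lemma innovation_self (hp : IsPrediction M η k p) :
    crossMoment (law M η) (innovation M η k p) p = 0 :=
  hp.innovation_crossMoment_eq_zero hp.squareIntegrable hp.error_self hp.signalNoise_self

lemma innovation_openSignal (hp : IsPrediction M η k p) {j : Fin κ} (hj : j < k) :
    crossMoment (law M η) (innovation M η k p) (openSignal M η j) = 0 :=
  hp.innovation_crossMoment_eq_zero (squareIntegrable_openSignal M η j)
    (hp.error_openSignal j hj) (crossMoment_signalNoise_openAlg M η hj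
      (squareIntegrable_openSignal M η j) (measurable_openSignal_openAlg M η le_rfl))

lemma isLinearEstimate_add_gain (hp : IsPrediction M η k p)
    (hgain : ∀ j : Fin (k.val + 1), j ≠ Fin.last k.val → η.gain k j = 0) {G : Mat m}
    (hG : G * crossMoment (law M η) (innovation M η k p) (innovation M η k p)
      = crossMoment (law M η) (fun z => freeState M z.1 k - p z) (innovation M η k p)) :
    IsLinearEstimate M η k fun z => p z + G *ᵥ innovation M η k p z := by
  have he := hp.squareIntegrable_error
  have hν := hp.squareIntegrable_innovation
  have hT : IsBoundedLinearMap ℝ fun z => p z + G *ᵥ innovation M η k p z :=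
    hp.isBoundedLinearMap.add (isBoundedLinearMap_mulVec G hp.isBoundedLinearMap_innovation)
  have hTm : Measurable[openAlg M η k] fun z => p z + G *ᵥ innovation M η k p z :=
    hp.measurable.add (measurable_mulVec _ (hp.measurable_innovation hgain))
  refine ⟨hT, hTm, estimate_ae_eq_of_crossMoment_eq_zero M η hT hTm fun j hj => ?_⟩
  simp only [← sub_sub]
  rcases hj.eq_or_lt with rfl | hlt
  · rw [funext (openSignal_eq_innovation_add M η hgain p),
      crossMoment_add_right (he.sub (hν.mulVec _)) hν (hp.squareIntegrable.mulVec _),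
      crossMoment_mulVec_right (he.sub (hν.mulVec _)) hp.squareIntegrable,
      crossMoment_sub_left he (hν.mulVec _) hν,
      crossMoment_sub_left he (hν.mulVec _) hp.squareIntegrable,
      crossMoment_mulVec_left hν hν, crossMoment_mulVec_left hν hp.squareIntegrable, hG,
      hp.innovation_self, hp.error_self, sub_self, Matrix.mul_zero, sub_zero, Matrix.zero_mul,
      add_zero]
  · have hs := squareIntegrable_openSignal M η j
    rw [crossMoment_sub_left he (hν.mulVec _) hs, crossMoment_mulVec_left hν hs,
      hp.innovation_openSignal hlt, hp.error_openSignal j hlt, Matrix.mul_zero, sub_zero]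

lemma crossMoment_add_gain (hp : IsPrediction M η k p) (G : Mat m) :
    crossMoment (law M η) (fun z => p z + G *ᵥ innovation M η k p z)
        (fun z => p z + G *ᵥ innovation M η k p z)
      = crossMoment (law M η) p p
        + G * crossMoment (law M η) (innovation M η k p) (innovation M η k p) * Gᵀ := by
  have hν := hp.squareIntegrable_innovation
  rw [crossMoment_add_self_of_uncorrelated hp.squareIntegrable (hν.mulVec G)
    (by rw [crossMoment_mulVec_left hν hp.squareIntegrable, hp.innovation_self, Matrix.mul_zero]),
    crossMoment_mulVec_self hν]

end IsPrediction

variable {M η}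

lemma isPrediction_zero (h : 0 < κ) : IsPrediction M η ⟨0, h⟩ fun _ => 0 where
  isBoundedLinearMap := .zero
  measurable := measurable_const
  error_openSignal _ hj := absurd hj (Nat.not_lt_zero _)
  error_self := crossMoment_zero_right
  signalNoise_self := crossMoment_zero_right

lemma IsLinearEstimate.isPrediction_succ {k : ℕ} (hk : k + 1 < κ) {T : Sample m κ → Vec m}
    (hT : IsLinearEstimate M η ⟨k, Nat.lt_of_succ_lt hk⟩ T) :
    IsPrediction M η ⟨k + 1, hk⟩ fun z => M.A *ᵥ T z := by
  have hTs : SquareIntegrable (law M η) T :=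
    squareIntegrable_of_isBoundedLinearMap hT.isBoundedLinearMap
  have hlt : (⟨k, Nat.lt_of_succ_lt hk⟩ : Fin κ) < ⟨k + 1, hk⟩ := Nat.lt_succ_self k
  have hAT := measurable_mulVec M.A hT.measurable
  have horth {Y : Sample m κ → Vec m} (hY : SquareIntegrable (law M η) Y)
      (hYm : Measurable[openAlg M η ⟨k, Nat.lt_of_succ_lt hk⟩] Y) :
      crossMoment (law M η) (fun z => freeState M z.1 ⟨k + 1, hk⟩ - M.A *ᵥ T z) Y = 0 := by
    rw [crossMoment_sub_left (squareIntegrable_freeState M η _) (hTs.mulVec _) hY,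
      crossMoment_freeState_succ M η hk hY hYm, crossMoment_mulVec_left hTs hY,
      crossMoment_congr hT.ae_eq Filter.EventuallyEq.rfl, sub_self]
  exact
    { isBoundedLinearMap := isBoundedLinearMap_mulVec M.A hT.isBoundedLinearMap
      measurable := hAT.mono (openAlg_mono M η hlt.le) le_rfl
      error_openSignal := fun j hj => horth (squareIntegrable_openSignal M η j)
        (measurable_openSignal_openAlg M η (Nat.le_of_lt_succ hj))
      error_self := horth (hTs.mulVec _) hAT
      signalNoise_self := crossMoment_signalNoise_openAlg M η hlt (hTs.mulVec _) hAT }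

lemma IsAssociatedRule.exists_isLinearEstimate {S : Fin κ → Mat m} (hS : S ∈ Feasible M)
    (hη : IsAssociatedRule M S η) {k : Fin κ} {p : Sample m κ → Vec m}
    (hp : IsPrediction M η k p) (hpS : crossMoment (law M η) p p = predicted M S k) :
    crossMoment (law M η) (estimate M η k) (estimate M η k) = S k
      ∧ ∃ T, IsLinearEstimate M η k T := by
  obtain ⟨G, hG, hGS⟩ := (hη k).2.exists_gain (hS k).2.2
    (by rw [sub_sub_sub_cancel_right]; exact (hS k).2.1)
  rw [← hpS, ← hp.innovation_innovation] at hG hGS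
  rw [← hp.error_innovation] at hG
  have hT := hp.isLinearEstimate_add_gain (hη k).1 hG
  refine ⟨?_, _, hT⟩
  rw [crossMoment_congr hT.ae_eq hT.ae_eq, hp.crossMoment_add_gain, hGS, add_sub_cancel]

theorem posteriorCov_of_isAssociatedRule {S : Fin κ → Mat m} (hS : S ∈ Feasible M)
    (hη : IsAssociatedRule M S η) (γ : ControlPolicy m r κ) : posteriorCov M η γ = S := by
  suffices hstage : ∀ k : Fin κ, crossMoment (law M η) (estimate M η k) (estimate M η k) = S k
      ∧ ∃ T, IsLinearEstimate M η k T by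
    funext k
    rw [posteriorCov_eq, (hstage k).1]
  rintro ⟨k, hk⟩
  induction k with
  | zero =>
    refine hη.exists_isLinearEstimate hS (isPrediction_zero hk) ?_
    rw [crossMoment_zero_right, predicted_zero]
  | succ k ih =>
    obtain ⟨hcov, T, hT⟩ := ih (Nat.lt_of_succ_lt hk)
    refine hη.exists_isLinearEstimate hS (hT.isPrediction_succ hk) ?_
    rw [crossMoment_mulVec_self (squareIntegrable_of_isBoundedLinearMap hT.isBoundedLinearMap),
      ← crossMoment_congr hT.ae_eq hT.ae_eq, hcov, predicted_succ]

end filter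

/-! ### Existence and equivalence -/

section posSemidefCone

variable {ι : Type*} [Finite ι]

lemma isClosed_posSemidef : IsClosed {X : Matrix ι ι ℝ | X.PosSemidef} := by
  have := Fintype.ofFinite ι
  have heq : {X : Matrix ι ι ℝ | X.PosSemidef}
      = {X | Xᵀ = X} ∩ ⋂ v : ι → ℝ, {X | 0 ≤ v ⬝ᵥ X *ᵥ v} := by
    ext X
    simp only [Set.mem_ofPred_eq, Set.mem_inter_iff, Set.mem_iInter]
    refine ⟨fun hX => ⟨transpose_eq_of_posSemidef hX, hX.dotProduct_mulVec_nonneg⟩,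
      fun ⟨hsymm, hnonneg⟩ => Matrix.PosSemidef.of_dotProduct_mulVec_nonneg ?_ hnonneg⟩
    rwa [Matrix.IsHermitian, Matrix.conjTranspose_eq_transpose_of_trivial]
  rw [heq]
  exact (isClosed_eq continuous_id.matrix_transpose continuous_id).inter
    (isClosed_iInter fun v => isClosed_le continuous_const
      (continuous_const.dotProduct (continuous_id.matrix_mulVec continuous_const)))

lemma abs_apply_le_of_posSemidef_sub {X Y : Matrix ι ι ℝ} (hX : X.PosSemidef)
    (hXY : (Y - X).PosSemidef) (i j : ι) : |X i j| ≤ Y i i + Y j j := by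
  classical
  have := Fintype.ofFinite ι
  have hquad (c : ℝ) : 0 ≤ X i i + 2 * c * X i j + c ^ 2 * X j j := by
    have hnonneg := hX.dotProduct_mulVec_nonneg (Pi.single i 1 + c • Pi.single j 1)
    have hsymm : X j i = X i j := congrFun (congrFun (transpose_eq_of_posSemidef hX) i) j
    simp only [star_trivial, Matrix.mulVec_add, Matrix.mulVec_smul, dotProduct_add, add_dotProduct,
      smul_dotProduct, dotProduct_smul, Matrix.mulVec_single_one, single_one_dotProduct,
      Matrix.col_apply, smul_eq_mul, hsymm] at hnonneg
    linarith
  have hdiag (a : ι) : 0 ≤ X a a ∧ X a a ≤ Y a a :=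
    ⟨hX.diag_nonneg, sub_nonneg.mp hXY.diag_nonneg⟩
  rw [abs_le]
  constructor <;> linarith [hquad 1, hquad (-1), hdiag i, hdiag j]

end posSemidefCone

section program

variable {m r κ : ℕ} {Ω : Type*} (M : Model m r κ Ω)

lemma continuous_predicted (k : Fin κ) : Continuous fun S => predicted M S k := by
  unfold predicted
  split_ifs
  · exact continuous_const
  · exact (continuous_const.matrix_mul (continuous_apply _)).matrix_mul continuous_const

lemma isClosed_feasible : IsClosed (Feasible M) := by
  have heq : Feasible M = ⋂ k, ({S | (S k).PosSemidef} ∩ {S | (freeCov M k - S k).PosSemidef}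
      ∩ {S | (S k - predicted M S k).PosSemidef}) := by
    ext S
    simp only [Feasible, Set.mem_ofPred_eq, Set.mem_iInter, Set.mem_inter_iff, and_assoc]
  rw [heq]
  refine isClosed_iInter fun k => ?_
  have hS : Continuous fun S : Fin κ → Mat m => S k := continuous_apply k
  exact ((isClosed_posSemidef.preimage hS).inter
    (isClosed_posSemidef.preimage (continuous_const.sub hS))).inter
    (isClosed_posSemidef.preimage (hS.sub (continuous_predicted M k)))

lemma isCompact_feasible : IsCompact (Feasible M) := by
  have hbox : IsCompact (Set.univ.pi fun k : Fin κ => Set.univ.pi fun i : Fin m =>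
      Set.univ.pi fun j : Fin m => Set.Icc (-(freeCov M k i i + freeCov M k j j))
        (freeCov M k i i + freeCov M k j j)) :=
    isCompact_univ_pi fun k => isCompact_univ_pi fun i => isCompact_univ_pi fun j => isCompact_Icc
  refine hbox.of_isClosed_subset (isClosed_feasible M) fun S hS => ?_
  simp only [Set.mem_pi, Set.mem_univ, true_imp_iff, Set.mem_Icc, ← abs_le]
  exact fun k => abs_apply_le_of_posSemidef_sub (hS k).1 (hS k).2.1

lemma lowerSemicontinuous_programValue [Fintype Ω] :
    LowerSemicontinuous (programValue M : (Fin κ → Mat m) → ℝ) := by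
  refine lowerSemicontinuous_ciSup (fun S => ?_) fun p => Continuous.lowerSemicontinuous ?_
  · refine ⟨∑ ω, |xi M ω + ∑ k, (S k * Xi M ω k).trace|, ?_⟩
    rintro _ ⟨p, rfl⟩
    refine Finset.sum_le_sum fun ω _ => (le_abs_self _).trans ?_
    rw [abs_mul, abs_of_nonneg (p.2.1 ω)]
    exact mul_le_of_le_one_left (abs_nonneg _)
      ((Finset.single_le_sum (fun ω _ => p.2.1 ω) (Finset.mem_univ ω)).trans p.2.2.le)
  · refine continuous_finsetSum _ fun ω _ => continuous_const.mul (continuous_const.add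
      (continuous_finsetSum _ fun k _ => Continuous.matrix_trace ?_))
    exact (continuous_apply k).matrix_mul continuous_const

/-- The signaling rule whose signals are all zero, a point of the search space of the sensor. -/
def silentRule (m κ : ℕ) : SignalRule m κ :=
  ⟨fun _ _ => 0, fun _ => 0, fun _ => Matrix.PosSemidef.zero⟩

lemma feasible_nonempty : (Feasible M).Nonempty :=
  ⟨_, posteriorCov_mem_feasible M (silentRule m κ) ⟨fun _ _ => 0, fun _ => measurable_const⟩⟩

theorem exists_isSolution [Fintype Ω] : ∃ S, IsSolution M S := by
  obtain ⟨S, hS, hmin⟩ := LowerSemicontinuousOn.exists_isMinOn (feasible_nonempty M)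
    (isCompact_feasible M) ((lowerSemicontinuous_programValue M).lowerSemicontinuousOn _)
  exact ⟨S, hS, fun S' hS' => hmin hS'⟩

variable {M}

theorem isEquilibrium_iff_isSolution [Fintype Ω]
    {g : SignalRule m κ → Option Ω → ControlPolicy m r κ} (hg : IsReaction M g)
    (η : SignalRule m κ) (γ : ControlPolicy m r κ) :
    IsEquilibrium M η g ↔ IsSolution M (posteriorCov M η γ) := by
  have hle (η' : SignalRule m κ) : sensorCost M η (g η) ≤ sensorCost M η' (g η') ↔
      programValue M (posteriorCov M η γ) ≤ programValue M (posteriorCov M η' γ) := by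
    rw [← EReal.coe_ennreal_le_coe_ennreal_iff, sensorCost_eq γ (hg η), sensorCost_eq γ (hg η'),
      EReal.coe_le_coe_iff]
  constructor
  · rintro ⟨-, hmin⟩
    refine ⟨posteriorCov_mem_feasible M η γ, fun S hS => ?_⟩
    obtain ⟨η', hη'⟩ := exists_isAssociatedRule M hS
    rw [← posteriorCov_of_isAssociatedRule hS hη' γ]
    exact (hle η').mp (hmin η')
  · rintro ⟨-, hmin⟩
    exact ⟨hg, fun η' => (hle η').mpr (hmin _ (posteriorCov_mem_feasible M η' γ))⟩

theorem exists_isLeast_sensorCost [Fintype Ω]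
    {g : SignalRule m κ → Option Ω → ControlPolicy m r κ} (hg : IsReaction M g) :
    ∃ v : ℝ, IsLeast (Set.range fun η => ((sensorCost M η (g η) : ℝ≥0∞) : EReal)) (v : EReal)
      ∧ IsLeast (programValue M '' Feasible M) v := by
  obtain ⟨S, hS, hmin⟩ := exists_isSolution M
  obtain ⟨η, hη⟩ := exists_isAssociatedRule M hS
  let γ : ControlPolicy m r κ := ⟨fun _ _ => 0, fun _ => measurable_const⟩
  refine ⟨programValue M S, ⟨⟨η, ?_⟩, ?_⟩, ⟨S, hS, rfl⟩, ?_⟩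
  · simp only [sensorCost_eq γ (hg η), posteriorCov_of_isAssociatedRule hS hη γ]
  · rintro _ ⟨η', rfl⟩
    simp only [sensorCost_eq γ (hg η'), EReal.coe_le_coe_iff]
    exact hmin _ (posteriorCov_mem_feasible M η' γ)
  · rintro _ ⟨S', hS', rfl⟩
    exact hmin S' hS'

end program

end RobustSensor

end

theorem corollary1 {m r κ : ℕ} {Ω : Type*} [Fintype Ω] (M : RobustSensor.Model m r κ Ω) :
    (∃ g, RobustSensor.IsReaction M g) ∧
    ∀ g : RobustSensor.SignalRule m κ → Option Ω → RobustSensor.ControlPolicy m r κ,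
      RobustSensor.IsReaction M g →
      -- every signaling rule yields a feasible point of the program, with the same value
      (∀ (η : RobustSensor.SignalRule m κ) (γ : RobustSensor.ControlPolicy m r κ),
        RobustSensor.posteriorCov M η γ ∈ RobustSensor.Feasible M ∧
        ((RobustSensor.sensorCost M η (g η) : ENNReal) : EReal) =
          ((RobustSensor.programValue M (RobustSensor.posteriorCov M η γ) : ℝ) : EReal)) ∧
      -- every feasible point comes from a signaling rule, by the explicit construction
      (∀ S ∈ RobustSensor.Feasible M,
        (∃ η, RobustSensor.IsAssociatedRule M S η) ∧
        ∀ η, RobustSensor.IsAssociatedRule M S η → ∀ γ, RobustSensor.posteriorCov M η γ = S) ∧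
      -- both minima are attained and they are equal
      (∃ v : ℝ,
        IsLeast (Set.range fun η => ((RobustSensor.sensorCost M η (g η) : ENNReal) : EReal))
          (v : EReal) ∧
        IsLeast (RobustSensor.programValue M '' RobustSensor.Feasible M) v) ∧
      -- the solutions correspond to each other
      (∀ (η : RobustSensor.SignalRule m κ) (γ : RobustSensor.ControlPolicy m r κ),
        RobustSensor.IsEquilibrium M η g ↔
          RobustSensor.IsSolution M (RobustSensor.posteriorCov M η γ)) ∧
      -- a solution of the program yields optimal signaling rules by the explicit construction
      (∀ S, RobustSensor.IsSolution M S →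
        (∃ η, RobustSensor.IsAssociatedRule M S η) ∧
        ∀ η, RobustSensor.IsAssociatedRule M S η → RobustSensor.IsEquilibrium M η g) := by
  refine ⟨RobustSensor.exists_isReaction M, fun g hg => ?_⟩
  have hassoc (S) (hS : S ∈ RobustSensor.Feasible M) : (∃ η, RobustSensor.IsAssociatedRule M S η) ∧
      ∀ η, RobustSensor.IsAssociatedRule M S η → ∀ γ, RobustSensor.posteriorCov M η γ = S :=
    ⟨RobustSensor.exists_isAssociatedRule M hS,
      fun _ hη γ => RobustSensor.posteriorCov_of_isAssociatedRule hS hη γ⟩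
  refine ⟨fun η γ => ⟨RobustSensor.posteriorCov_mem_feasible M η γ,
      RobustSensor.sensorCost_eq γ (hg η)⟩, hassoc,
    RobustSensor.exists_isLeast_sensorCost hg, RobustSensor.isEquilibrium_iff_isSolution hg,
    fun S hS => ⟨(hassoc S hS.1).1, fun η hη => ?_⟩⟩
  rwa [RobustSensor.isEquilibrium_iff_isSolution hg η (g η none), (hassoc S hS.1).2 η hη]
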